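/- Let $Z$ be a compact smooth manifold (without boundary), $N\ge 1$, and let $\mathcal A\to Z$ be a star Azumaya bundle: a smooth complex vector bundle whose fibres are $*$-algebras and which has smooth local trivializations that are, on each fibre, isomorphisms of $*$-algebras with the algebra $M_N(\mathbb C)$ of $N\times N$ matrices. Let $\mathcal P\to Z$ be its bundle of trivializations. It is the principal $\mathrm{PU}(N)$-bundle whose fibre at $z$ is the set of $*$-algebra isomorphisms $p:\mathcal A_z\to M_N(\mathbb C)$. An element $g\in\mathrm{SU}(N)$ acts on it through $\mathrm{PU}(N)$ by $(g\cdot p)(a)=g\,p(a)\,g^{*}$. A representing bundle for $\mathcal A$ is a smooth complex vector bundle $\tilde V$ over $\mathcal P$ with the following two structures. First, a smooth action of $\mathrm{SU}(N)$ on its total space which is linear between the fibres and covers the action on $\mathcal P$, and for which every element of the centre of $\mathrm{SU}(N)$ acts on each fibre as a scalar. Second, an isomorphism of bundles of algebras of $\mathcal A$ with $\hom(\tilde V)$ regarded as a bundle over $Z$, that is, a smooth family of algebra isomorphisms $\phi_p:\mathcal A_{\pi(p)}\to\hom(\tilde V_p)$, $p\in\mathcal P$, with $g\,\phi_p(a)=\phi_{g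 p}(a)\,g$ for $g\in\mathrm{SU}(N)$. Two representing bundles are equivalent if there is an isomorphism of smooth complex vector bundles over the identity of $\mathcal P$ between them which intertwines the $\mathrm{SU}(N)$-actions and the isomorphisms with $\mathcal A$. A fibre-holonomy action on a smooth complex line bundle $\tilde L$ over $\mathcal P$ is a smooth action of $\mathrm{SU}(N)$ on $\tilde L$, linear between the fibres and covering the action on $\mathcal P$, which is given by parallel transport along the fibres of $\mathcal P$ for some smooth connection on $\tilde L$ whose curvature vanishes on each fibre of $\mathcal P\to Z$: for every smooth curve $c$ in $\mathrm{SU}(N)$ with $c(0)=1$ and every $l\in\tilde L_p$, the section $t\mapsto c(t)\cdot l$ along the curve $t\mapsto c(t)\cdot p$ is parallel. Let $\tilde E=\mathcal P\times\mathbb C^N$ be the trivial bundle with the standard action $g(p,v)=(gp,gv)$ of $\mathrm{SU}(N)$. It is a representing bundle with $\phi_p(a)v=p(a)v$. Then for every representing bundle $\tilde V$ for $\mathcal A$ there is a smooth complex line bundle $\tilde L$ over $\mathcal P$ with a fibre-holonomy action of $\mathrm{SU}(N)$ such that $\tilde V$ is equivalent, as a representing bundle, to $\tilde L\otimes\tilde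 E$ with the induced (tensor product) action of $\mathrm{SU}(N)$ and the isomorphisms $a\mapsto \mathrm{id}\otimes p(a)$. -/

import Mathlib

set_option linter.unusedSectionVars false
set_option linter.unusedSimpArgs false

namespace ProjectiveBundle

open Matrix Bundle Topology
open scoped Manifold ContDiff Matrix.Norms.Operator

noncomputable section

/-- The algebra of complex `N × N` matrices. -/
abbrev Mat (N : ℕ) : Type := Matrix (Fin N) (Fin N) ℂ

/-- The topology of the matrix algebra, as induced by its norm. -/
instance (priority := high) matTopologicalSpace (N : ℕ) : TopologicalSpace (Mat N) :=
  (Matrix.linftyOpNormedAddCommGroup :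
    NormedAddCommGroup (Mat N)).toPseudoMetricSpace.toUniformSpace.toTopologicalSpace

/-- The special unitary group. -/
abbrev SU (N : ℕ) : Type := Matrix.specialUnitaryGroup (Fin N) ℂ

section PUChart

variable {N : ℕ} [NeZero N]

/-- The Cayley transform. -/
def cayley (X : Mat N) : Mat N := (1 - X) * (1 + X)⁻¹

/-- Skew-Hermitian matrices whose upper left entry vanishes: the model space of `PU(N)`. -/
def slice (N : ℕ) [NeZero N] : Submodule ℝ (Mat N) where
  carrier := {X | star X = -X ∧ X 0 0 = 0}
  zero_mem' := by simp
  add_mem' := by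
    rintro X Y ⟨h1, h2⟩ ⟨h3, h4⟩
    refine ⟨?_, by simp [h2, h4]⟩
    rw [star_add, h1, h3]; abel
  smul_mem' := by
    rintro c X ⟨h1, h2⟩
    refine ⟨?_, by simp [h2]⟩
    rw [star_smul, h1, smul_neg]; simp

/-- The projection of all matrices to the slice. -/
def sliceProj (N : ℕ) [NeZero N] : Mat N →ₗ[ℝ] slice N where
  toFun Y := ⟨(2⁻¹ : ℝ) • (Y - star Y) - Matrix.single 0 0 (((2⁻¹ : ℝ) • (Y - star Y)) 0 0), by
    constructor
    · ext i j
      by_cases h : 0 = i ∧ 0 = j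
      · obtain ⟨rfl, rfl⟩ := h
        simp
      · have h' : ¬ (0 = j ∧ 0 = i) := fun h2 => h ⟨h2.2, h2.1⟩
        simp [Matrix.single, h, h', Matrix.star_apply]
        ring
    · simp⟩
  map_add' Y Y' := by
    ext i j
    simp [Matrix.single, Matrix.star_apply]
    split_ifs <;> ring
  map_smul' c Y := by
    ext i j
    simp [Matrix.single, Matrix.star_apply]
    split_ifs <;> ring

open scoped ComplexOrder in
lemma isUnit_one_add {X : Mat N} (h : star X = -X) : IsUnit (1 + X) := by
  have h1 : IsUnit ((1 + X)ᴴ * (1 + X)) := by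
    have e : (1 + X)ᴴ * (1 + X) = 1 + Xᴴ * X := by
      have h' : Xᴴ = -X := h
      rw [Matrix.conjTranspose_add, Matrix.conjTranspose_one, h']
      noncomm_ring
    rw [e]
    exact (Matrix.PosDef.one.add_posSemidef (Matrix.posSemidef_conjTranspose_mul_self X)).isUnit
  rw [Matrix.isUnit_iff_isUnit_det, Matrix.det_mul] at h1
  rw [Matrix.isUnit_iff_isUnit_det]
  exact isUnit_of_mul_isUnit_right h1

lemma mul_inv_one {Y : Mat N} (h : IsUnit Y) : Y * Y⁻¹ = 1 :=
  Matrix.mul_nonsing_inv _ ((Matrix.isUnit_iff_isUnit_det _).1 h)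

lemma inv_mul_one {Y : Mat N} (h : IsUnit Y) : Y⁻¹ * Y = 1 :=
  Matrix.nonsing_inv_mul _ ((Matrix.isUnit_iff_isUnit_det _).1 h)

lemma cayley_eq {X : Mat N} (h : IsUnit (1 + X)) : cayley X = (2 : ℂ) • (1 + X)⁻¹ - 1 := by
  have h1 := mul_inv_one h
  have : (1 - X) * (1 + X)⁻¹ = (2 : ℂ) • (1 + X)⁻¹ - (1 + X) * (1 + X)⁻¹ := by
    rw [two_smul]; noncomm_ring
  rw [cayley, this, h1]

lemma isUnit_one_add_cayley {X : Mat N} (h : IsUnit (1 + X)) : IsUnit (1 + cayley X) := by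
  rw [cayley_eq h, add_sub_cancel]
  have : (2 : ℂ) • (1 + X)⁻¹ * ((2⁻¹ : ℂ) • (1 + X)) = 1 := by
    rw [Matrix.smul_mul, Matrix.mul_smul, inv_mul_one h, smul_smul]; norm_num
  exact IsUnit.of_mul_eq_one _ this

lemma cayley_cayley {X : Mat N} (h : IsUnit (1 + X)) : cayley (cayley X) = X := by
  have h2 : (1 + cayley X)⁻¹ = (2⁻¹ : ℂ) • (1 + X) := by
    apply Matrix.inv_eq_right_inv
    rw [cayley_eq h, add_sub_cancel, Matrix.smul_mul, Matrix.mul_smul, inv_mul_one h, smul_smul]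
    norm_num
  rw [cayley_eq (isUnit_one_add_cayley h), h2, smul_smul]
  norm_num

lemma cayley_mem_unitary {X : Mat N} (h : star X = -X) : cayley X ∈ unitary (Mat N) := by
  have u1 := isUnit_one_add h
  have u2 : IsUnit (1 - X) := by
    have := isUnit_one_add (X := -X) (by rw [star_neg, h])
    rwa [← sub_eq_add_neg] at this
  have hs : star (cayley X) = (1 - X)⁻¹ * (1 + X) := by
    have h' : Xᴴ = -X := h
    rw [cayley, star_mul]
    change ((1 + X)⁻¹)ᴴ * (1 - X)ᴴ = _
    rw [Matrix.conjTranspose_nonsing_inv, Matrix.conjTranspose_add, Matrix.conjTranspose_sub,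
      Matrix.conjTranspose_one, h', sub_neg_eq_add, ← sub_eq_add_neg]
  have hc : (1 + X) * (1 - X) = (1 - X) * (1 + X) := by noncomm_ring
  have h1 : star (cayley X) * cayley X = 1 := by
    rw [hs, cayley]
    calc (1 - X)⁻¹ * (1 + X) * ((1 - X) * (1 + X)⁻¹)
        = (1 - X)⁻¹ * ((1 + X) * (1 - X)) * (1 + X)⁻¹ := by simp only [mul_assoc]
      _ = ((1 - X)⁻¹ * (1 - X)) * ((1 + X) * (1 + X)⁻¹) := by rw [hc]; simp only [mul_assoc]
      _ = 1 := by rw [inv_mul_one u2, mul_inv_one u1, one_mul]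
  exact Unitary.mem_iff.2 ⟨h1, mul_eq_one_comm.1 h1⟩

lemma star_cayley {U : Mat N} (h : U ∈ unitary (Mat N)) (hU : IsUnit (1 + U)) :
    star (cayley U) = - cayley U := by
  have h1 : star U * U = 1 := (Unitary.mem_iff.1 h).1
  have h2 : U * star U = 1 := (Unitary.mem_iff.1 h).2
  have hR : star ((1 + U)⁻¹) = (1 + U)⁻¹ * U := by
    change ((1 + U)⁻¹)ᴴ = _
    rw [Matrix.conjTranspose_nonsing_inv]
    apply Matrix.inv_eq_left_inv
    have e : (1 + U)ᴴ = (1 + U) * star U := by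
      rw [add_mul, h2, one_mul, Matrix.conjTranspose_add, Matrix.conjTranspose_one, add_comm]; rfl
    have e2 : (1 + U) * star U = star U * (1 + U) := by
      rw [add_mul, mul_add, h1, h2]; simp
    rw [e, e2, mul_assoc, ← mul_assoc U, h2, one_mul, inv_mul_one hU]
  rw [cayley_eq hU, star_sub, star_smul, hR, star_one]
  have : (1 + U)⁻¹ * U = 1 - (1 + U)⁻¹ := by
    rw [eq_sub_iff_add_eq, ← mul_add_one, add_comm U 1, inv_mul_one hU]
  rw [this]
  simp only [RCLike.star_def, map_ofNat, smul_sub, two_smul]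
  abel

/-- For skew-Hermitian `X`, the inverse of `1 + X` has an upper left entry of positive real part. -/
lemma re_inv_pos {X : Mat N} (h : star X = -X) : 0 < ((1 + X)⁻¹ 0 0).re := by
  have u1 := isUnit_one_add h
  set R := (1 + X)⁻¹ with hR
  have h' : Xᴴ = -X := h
  have e : R + Rᴴ = (2 : ℂ) • (R * Rᴴ) := by
    have e1 : R * (1 + X) = 1 := inv_mul_one u1
    have e2 : (1 - X) * Rᴴ = 1 := by
      have := congrArg Matrix.conjTranspose e1
      rwa [Matrix.conjTranspose_mul, Matrix.conjTranspose_add, Matrix.conjTranspose_one, h',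
        ← sub_eq_add_neg] at this
    calc R + Rᴴ = R * ((1 - X) * Rᴴ) + (R * (1 + X)) * Rᴴ := by rw [e1, e2]; simp
      _ = (2 : ℂ) • (R * Rᴴ) := by rw [two_smul]; noncomm_ring
  have e3 := congrFun (congrFun e 0) 0
  have e4 : (R * Rᴴ) 0 0 = ((∑ j, Complex.normSq (R 0 j) : ℝ) : ℂ) := by
    rw [Matrix.mul_apply]; push_cast
    refine Finset.sum_congr rfl fun j _ => ?_
    rw [Matrix.conjTranspose_apply, RCLike.star_def, Complex.mul_conj]
  have e5 : (R 0 0).re = ∑ j, Complex.normSq (R 0 j) := by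
    have := congrArg Complex.re e3
    simp only [Matrix.add_apply, Matrix.smul_apply, e4, Matrix.conjTranspose_apply, smul_eq_mul,
      RCLike.star_def, Complex.add_re, Complex.conj_re] at this
    have h3 : ((2 : ℂ) * ((∑ j, Complex.normSq (R 0 j) : ℝ) : ℂ)).re
        = 2 * ∑ j, Complex.normSq (R 0 j) := by
      rw [Complex.re_mul_ofReal]; simp
    rw [h3] at this
    linarith
  rw [e5]
  refine lt_of_le_of_ne (Finset.sum_nonneg fun j _ => Complex.normSq_nonneg _) fun h0 => ?_
  have h0' := (Finset.sum_eq_zero_iff_of_nonneg fun j _ => Complex.normSq_nonneg _).1 h0.symm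
  have h6 := congrFun (congrFun (inv_mul_one u1) 0) 0
  rw [Matrix.mul_apply, Finset.sum_eq_zero] at h6
  · simp at h6
  · intro j hj
    rw [← hR, Complex.normSq_eq_zero.1 (h0' j hj), zero_mul]

/-- The effect of a change of the upper left entry on the inverse. -/
lemma inv_shift {X : Mat N} (h : star X = -X) (t : ℝ) :
    ((1 + (X + Matrix.single 0 0 ((t : ℂ) * Complex.I)) : Mat N)⁻¹ 0 0)⁻¹ =
      ((1 + X)⁻¹ 0 0)⁻¹ + t * Complex.I := by
  set s : Mat N := Matrix.single 0 0 (t * Complex.I) with hs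
  have h2 : star (X + s) = -(X + s) := by
    have hs' : star s = -s := by
      rw [hs]
      change (Matrix.single 0 0 ((t : ℂ) * Complex.I))ᴴ = _
      rw [Matrix.conjTranspose_single]
      ext i j
      simp only [Matrix.single_apply, Matrix.neg_apply]
      split_ifs <;> simp
    rw [star_add, h, hs', neg_add]
  have u1 := isUnit_one_add h
  have u2 := isUnit_one_add h2
  have p1 := re_inv_pos h
  have p2 := re_inv_pos h2
  set R := (1 + X)⁻¹ with hR
  set R' := (1 + (X + s))⁻¹ with hR'
  have e1 : R' * (1 + (X + s)) = 1 := inv_mul_one u2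
  have e2 : (1 + X) * R = 1 := mul_inv_one u1
  have e3 : R = R' + R' * s * R := by
    calc R = (R' * (1 + (X + s))) * R := by rw [e1, one_mul]
      _ = R' * ((1 + X) * R) + R' * s * R := by noncomm_ring
      _ = _ := by rw [e2, mul_one]
  have e4 : R 0 0 = R' 0 0 + R' 0 0 * (t * Complex.I) * R 0 0 := by
    have := congrFun (congrFun e3 0) 0
    have h6 : (R' * s * R) 0 0 = R' 0 0 * (t * Complex.I) * R 0 0 := by
      rw [Matrix.mul_apply, Finset.sum_eq_single 0]
      · rw [hs, Matrix.mul_single_apply_same]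
      · intro j _ hj
        rw [hs, Matrix.mul_single_apply_of_ne _ _ _ _ _ hj, zero_mul]
      · simp
    rwa [Matrix.add_apply, h6] at this
  have n1 : R 0 0 ≠ 0 := fun h => by rw [h] at p1; simp at p1
  have n2 : R' 0 0 ≠ 0 := fun h => by rw [h] at p2; simp at p2
  field_simp
  linear_combination e4

/-- The upper left entry which turns the Cayley transform of a matrix of the slice into one with
real upper left entry. -/
def shift (X : Mat N) : Mat N :=
  X + Matrix.single 0 0 (((-(((1 + X)⁻¹ 0 0)⁻¹).im : ℝ) : ℂ) * Complex.I)

lemma star_shift {X : Mat N} (h : star X = -X) : star (shift X) = -shift X := by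
  rw [shift, star_add, h, neg_add]
  congr 1
  change (Matrix.single 0 0 _)ᴴ = _
  rw [Matrix.conjTranspose_single]
  ext i j
  simp only [Matrix.single_apply, Matrix.neg_apply]
  split_ifs <;> simp

lemma im_cayley_shift {X : Mat N} (h : star X = -X) : (cayley (shift X) 0 0).im = 0 := by
  have h1 := inv_shift h (-(((1 + X)⁻¹ 0 0)⁻¹).im)
  have h2 : (((1 + shift X)⁻¹ 0 0)⁻¹).im = 0 := by
    rw [shift, h1]; simp
  have h3 : ((1 + shift X)⁻¹ 0 0).im = 0 := by
    rw [Complex.inv_im, neg_div, neg_eq_zero, div_eq_zero_iff] at h2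
    rcases h2 with h2 | h2
    · exact h2
    · rw [Complex.normSq_eq_zero.1 h2]; rfl
  rw [cayley_eq (isUnit_one_add (star_shift h))]
  simp [h3]

/-- A unitary with real upper left entry is the Cayley transform of a shifted matrix. -/
lemma shift_eq {X : Mat N} (h : star X = -X) (h0 : (cayley X 0 0).im = 0) :
    shift (X - Matrix.single 0 0 (X 0 0)) = X := by
  obtain ⟨t, ht⟩ : ∃ t : ℝ, X 0 0 = t * Complex.I := by
    have := congrFun (congrFun h 0) 0
    rw [Matrix.star_apply, Matrix.neg_apply] at this
    refine ⟨(X 0 0).im, ?_⟩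
    apply Complex.ext
    · have := congrArg Complex.re this
      simp at this
      simp; linarith
    · simp
  set Y : Mat N := X - Matrix.single 0 0 (X 0 0) with hY
  have hYs : star Y = -Y := by
    rw [hY, star_sub, h, neg_sub, sub_eq_add_neg, sub_eq_add_neg, add_comm]
    congr 1
    rw [ht]
    change -(Matrix.single 0 0 _)ᴴ = _
    rw [Matrix.conjTranspose_single]
    ext i j
    simp only [Matrix.single_apply, Matrix.neg_apply]
    split_ifs <;> simp
  have hX : X = Y + Matrix.single 0 0 ((t : ℂ) * Complex.I) := by rw [hY, ht]; abel
  have h1 := inv_shift hYs t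
  rw [← hX] at h1
  have h2 : ((1 + X)⁻¹ 0 0).im = 0 := by
    rw [cayley_eq (isUnit_one_add h)] at h0
    simpa using h0
  have h3 : (((1 + X)⁻¹ 0 0)⁻¹).im = 0 := by
    rw [Complex.inv_im, h2]; simp
  rw [h1] at h3
  have h4 : t = -(((1 + Y)⁻¹ 0 0)⁻¹).im := by
    simp at h3
    simp
    linarith
  rw [shift, ← h4, ← hX]

/-- For `β` the conjugation by a unitary `U`, this is `conj (U 0 0) • U`. -/
def gram (β : Mat N ≃⋆ₐ[ℂ] Mat N) : Mat N :=
  Matrix.of fun a b => β (Matrix.single b 0 1) a 0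

/-- Rescaling to norm one. -/
def rescale (S : Mat N) : Mat N := (((Real.sqrt (S 0 0).re)⁻¹ : ℝ) : ℂ) • S

lemma star_gram_mul_gram (β : Mat N ≃⋆ₐ[ℂ] Mat N) :
    star (gram β) * gram β = (gram β 0 0) • (1 : Mat N) := by
  ext b c
  have h1 : (star (gram β) * gram β) b c
      = (star (β (Matrix.single b 0 1)) * β (Matrix.single c 0 1)) 0 0 := by
    simp only [Matrix.mul_apply, Matrix.star_apply, gram, Matrix.of_apply]
  have h2 : star (Matrix.single b 0 1 : Mat N) = Matrix.single 0 b 1 := by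
    change (Matrix.single b 0 1)ᴴ = _
    rw [Matrix.conjTranspose_single, star_one]
  rw [h1, ← map_star, ← map_mul, h2]
  by_cases hbc : b = c
  · subst hbc
    rw [Matrix.single_mul_single_same, mul_one]
    simp [gram]
  · rw [Matrix.single_mul_single_of_ne _ _ _ _ hbc, map_zero]
    simp [Matrix.one_apply_ne hbc]

lemma gram_apply_eq (β : Mat N ≃⋆ₐ[ℂ] Mat N) :
    gram β 0 0 = ((∑ a, Complex.normSq (gram β a 0) : ℝ) : ℂ) := by
  have h := congrFun (congrFun (star_gram_mul_gram β) 0) 0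
  rw [Matrix.smul_apply, Matrix.one_apply_eq, smul_eq_mul, mul_one] at h
  rw [← h, Matrix.mul_apply]
  push_cast
  refine Finset.sum_congr rfl fun j _ => ?_
  rw [Matrix.star_apply, RCLike.star_def, mul_comm, Complex.mul_conj]

lemma gram_intertwines (β : Mat N ≃⋆ₐ[ℂ] Mat N) (A : Mat N) : β A * gram β = gram β * A := by
  ext a b
  have h1 : (β A * gram β) a b = β (A * Matrix.single b 0 1) a 0 := by
    rw [map_mul, Matrix.mul_apply, Matrix.mul_apply]; rfl
  have h2 : A * Matrix.single b 0 1 = ∑ c, A c b • (Matrix.single c 0 1 : Mat N) := by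
    ext i j
    rw [Matrix.sum_apply]
    by_cases hj : j = 0
    · subst hj
      rw [Matrix.mul_single_apply_same, Finset.sum_eq_single i]
      · simp
      · intro c _ hc; simp [Matrix.single_apply, hc]
      · simp
    · rw [Matrix.mul_single_apply_of_ne _ _ _ _ _ hj, Finset.sum_eq_zero]
      intro c _
      simp [Matrix.single_apply, Ne.symm hj]
  rw [h1, h2, map_sum, Matrix.sum_apply, Matrix.mul_apply]
  refine Finset.sum_congr rfl fun c _ => ?_
  rw [map_smul, Matrix.smul_apply, smul_eq_mul, mul_comm]; rfl

lemma rescale_mem_unitary {β : Mat N ≃⋆ₐ[ℂ] Mat N} (h : 0 < (gram β 0 0).re) :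
    rescale (gram β) ∈ unitary (Mat N) := by
  set s := (gram β 0 0).re with hs
  have hs' : gram β 0 0 = (s : ℂ) := by
    have := gram_apply_eq β
    rw [hs]; rw [this]; simp
  have h1 : star (rescale (gram β)) * rescale (gram β) = 1 := by
    rw [rescale, star_smul, Matrix.smul_mul, Matrix.mul_smul, star_gram_mul_gram, smul_smul,
      smul_smul, ← hs, hs', RCLike.star_def, Complex.conj_ofReal, ← Complex.ofReal_mul,
      ← Complex.ofReal_mul]
    have h3 : (Real.sqrt s)⁻¹ * (Real.sqrt s)⁻¹ * s = 1 := by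
      rw [← mul_inv, Real.mul_self_sqrt h.le, inv_mul_cancel₀ h.ne']
    rw [h3, Complex.ofReal_one, one_smul]
  exact Unitary.mem_iff.2 ⟨h1, mul_eq_one_comm.1 h1⟩

lemma conj_rescale {β : Mat N ≃⋆ₐ[ℂ] Mat N} (h : 0 < (gram β 0 0).re) (A : Mat N) :
    rescale (gram β) * A * star (rescale (gram β)) = β A := by
  have h2 := (Unitary.mem_iff.1 (rescale_mem_unitary h)).2
  have h3 : rescale (gram β) * A = β A * rescale (gram β) := by
    rw [rescale, Matrix.mul_smul, gram_intertwines, Matrix.smul_mul]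
  rw [h3, mul_assoc, h2, mul_one]

/-- The automorphism of the matrix algebra given by an element of the slice. -/
def conjAut (X : slice N) : Mat N ≃⋆ₐ[ℂ] Mat N :=
  Unitary.conjStarAlgAut ℂ (Mat N) ⟨cayley (shift X.1), cayley_mem_unitary (star_shift X.2.1)⟩

lemma conjAut_apply (X : slice N) (A : Mat N) :
    conjAut X A = cayley (shift X.1) * A * star (cayley (shift X.1)) := rfl

/-- The slice component of the inverse of `conjAut`, as a function of the matrix `gram β`. -/
def gramLog (S : Mat N) : slice N := sliceProj N (cayley (rescale S))

lemma sliceProj_of_skew {X : Mat N} (h : star X = -X) :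
    (sliceProj N X : Mat N) = X - Matrix.single 0 0 (X 0 0) := by
  have : (2⁻¹ : ℝ) • (X - star X) = X := by
    rw [h, sub_neg_eq_add, ← two_smul ℝ, smul_smul]; norm_num
  change (2⁻¹ : ℝ) • (X - star X) - Matrix.single 0 0 (((2⁻¹ : ℝ) • (X - star X)) 0 0) = _
  rw [this]

/-- The domain of `gramLog`. -/
def gramDom (N : ℕ) [NeZero N] : Set (Mat N) :=
  {S | 0 < (S 0 0).re ∧ (1 + rescale S).det ≠ 0}

lemma rescale_apply_zero {S : Mat N} (h0 : (S 0 0).im = 0) :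
    rescale S 0 0 = ((Real.sqrt (S 0 0).re : ℝ) : ℂ) := by
  have h1 : S 0 0 = (((S 0 0).re : ℝ) : ℂ) := Complex.ext rfl (by simpa using h0)
  rw [rescale, Matrix.smul_apply, smul_eq_mul]
  nth_rw 2 [h1]
  rw [← Complex.ofReal_mul]
  congr 1
  rcases le_or_gt (S 0 0).re 0 with h | h
  · rw [Real.sqrt_eq_zero_of_nonpos h]; simp
  · rw [inv_mul_eq_div, Real.div_sqrt]

lemma gram_conjAut (X : slice N) :
    gram (conjAut X) = cayley (shift X.1) 0 0 • cayley (shift X.1) := by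
  set U := cayley (shift X.1) with hU
  have him : (U 0 0).im = 0 := im_cayley_shift X.2.1
  have hc : star (U 0 0) = U 0 0 := Complex.conj_eq_iff_im.2 him
  ext a b
  change (U * Matrix.single b 0 1 * star U : Mat N) a 0 = _
  rw [Matrix.mul_apply, Finset.sum_eq_single 0]
  · rw [Matrix.mul_single_apply_same, Matrix.star_apply, hc, Matrix.smul_apply, smul_eq_mul]
    ring
  · intro j _ hj
    rw [Matrix.mul_single_apply_of_ne _ _ _ _ _ hj, zero_mul]
  · simp

lemma rescale_gram_conjAut {X : slice N} (h : 0 < (cayley (shift X.1) 0 0).re) :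
    rescale (gram (conjAut X)) = cayley (shift X.1) := by
  set U := cayley (shift X.1) with hU
  have him : (U 0 0).im = 0 := im_cayley_shift X.2.1
  set u := (U 0 0).re with hu
  have h1 : U 0 0 = (u : ℂ) := Complex.ext rfl (by simpa using him)
  have h2 : (gram (conjAut X) 0 0).re = u * u := by
    rw [gram_conjAut, ← hU, Matrix.smul_apply, h1, smul_eq_mul]; simp
  rw [rescale, h2, Real.sqrt_mul_self h.le, gram_conjAut, ← hU, h1, smul_smul, ← Complex.ofReal_mul,
    inv_mul_cancel₀ h.ne', Complex.ofReal_one, one_smul]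

/-- The chart of the automorphism group of the star algebra of matrices around the identity. -/
def autChart (N : ℕ) [NeZero N] : PartialEquiv (Mat N ≃⋆ₐ[ℂ] Mat N) (slice N) where
  toFun β := gramLog (gram β)
  invFun X := conjAut X
  source := {β | gram β ∈ gramDom N}
  target := {X | 0 < (cayley (shift X.1) 0 0).re}
  map_source' := by
    rintro β ⟨h1, h2⟩
    have hU := rescale_mem_unitary h1
    have u : IsUnit (1 + rescale (gram β)) :=
      (Matrix.isUnit_iff_isUnit_det _).2 (isUnit_iff_ne_zero.2 h2)
    have him : (gram β 0 0).im = 0 := by rw [gram_apply_eq]; simp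
    have h3 : shift (gramLog (gram β) : Mat N) = cayley (rescale (gram β)) := by
      rw [gramLog, sliceProj_of_skew (star_cayley hU u)]
      apply shift_eq (star_cayley hU u)
      rw [cayley_cayley u, rescale_apply_zero him]; simp
    change 0 < (cayley (shift _) 0 0).re
    rw [h3, cayley_cayley u, rescale_apply_zero him, Complex.ofReal_re]
    exact Real.sqrt_pos.2 h1
  map_target' := by
    intro X h
    have h0 := rescale_gram_conjAut h
    refine ⟨?_, ?_⟩
    · rw [gram_conjAut, Matrix.smul_apply, smul_eq_mul, Complex.mul_re, im_cayley_shift X.2.1]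
      have : 0 < (cayley (shift X.1) 0 0).re := h
      simp only [mul_zero, sub_zero]
      positivity
    · rw [h0, ← isUnit_iff_ne_zero, ← Matrix.isUnit_iff_isUnit_det]
      exact isUnit_one_add_cayley (isUnit_one_add (star_shift X.2.1))
  left_inv' := by
    rintro β ⟨h1, h2⟩
    have hU := rescale_mem_unitary h1
    have u : IsUnit (1 + rescale (gram β)) :=
      (Matrix.isUnit_iff_isUnit_det _).2 (isUnit_iff_ne_zero.2 h2)
    have him : (gram β 0 0).im = 0 := by rw [gram_apply_eq]; simp
    have h3 : shift (gramLog (gram β) : Mat N) = cayley (rescale (gram β)) := by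
      rw [gramLog, sliceProj_of_skew (star_cayley hU u)]
      apply shift_eq (star_cayley hU u)
      rw [cayley_cayley u, rescale_apply_zero him]; simp
    ext1 A
    rw [conjAut_apply, h3, cayley_cayley u, conj_rescale h1]
  right_inv' := by
    intro X h
    apply Subtype.ext
    rw [gramLog, rescale_gram_conjAut h, cayley_cayley (isUnit_one_add (star_shift X.2.1)),
      sliceProj_of_skew (star_shift X.2.1)]
    ext i j
    have h00 := X.2.2
    simp only [shift, Matrix.sub_apply, Matrix.add_apply, Matrix.single_apply]
    split_ifs <;> simp_all

lemma one_mem_autChart_source : (StarAlgEquiv.refl ℂ (Mat N) : Mat N ≃⋆ₐ[ℂ] Mat N) ∈ (autChart N).source := by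
  have h0 : gram (StarAlgEquiv.refl ℂ (Mat N) : Mat N ≃⋆ₐ[ℂ] Mat N) = 1 := by
    ext a b
    change (Matrix.single b 0 1 : Mat N) a 0 = _
    simp [Matrix.single_apply, Matrix.one_apply, eq_comm]
  have h1 : rescale (1 : Mat N) = 1 := by simp [rescale]
  refine ⟨?_, ?_⟩
  · rw [h0]; simp
  · rw [h0, h1]
    have : (1 + 1 : Mat N) = (2 : ℂ) • 1 := by rw [two_smul]
    rw [this, Matrix.det_smul]; simp

lemma isOpen_isUnit_mat : IsOpen {X : Mat N | X.det ≠ 0} :=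
  isOpen_ne_fun (Continuous.matrix_det continuous_id) continuous_const

lemma contDiffAt_inv {X : Mat N} (h : X.det ≠ 0) :
    ContDiffAt ℝ ∞ (fun Y : Mat N => Y⁻¹) X := by
  have u : IsUnit X := (Matrix.isUnit_iff_isUnit_det _).2 (isUnit_iff_ne_zero.2 h)
  obtain ⟨u, rfl⟩ := u
  have := contDiffAt_ringInverse ℝ (n := ∞) u
  refine this.congr_of_eventuallyEq (Filter.Eventually.of_forall fun Y => ?_)
  exact Matrix.nonsing_inv_eq_ringInverse Y

lemma contDiffAt_cayley {X : Mat N} (h : (1 + X).det ≠ 0) : ContDiffAt ℝ ∞ (cayley (N := N)) X := by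
  unfold cayley
  have h1 : ContDiffAt ℝ ∞ (fun Y : Mat N => (1 + Y)⁻¹) X :=
    ContDiffAt.comp X (contDiffAt_inv h) (contDiffAt_const.add contDiffAt_id)
  exact (contDiffAt_const.sub contDiffAt_id).mul h1

/-- An entry of a matrix, as a continuous linear functional. -/
def entryL (N : ℕ) (i j : Fin N) : Mat N →L[ℝ] ℂ :=
  LinearMap.toContinuousLinearMap
    { toFun := fun X => X i j, map_add' := fun _ _ => rfl, map_smul' := fun _ _ => rfl }

lemma contDiff_entry (i j : Fin N) : ContDiff ℝ ∞ (fun X : Mat N => X i j) :=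
  (entryL N i j).contDiff

lemma contDiff_smul_single (i j : Fin N) :
    ContDiff ℝ ∞ (fun z : ℂ => (Matrix.single i j z : Mat N)) :=
  (LinearMap.toContinuousLinearMap (𝕜 := ℝ)
    { toFun := fun z : ℂ => (Matrix.single i j z : Mat N)
      map_add' := fun a b => Matrix.single_add i j a b
      map_smul' := fun c a => by
        ext k l; simp [Matrix.single_apply] } : ℂ →L[ℝ] Mat N).contDiff

lemma contDiff_sliceProj : ContDiff ℝ ∞ (sliceProj N) :=
  (LinearMap.toContinuousLinearMap (sliceProj N)).contDiff

lemma contDiffAt_rescale {S : Mat N} (h : 0 < (S 0 0).re) : ContDiffAt ℝ ∞ (rescale (N := N)) S := by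
  unfold rescale
  have h0 : ContDiff ℝ ∞ (fun S : Mat N => (S 0 0).re) :=
    Complex.reCLM.contDiff.comp (contDiff_entry 0 0)
  have h1 : ContDiffAt ℝ ∞ (fun S : Mat N => (Real.sqrt (S 0 0).re)⁻¹) S :=
    (h0.contDiffAt.sqrt h.ne').inv (Real.sqrt_pos.2 h).ne'
  have h2 : ContDiffAt ℝ ∞ (fun S : Mat N => (Real.sqrt (S 0 0).re)⁻¹ • S) S :=
    h1.smul contDiffAt_id
  refine h2.congr_of_eventuallyEq (Filter.Eventually.of_forall fun Y => ?_)
  ext i j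
  simp

lemma isOpen_gramDom : IsOpen (gramDom N) := by
  have h0 : Continuous (fun S : Mat N => (S 0 0).re) :=
    Complex.continuous_re.comp (contDiff_entry 0 0).continuous
  have h1 : IsOpen {S : Mat N | 0 < (S 0 0).re} := isOpen_lt continuous_const h0
  have h2 : ContinuousOn (fun S : Mat N => 1 + rescale S) {S : Mat N | 0 < (S 0 0).re} :=
    fun S hS => (continuousAt_const.add (contDiffAt_rescale hS).continuousAt).continuousWithinAt
  exact h2.isOpen_inter_preimage h1 isOpen_isUnit_mat

lemma contDiffAt_gramLog {S : Mat N} (h : S ∈ gramDom N) : ContDiffAt ℝ ∞ (gramLog (N := N)) S := by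
  unfold gramLog
  exact contDiff_sliceProj.contDiffAt.comp S
    ((contDiffAt_cayley h.2).comp S (contDiffAt_rescale h.1))

/-- The unitary attached to an element of the slice depends smoothly on it. -/
lemma contDiff_cayley_shift : ContDiff ℝ ∞ (fun X : slice N => cayley (shift X.1)) := by
  rw [contDiff_iff_contDiffAt]
  intro X
  have hc : ContDiff ℝ ∞ (fun X : slice N => X.1) := (slice N).subtypeL.contDiff
  have u1 := Matrix.isUnit_iff_isUnit_det _ |>.1 (isUnit_one_add X.2.1)
  have u2 := Matrix.isUnit_iff_isUnit_det _ |>.1 (isUnit_one_add (star_shift X.2.1))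
  have h1 : ContDiffAt ℝ ∞ (fun X : slice N => (1 + X.1)⁻¹) X :=
    ContDiffAt.comp X (f := fun X : slice N => 1 + X.1) (contDiffAt_inv (isUnit_iff_ne_zero.1 u1))
      (contDiffAt_const.add hc.contDiffAt)
  have h2 : ContDiffAt ℝ ∞ (fun X : slice N => (1 + X.1)⁻¹ 0 0) X :=
    ContDiffAt.comp X (contDiff_entry 0 0).contDiffAt h1
  have h3 : ContDiffAt ℝ ∞ (fun X : slice N => ((1 + X.1)⁻¹ 0 0)⁻¹) X := by
    refine h2.inv fun h => ?_
    have := re_inv_pos X.2.1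
    rw [h] at this; simp at this
  have h4 : ContDiffAt ℝ ∞ (fun X : slice N => (((1 + X.1)⁻¹ 0 0)⁻¹).im) X :=
    ContDiffAt.comp X Complex.imCLM.contDiff.contDiffAt h3
  have h5 : ContDiffAt ℝ ∞
      (fun X : slice N => ((-(((1 + X.1)⁻¹ 0 0)⁻¹).im : ℝ) : ℂ) * Complex.I) X :=
    (ContDiffAt.comp X Complex.ofRealCLM.contDiff.contDiffAt h4.neg).mul contDiffAt_const
  have h6 : ContDiffAt ℝ ∞ (fun X : slice N => shift X.1) X :=
    hc.contDiffAt.add (ContDiffAt.comp X (g := fun z : ℂ => (Matrix.single 0 0 z : Mat N))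
      (contDiff_smul_single 0 0).contDiffAt h5)
  exact ContDiffAt.comp X (f := fun X : slice N => shift X.1)
    (contDiffAt_cayley (isUnit_iff_ne_zero.1 u2)) h6

lemma isOpen_autChart_target : IsOpen (autChart N).target := by
  have h : Continuous (fun X : slice N => (cayley (shift X.1) 0 0).re) :=
    Complex.continuous_re.comp ((contDiff_entry 0 0).continuous.comp contDiff_cayley_shift.continuous)
  exact isOpen_lt continuous_const h

end PUChart
section Azumaya

variable (N : ℕ) [NeZero N] (E : Type*) [NormedAddCommGroup E] [NormedSpace ℝ E]
  (Z : Type*) [TopologicalSpace Z] [ChartedSpace E Z]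

section RealBundle

variable {B : Type*} [TopologicalSpace B] (F : Type*) [NormedAddCommGroup F]
  [NormedSpace ℂ F] [NormedSpace ℝ F] [IsScalarTower ℝ ℂ F] (V : B → Type*)
  [∀ x, AddCommGroup (V x)] [∀ x, Module ℂ (V x)] [∀ x, TopologicalSpace (V x)]
  [TopologicalSpace (TotalSpace F V)] [FiberBundle F V] [VectorBundle ℂ F V]

lemma isLinear_real (e : Trivialization F (π F V)) [MemTrivializationAtlas e] : e.IsLinear ℝ :=
  ⟨fun b hb => ⟨(e.linear ℂ hb).map_add, fun c v => by
    have := (e.linear ℂ hb).map_smul (c : ℂ) v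
    rw [Complex.coe_smul] at this
    rw [this, ← algebraMap_smul ℂ c (e ⟨b, v⟩).2]; rfl⟩⟩

/-- Every complex vector bundle is a real vector bundle. -/
instance vectorBundleReal : VectorBundle ℝ F V where
  trivialization_linear' e _ := isLinear_real F V e
  continuousOn_coordChange' e e' he he' := by
    have := isLinear_real F V e
    have := isLinear_real F V e'
    have h := continuousOn_coordChange ℂ e e'
    have h2 := (ContinuousLinearMap.restrictScalarsL ℂ F F ℝ ℝ).continuous.comp_continuousOn h
    refine h2.congr fun b hb => ?_
    ext v
    change (e.coordChangeL ℝ e' b : F →L[ℝ] F) v = (e.coordChangeL ℂ e' b : F →L[ℂ] F) v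
    rw [ContinuousLinearEquiv.coe_coe, ContinuousLinearEquiv.coe_coe,
      Trivialization.coordChangeL_apply _ _ hb, Trivialization.coordChangeL_apply _ _ hb]

end RealBundle

/-- A star Azumaya bundle of `N × N` matrix algebras over `Z`: a smooth complex vector bundle whose
fibres are star algebras, with smooth local trivializations which are isomorphisms of star algebras
from each fibre to the `N × N` matrices. -/
structure AzumayaBundle where
  /-- The fibres. -/
  Fiber : Z → Type*
  [ring : ∀ z, Ring (Fiber z)]
  [algebra : ∀ z, Algebra ℂ (Fiber z)]
  [starRing : ∀ z, StarRing (Fiber z)]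
  [starModule : ∀ z, StarModule ℂ (Fiber z)]
  [topologicalSpaceFiber : ∀ z, TopologicalSpace (Fiber z)]
  [topologicalSpaceTotal : TopologicalSpace (TotalSpace (Mat N) Fiber)]
  [fiberBundle : FiberBundle (Mat N) Fiber]
  [vectorBundle : VectorBundle ℂ (Mat N) Fiber]
  [contMDiffVectorBundle : ContMDiffVectorBundle ∞ (Mat N) Fiber 𝓘(ℝ, E)]
  map_mul : ∀ z₀, ∀ z ∈ (trivializationAt (Mat N) Fiber z₀).baseSet, ∀ a b : Fiber z,
    (trivializationAt (Mat N) Fiber z₀ ⟨z, a * b⟩).2 =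
      (trivializationAt (Mat N) Fiber z₀ ⟨z, a⟩).2 * (trivializationAt (Mat N) Fiber z₀ ⟨z, b⟩).2
  map_star : ∀ z₀, ∀ z ∈ (trivializationAt (Mat N) Fiber z₀).baseSet, ∀ a : Fiber z,
    (trivializationAt (Mat N) Fiber z₀ ⟨z, star a⟩).2 =
      star (trivializationAt (Mat N) Fiber z₀ ⟨z, a⟩).2

namespace AzumayaBundle

attribute [instance] ring algebra starRing starModule topologicalSpaceFiber topologicalSpaceTotal
  fiberBundle vectorBundle contMDiffVectorBundle

variable {N E Z} (𝒜 : AzumayaBundle N E Z)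

/-- The domain of the local trivialization around `z₀`. -/
def dom (z₀ : Z) : Set Z := (trivializationAt (Mat N) 𝒜.Fiber z₀).baseSet

lemma isOpen_dom (z₀ : Z) : IsOpen (𝒜.dom z₀) :=
  (trivializationAt (Mat N) 𝒜.Fiber z₀).open_baseSet

lemma mem_dom (z₀ : Z) : z₀ ∈ 𝒜.dom z₀ := mem_baseSet_trivializationAt (Mat N) 𝒜.Fiber z₀

/-- The local trivialization around `z₀`, as a star algebra isomorphism on a fibre. -/
def frameOn (z₀ z : Z) (h : z ∈ 𝒜.dom z₀) : 𝒜.Fiber z ≃⋆ₐ[ℂ] Mat N :=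
  { (trivializationAt (Mat N) 𝒜.Fiber z₀).linearEquivAt ℂ z h with
    map_mul' := 𝒜.map_mul z₀ z h
    map_star' := 𝒜.map_star z₀ z h
    map_smul' := ((trivializationAt (Mat N) 𝒜.Fiber z₀).linearEquivAt ℂ z h).map_smul }

open Classical in
/-- The local trivialization around `z₀`, extended arbitrarily to the fibres outside its domain. -/
def frame (z₀ z : Z) : 𝒜.Fiber z ≃⋆ₐ[ℂ] Mat N :=
  if h : z ∈ 𝒜.dom z₀ then 𝒜.frameOn z₀ z h else 𝒜.frameOn z z (𝒜.mem_dom z)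

lemma frame_apply {z₀ z : Z} (h : z ∈ 𝒜.dom z₀) (a : 𝒜.Fiber z) :
    𝒜.frame z₀ z a = (trivializationAt (Mat N) 𝒜.Fiber z₀ ⟨z, a⟩).2 := by
  rw [frame, dif_pos h]; rfl

lemma frame_symm_apply {z₀ z : Z} (h : z ∈ 𝒜.dom z₀) (A : Mat N) :
    (𝒜.frame z₀ z).symm A = (trivializationAt (Mat N) 𝒜.Fiber z₀).symm z A := by
  rw [frame, dif_pos h]; rfl

lemma contMDiffOn_frame (z₀ z₁ : Z) (A : Mat N) :
    ContMDiffOn 𝓘(ℝ, E) 𝓘(ℝ, Mat N) ∞ (fun z => 𝒜.frame z₁ z ((𝒜.frame z₀ z).symm A))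
      (𝒜.dom z₀ ∩ 𝒜.dom z₁) := by
  have h := contMDiffOn_coordChangeL (n := ∞) (IB := 𝓘(ℝ, E)) (𝕜 := ℝ)
    (trivializationAt (Mat N) 𝒜.Fiber z₀) (trivializationAt (Mat N) 𝒜.Fiber z₁)
  refine (h.clm_apply (contMDiffOn_const (c := A))).congr fun z hz => ?_
  rw [ContinuousLinearEquiv.coe_coe, Trivialization.coordChangeL_apply _ _ hz,
    frame_apply _ hz.2, frame_symm_apply _ hz.1]

end AzumayaBundle

/-- The total space of the bundle of trivializations of a star Azumaya bundle: a point is a point of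
the base together with a star algebra isomorphism from the fibre there to the matrix algebra. -/
@[ext]
structure TrivBundle {N : ℕ} [NeZero N] {E : Type*} [NormedAddCommGroup E] [NormedSpace ℝ E]
    {Z : Type*} [TopologicalSpace Z] [ChartedSpace E Z] (𝒜 : AzumayaBundle N E Z) where
  /-- The projection to the base. -/
  base : Z
  /-- The isomorphism of the fibre with the matrix algebra. -/
  iso : 𝒜.Fiber base ≃⋆ₐ[ℂ] Mat N

namespace TrivBundle

variable {N E Z} {𝒜 : AzumayaBundle N E Z}

/-- A local section of the bundle of trivializations through a given point. -/
def sec (p₀ : TrivBundle 𝒜) (z : Z) : 𝒜.Fiber z ≃⋆ₐ[ℂ] Mat N :=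
  (𝒜.frame p₀.base z).trans ((𝒜.frame p₀.base p₀.base).symm.trans p₀.iso)

lemma sec_self (p₀ : TrivBundle 𝒜) : p₀.sec p₀.base = p₀.iso := by
  ext a; simp [sec]

/-- The automorphism of the matrix algebra comparing `p` with the local section through `p₀`. -/
def comp (p₀ p : TrivBundle 𝒜) : Mat N ≃⋆ₐ[ℂ] Mat N := (p₀.sec p.base).symm.trans p.iso

lemma comp_apply (p₀ p : TrivBundle 𝒜) (A : Mat N) :
    p₀.comp p A = p.iso ((p₀.sec p.base).symm A) := rfl

/-- The chart of the bundle of trivializations around `p₀`. -/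
def chart (p₀ : TrivBundle 𝒜) : PartialEquiv (TrivBundle 𝒜) (E × slice N) where
  toFun p := (chartAt E p₀.base p.base, autChart N (p₀.comp p))
  invFun x := ⟨(chartAt E p₀.base).symm x.1,
    (p₀.sec ((chartAt E p₀.base).symm x.1)).trans ((autChart N).symm x.2)⟩
  source := {p | p.base ∈ (chartAt E p₀.base).source ∧ p.base ∈ 𝒜.dom p₀.base ∧
    p₀.comp p ∈ (autChart N).source}
  target := {x | x.1 ∈ (chartAt E p₀.base).target ∧ (chartAt E p₀.base).symm x.1 ∈ 𝒜.dom p₀.base ∧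
    x.2 ∈ (autChart N).target}
  map_source' := by
    rintro p ⟨h1, h2, h3⟩
    exact ⟨(chartAt E p₀.base).map_source h1, by rwa [(chartAt E p₀.base).left_inv h1],
      (autChart N).map_source h3⟩
  map_target' := by
    rintro x ⟨h1, h2, h3⟩
    refine ⟨(chartAt E p₀.base).map_target h1, h2, ?_⟩
    have h4 := (autChart N).map_target h3
    convert h4 using 1
    ext A
    simp [comp]
  left_inv' := by
    rintro ⟨z, φ⟩ ⟨h1, h2, h3⟩
    have e1 : (chartAt E p₀.base).symm (chartAt E p₀.base z) = z := (chartAt E p₀.base).left_inv h1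
    have e2 := (autChart N).left_inv h3
    dsimp only
    rw [e2]
    have key : ∀ z' : Z, z' = z → (⟨z', (p₀.sec z').trans (p₀.comp ⟨z, φ⟩)⟩ : TrivBundle 𝒜)
        = ⟨z, φ⟩ := by
      rintro z' rfl
      congr 1
      ext a
      simp [comp]
    exact key _ e1
  right_inv' := by
    rintro ⟨h, X⟩ ⟨h1, h2, h3⟩
    refine Prod.ext ((chartAt E p₀.base).right_inv h1) ?_
    have h4 := (autChart N).right_inv h3
    dsimp only at h4 ⊢
    convert h4 using 2
    ext A
    simp [comp]

lemma mem_chart_source (p₀ : TrivBundle 𝒜) : p₀ ∈ p₀.chart.source := by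
  refine ⟨_root_.mem_chart_source E _, 𝒜.mem_dom _, ?_⟩
  have : p₀.comp p₀ = StarAlgEquiv.refl ℂ (Mat N) := by
    ext A; rw [comp_apply, sec_self]; simp
  rw [this]
  exact one_mem_autChart_source

section Smooth

variable {EM : Type*} [NormedAddCommGroup EM] [NormedSpace ℝ EM] {HM : Type*} [TopologicalSpace HM]
  {IM : ModelWithCorners ℝ EM HM} {M : Type*} [TopologicalSpace M] [ChartedSpace HM M]

lemma eventually_mem_chart_source {f : M → TrivBundle 𝒜} {s : Set M} {x₀ : M} {p₀ : TrivBundle 𝒜}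
    (h₀ : f x₀ ∈ p₀.chart.source) (hb : ContinuousWithinAt (fun x => (f x).base) s x₀)
    (hc : ∀ A, ContinuousWithinAt (fun x => p₀.comp (f x) A) s x₀) :
    ∀ᶠ x in 𝓝[s] x₀, f x ∈ p₀.chart.source := by
  have h1 := hb.eventually_mem ((chartAt E p₀.base).open_source.mem_nhds h₀.1)
  have h2 := hb.eventually_mem ((𝒜.isOpen_dom p₀.base).mem_nhds h₀.2.1)
  have hg : ContinuousWithinAt (fun x => gram (p₀.comp (f x))) s x₀ := by
    refine continuousWithinAt_pi.2 fun a => continuousWithinAt_pi.2 fun b => ?_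
    exact (contDiff_entry a 0).continuous.continuousAt.comp_continuousWithinAt
      (hc (Matrix.single b 0 1))
  have h3 := hg.eventually_mem (isOpen_gramDom.mem_nhds h₀.2.2)
  filter_upwards [h1, h2, h3] with x a b c using ⟨a, b, c⟩

lemma contMDiffWithinAt_gram {f : M → Mat N ≃⋆ₐ[ℂ] Mat N} {s : Set M} {x₀ : M}
    (hc : ∀ A, ContMDiffWithinAt IM 𝓘(ℝ, Mat N) ∞ (fun x => f x A) s x₀) :
    ContMDiffWithinAt IM 𝓘(ℝ, Mat N) ∞ (fun x => gram (f x)) s x₀ := by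
  have e : (fun x => gram (f x)) =
      fun x => ∑ a, ∑ b, (Matrix.single a b (f x (Matrix.single b 0 1) a 0) : Mat N) := by
    funext x
    exact Matrix.matrix_eq_sum_single (gram (f x))
  rw [e]
  refine contMDiffWithinAt_finsetSum fun a _ => contMDiffWithinAt_finsetSum fun b _ => ?_
  exact ((contDiff_smul_single a b).comp (contDiff_entry a 0)).contMDiff.contMDiffAt.comp_contMDiffWithinAt
    x₀ (hc (Matrix.single b 0 1))

lemma contMDiffWithinAt_chart [IsManifold 𝓘(ℝ, E) ∞ Z] {f : M → TrivBundle 𝒜} {s : Set M} {x₀ : M}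
    {p₀ : TrivBundle 𝒜} (h₀ : f x₀ ∈ p₀.chart.source)
    (hb : ContMDiffWithinAt IM 𝓘(ℝ, E) ∞ (fun x => (f x).base) s x₀)
    (hc : ∀ A, ContMDiffWithinAt IM 𝓘(ℝ, Mat N) ∞ (fun x => p₀.comp (f x) A) s x₀) :
    ContMDiffWithinAt IM 𝓘(ℝ, E × slice N) ∞ (fun x => p₀.chart (f x)) s x₀ := by
  have h1 : ContMDiffWithinAt IM 𝓘(ℝ, E) ∞ (fun x => chartAt E p₀.base (f x).base) s x₀ :=
    (contMDiffOn_chart.contMDiffAt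
      ((chartAt E p₀.base).open_source.mem_nhds h₀.1)).comp_contMDiffWithinAt x₀ hb
  have h2 : ContMDiffWithinAt IM 𝓘(ℝ, slice N) ∞ (fun x => gramLog (gram (p₀.comp (f x)))) s x₀ :=
    ContMDiffAt.comp_contMDiffWithinAt (g := gramLog (N := N)) x₀
      (contDiffAt_gramLog h₀.2.2).contMDiffAt (contMDiffWithinAt_gram hc)
  exact h1.prodMk_space h2

end Smooth

end TrivBundle

end Azumaya

section Trivializations

variable {N : ℕ} [NeZero N] {E : Type*} [NormedAddCommGroup E] [NormedSpace ℝ E]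
  {Z : Type*} [TopologicalSpace Z] [ChartedSpace E Z] {𝒜 : AzumayaBundle N E Z}

namespace TrivBundle

lemma chart_symm_base (p₁ : TrivBundle 𝒜) (x : E × slice N) :
    (p₁.chart.symm x).base = (chartAt E p₁.base).symm x.1 := rfl

lemma comp_chart_symm (p₀ p₁ : TrivBundle 𝒜) (x : E × slice N) (A : Mat N) :
    p₀.comp (p₁.chart.symm x) A =
      cayley (shift x.2.1) *
        p₁.sec ((chartAt E p₁.base).symm x.1) ((p₀.sec ((chartAt E p₁.base).symm x.1)).symm A) *
        star (cayley (shift x.2.1)) := rfl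

lemma isOpen_chart_target (p₁ : TrivBundle 𝒜) : IsOpen p₁.chart.target := by
  have h : IsOpen ((chartAt E p₁.base).target ∩ (chartAt E p₁.base).symm ⁻¹' 𝒜.dom p₁.base) :=
    (chartAt E p₁.base).symm.isOpen_inter_preimage (𝒜.isOpen_dom _)
  convert h.prod (isOpen_autChart_target (N := N)) using 1
  ext x
  exact and_assoc.symm

lemma contDiff_star : ContDiff ℝ ∞ (fun X : Mat N => star X) :=
  (LinearMap.toContinuousLinearMap (𝕜 := ℝ)
    { toFun := fun X : Mat N => star X
      map_add' := fun a b => star_add a b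
      map_smul' := fun c a => by ext k l; simp [Matrix.star_apply] } : Mat N →L[ℝ] Mat N).contDiff

/-- Expansion of a linear image of a matrix in matrix units. -/
lemma map_eq_sum {W : Type*} [AddCommGroup W] [Module ℂ W] (f : Mat N →ₗ[ℂ] W) (A : Mat N) :
    f A = ∑ a, ∑ b, A a b • f (Matrix.single a b 1) := by
  conv_lhs => rw [Matrix.matrix_eq_sum_single A]
  simp only [map_sum]
  refine Finset.sum_congr rfl fun a _ => Finset.sum_congr rfl fun b _ => ?_
  rw [← map_smul, Matrix.smul_single, smul_eq_mul, mul_one]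

section Smooth

variable {EM : Type*} [NormedAddCommGroup EM] [NormedSpace ℝ EM] {HM : Type*} [TopologicalSpace HM]
  {IM : ModelWithCorners ℝ EM HM} {M : Type*} [TopologicalSpace M] [ChartedSpace HM M]

lemma _root_.ContMDiffWithinAt.matMul {f g : M → Mat N} {s : Set M} {x₀ : M}
    (hf : ContMDiffWithinAt IM 𝓘(ℝ, Mat N) ∞ f s x₀)
    (hg : ContMDiffWithinAt IM 𝓘(ℝ, Mat N) ∞ g s x₀) :
    ContMDiffWithinAt IM 𝓘(ℝ, Mat N) ∞ (fun x => f x * g x) s x₀ := by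
  have h : ContDiff ℝ ∞ (fun p : Mat N × Mat N => p.1 * p.2) := contDiff_fst.mul contDiff_snd
  exact h.contMDiff.contMDiffAt.comp_contMDiffWithinAt x₀ (hf.prodMk_space hg)

/-- A smooth family of linear maps from matrices, applied to a smooth family of matrices. -/
lemma contMDiffWithinAt_apply {f : M → Mat N →ₗ[ℂ] Mat N} {g : M → Mat N} {s : Set M} {x₀ : M}
    (hf : ∀ A, ContMDiffWithinAt IM 𝓘(ℝ, Mat N) ∞ (fun x => f x A) s x₀)
    (hg : ContMDiffWithinAt IM 𝓘(ℝ, Mat N) ∞ g s x₀) :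
    ContMDiffWithinAt IM 𝓘(ℝ, Mat N) ∞ (fun x => f x (g x)) s x₀ := by
  have e : (fun x => f x (g x)) = fun x => ∑ a, ∑ b, g x a b • f x (Matrix.single a b 1) := by
    funext x; exact map_eq_sum (f x) (g x)
  rw [e]
  refine contMDiffWithinAt_finsetSum fun a _ => contMDiffWithinAt_finsetSum fun b _ => ?_
  have h : ContDiff ℝ ∞ (fun p : ℂ × Mat N => p.1 • p.2) := contDiff_fst.smul contDiff_snd
  have h1 : ContMDiffWithinAt IM 𝓘(ℝ, ℂ) ∞ (fun x => g x a b) s x₀ :=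
    (contDiff_entry a b).contMDiff.contMDiffAt.comp_contMDiffWithinAt x₀ hg
  exact h.contMDiff.contMDiffAt.comp_contMDiffWithinAt x₀ (h1.prodMk_space (hf _))

end Smooth

lemma contMDiffOn_sec (p₀ p₁ : TrivBundle 𝒜) (A : Mat N) :
    ContMDiffOn 𝓘(ℝ, E) 𝓘(ℝ, Mat N) ∞ (fun z => p₁.sec z ((p₀.sec z).symm A))
      (𝒜.dom p₀.base ∩ 𝒜.dom p₁.base) := by
  intro z hz
  have h := (𝒜.contMDiffOn_frame p₀.base p₁.base
    ((𝒜.frame p₀.base p₀.base) (p₀.iso.symm A))) z hz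
  let T : Mat N ≃⋆ₐ[ℂ] Mat N := (𝒜.frame p₁.base p₁.base).symm.trans p₁.iso
  exact contMDiffWithinAt_apply (f := fun _ => (T : Mat N →ₗ[ℂ] Mat N))
    (fun A => contMDiffWithinAt_const) h

variable [IsManifold 𝓘(ℝ, E) ∞ Z]

lemma contMDiffOn_base_chart_symm (p₁ : TrivBundle 𝒜) :
    ContMDiffOn 𝓘(ℝ, E × slice N) 𝓘(ℝ, E) ∞ (fun x => (p₁.chart.symm x).base) p₁.chart.target := by
  have h : ContMDiffOn 𝓘(ℝ, E) 𝓘(ℝ, E) ∞ (chartAt E p₁.base).symm (chartAt E p₁.base).target :=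
    contMDiffOn_chart_symm
  exact h.comp contDiff_fst.contMDiff.contMDiffOn fun x hx => hx.1

lemma contMDiffWithinAt_comp_chart_symm (p₀ p₁ : TrivBundle 𝒜) (A : Mat N) {x : E × slice N}
    (hx : x ∈ p₁.chart.target) (hx0 : (p₁.chart.symm x).base ∈ 𝒜.dom p₀.base) :
    ContMDiffWithinAt 𝓘(ℝ, E × slice N) 𝓘(ℝ, Mat N) ∞ (fun y => p₀.comp (p₁.chart.symm y) A)
      p₁.chart.target x := by
  have hU : ContMDiff 𝓘(ℝ, E × slice N) 𝓘(ℝ, Mat N) ∞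
      (fun y : E × slice N => cayley (shift y.2.1)) :=
    (contDiff_cayley_shift.comp contDiff_snd).contMDiff
  have hU' : ContMDiff 𝓘(ℝ, E × slice N) 𝓘(ℝ, Mat N) ∞
      (fun y : E × slice N => star (cayley (shift y.2.1))) :=
    (contDiff_star.comp (contDiff_cayley_shift.comp contDiff_snd)).contMDiff
  have hσ : ContMDiffWithinAt 𝓘(ℝ, E × slice N) 𝓘(ℝ, Mat N) ∞ (fun y : E × slice N =>
      p₁.sec ((chartAt E p₁.base).symm y.1) ((p₀.sec ((chartAt E p₁.base).symm y.1)).symm A))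
      p₁.chart.target x := by
    have h1 := (contMDiffOn_sec p₀ p₁ A).contMDiffAt
      (((𝒜.isOpen_dom _).inter (𝒜.isOpen_dom _)).mem_nhds ⟨hx0, hx.2.1⟩)
    exact ContMDiffAt.comp_contMDiffWithinAt (g := fun z => p₁.sec z ((p₀.sec z).symm A))
      (f := fun y => (p₁.chart.symm y).base) x h1 (contMDiffOn_base_chart_symm p₁ x hx)
  exact (hU.contMDiffAt.contMDiffWithinAt.matMul hσ).matMul hU'.contMDiffAt.contMDiffWithinAt

lemma chart_trans (p₀ p₁ : TrivBundle 𝒜) {x : E × slice N}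
    (hx : x ∈ (p₁.chart.symm.trans p₀.chart).source) :
    (∀ᶠ y in 𝓝 x, y ∈ (p₁.chart.symm.trans p₀.chart).source) ∧
      ContDiffAt ℝ ∞ (p₁.chart.symm.trans p₀.chart) x := by
  have hx1 : x ∈ p₁.chart.target := hx.1
  have hx2 : p₁.chart.symm x ∈ p₀.chart.source := hx.2
  have hb := contMDiffOn_base_chart_symm p₁ x hx1
  have hc := fun A => contMDiffWithinAt_comp_chart_symm p₀ p₁ A hx1 hx2.2.1
  have ho := p₁.isOpen_chart_target.mem_nhds hx1
  constructor
  · have h := eventually_mem_chart_source hx2 hb.continuousWithinAt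
      (fun A => (hc A).continuousWithinAt)
    rw [nhdsWithin_eq_nhds.2 ho] at h
    filter_upwards [ho, h] with y h1 h2 using ⟨h1, h2⟩
  · have h := contMDiffWithinAt_chart hx2 hb hc
    exact (h.contMDiffAt ho).contDiffAt

variable (𝒜) in
/-- The smooth atlas of the bundle of trivializations. -/
def core : ChartedSpaceCore (E × slice N) (TrivBundle 𝒜) where
  atlas := Set.range chart
  chartAt := chart
  mem_chart_source := mem_chart_source
  chart_mem_atlas p := Set.mem_range_self p
  open_source := by
    rintro _ _ ⟨p₁, rfl⟩ ⟨p₀, rfl⟩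
    exact isOpen_iff_mem_nhds.2 fun x hx => (chart_trans p₀ p₁ hx).1
  continuousOn_toFun := by
    rintro _ _ ⟨p₁, rfl⟩ ⟨p₀, rfl⟩
    exact fun x hx => (chart_trans p₀ p₁ hx).2.continuousAt.continuousWithinAt

instance : TopologicalSpace (TrivBundle 𝒜) := (core 𝒜).toTopologicalSpace

instance : ChartedSpace (E × slice N) (TrivBundle 𝒜) := (core 𝒜).toChartedSpace

lemma chartAt_toPartialEquiv (p : TrivBundle 𝒜) :
    (chartAt (E × slice N) p).toPartialEquiv = p.chart := rfl

instance : IsManifold 𝓘(ℝ, E × slice N) ∞ (TrivBundle 𝒜) := by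
  refine isManifold_of_contDiffOn _ _ _ ?_
  rintro e e' he he'
  obtain ⟨_, ⟨p₁, rfl⟩, rfl⟩ : ∃ c : PartialEquiv _ _, ∃ h : c ∈ (core 𝒜).atlas,
      e = (core 𝒜).openPartialHomeomorph c h := by
    have h := Set.mem_iUnion₂.1 he
    obtain ⟨c, hc, h⟩ := h
    exact ⟨c, hc, h⟩
  obtain ⟨_, ⟨p₀, rfl⟩, rfl⟩ : ∃ c : PartialEquiv _ _, ∃ h : c ∈ (core 𝒜).atlas,
      e' = (core 𝒜).openPartialHomeomorph c h := by
    have h := Set.mem_iUnion₂.1 he'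
    obtain ⟨c, hc, h⟩ := h
    exact ⟨c, hc, h⟩
  intro x hx
  exact (chart_trans p₀ p₁ hx.1).2.contDiffWithinAt

section Smooth

variable {EM : Type*} [NormedAddCommGroup EM] [NormedSpace ℝ EM] {HM : Type*} [TopologicalSpace HM]
  {IM : ModelWithCorners ℝ EM HM} {M : Type*} [TopologicalSpace M] [ChartedSpace HM M]

/-- A map to the bundle of trivializations is smooth if its projection to the base and the values of
the isomorphisms are. -/
lemma contMDiffWithinAt_of {f : M → TrivBundle 𝒜} {s : Set M} {x₀ : M}
    {p₀ : TrivBundle 𝒜} (h₀ : f x₀ ∈ p₀.chart.source)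
    (hb : ContMDiffWithinAt IM 𝓘(ℝ, E) ∞ (fun x => (f x).base) s x₀)
    (hc : ∀ A, ContMDiffWithinAt IM 𝓘(ℝ, Mat N) ∞ (fun x => p₀.comp (f x) A) s x₀) :
    ContMDiffWithinAt IM 𝓘(ℝ, E × slice N) ∞ f s x₀ := by
  have h1 := eventually_mem_chart_source h₀ hb.continuousWithinAt
      (fun A => (hc A).continuousWithinAt)
  have h2 := contMDiffWithinAt_chart h₀ hb hc
  have h3 : ContMDiffOn 𝓘(ℝ, E × slice N) 𝓘(ℝ, E × slice N) ∞
      (chartAt (E × slice N) p₀).symm (chartAt (E × slice N) p₀).target :=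
    contMDiffOn_chart_symm
  have h4 : p₀.chart (f x₀) ∈ (chartAt (E × slice N) p₀).target := p₀.chart.map_source h₀
  have h5 := (h3.contMDiffAt ((chartAt (E × slice N) p₀).open_target.mem_nhds h4)).comp_contMDiffWithinAt
    (g := (chartAt (E × slice N) p₀).symm) x₀ h2
  refine h5.congr_of_eventuallyEq ?_ (p₀.chart.left_inv h₀).symm
  filter_upwards [h1] with x hx using (p₀.chart.left_inv hx).symm

lemma contMDiff_base :
    ContMDiff 𝓘(ℝ, E × slice N) 𝓘(ℝ, E) ∞ (base : TrivBundle 𝒜 → Z) := by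
  intro p
  have h : ContMDiffOn 𝓘(ℝ, E × slice N) 𝓘(ℝ, E × slice N) ∞ (chartAt (E × slice N) p)
      (chartAt (E × slice N) p).source := contMDiffOn_chart
  have hp : p ∈ (chartAt (E × slice N) p).source := p.mem_chart_source
  have h1 := h.contMDiffAt ((chartAt (E × slice N) p).open_source.mem_nhds hp)
  have h2 := (contMDiffOn_base_chart_symm p).contMDiffAt
    (p.isOpen_chart_target.mem_nhds (p.chart.map_source hp))
  have h3 := ContMDiffAt.comp (g := fun x => (p.chart.symm x).base) p h2 h1
  refine h3.congr_of_eventuallyEq ?_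
  filter_upwards [(chartAt (E × slice N) p).open_source.mem_nhds hp] with q hq
  exact congrArg base (p.chart.left_inv hq).symm

lemma contMDiffAt_comp (p₀ : TrivBundle 𝒜) (A : Mat N) {p : TrivBundle 𝒜}
    (hp0 : p.base ∈ 𝒜.dom p₀.base) :
    ContMDiffAt 𝓘(ℝ, E × slice N) 𝓘(ℝ, Mat N) ∞ (fun q : TrivBundle 𝒜 => p₀.comp q A) p := by
  have h : ContMDiffOn 𝓘(ℝ, E × slice N) 𝓘(ℝ, E × slice N) ∞ (chartAt (E × slice N) p)
      (chartAt (E × slice N) p).source := contMDiffOn_chart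
  have hp : p ∈ (chartAt (E × slice N) p).source := p.mem_chart_source
  have h1 := h.contMDiffAt ((chartAt (E × slice N) p).open_source.mem_nhds hp)
  have ht := p.chart.map_source hp
  have h2 := (contMDiffWithinAt_comp_chart_symm p₀ p A ht
    (by rw [p.chart.left_inv hp]; exact hp0)).contMDiffAt (p.isOpen_chart_target.mem_nhds ht)
  have h3 := ContMDiffAt.comp (g := fun x => p₀.comp (p.chart.symm x) A) p h2 h1
  refine h3.congr_of_eventuallyEq ?_
  filter_upwards [(chartAt (E × slice N) p).open_source.mem_nhds hp] with q hq
  exact congrArg (fun q => p₀.comp q A) (p.chart.left_inv hq).symm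

end Smooth

/-- The unitary given by a special unitary matrix. -/
def toUnitary (g : SU N) : unitary (Mat N) := ⟨g.1, g.2.1⟩

/-- The action of `SU(N)`, which factors through `PU(N)`: composition with conjugation. -/
instance : MulAction (SU N) (TrivBundle 𝒜) where
  smul g p := ⟨p.base, p.iso.trans (Unitary.conjStarAlgAut ℂ (Mat N) (toUnitary g))⟩
  one_smul p := by
    change (⟨p.base, _⟩ : TrivBundle 𝒜) = p
    cases p with | mk z φ =>
    congr 1
    ext1 a
    change (1 : Mat N) * φ a * star (1 : Mat N) = φ a
    simp
  mul_smul g h p := by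
    change (⟨p.base, _⟩ : TrivBundle 𝒜) = ⟨p.base, _⟩
    congr 1
    ext1 a
    change ((g.1 * h.1 : Mat N)) * p.iso a * star (g.1 * h.1 : Mat N) =
      g.1 * (h.1 * p.iso a * star h.1) * star g.1
    rw [star_mul]; noncomm_ring

@[simp] lemma smul_base (g : SU N) (p : TrivBundle 𝒜) : (g • p).base = p.base := rfl

lemma smul_iso (g : SU N) (p : TrivBundle 𝒜) (a : 𝒜.Fiber p.base) :
    (g • p).iso a = g.1 * p.iso a * star g.1 := rfl

lemma comp_smul (p₀ : TrivBundle 𝒜) (g : SU N) (p : TrivBundle 𝒜) (A : Mat N) :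
    p₀.comp (g • p) A = g.1 * p₀.comp p A * star g.1 := rfl

open Classical in
/-- The action of a matrix on the bundle of trivializations, trivial outside `SU(N)`. -/
def matAct (g : Mat N) (p : TrivBundle 𝒜) : TrivBundle 𝒜 :=
  if h : g ∈ Matrix.specialUnitaryGroup (Fin N) ℂ then (⟨g, h⟩ : SU N) • p else p

lemma matAct_of_mem (g : SU N) (p : TrivBundle 𝒜) : matAct g.1 p = g • p := dif_pos g.2

lemma contMDiffWithinAt_matAct {g : Mat N} (hg : g ∈ Matrix.specialUnitaryGroup (Fin N) ℂ)
    (p : TrivBundle 𝒜) :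
    ContMDiffWithinAt (𝓘(ℝ, Mat N).prod 𝓘(ℝ, E × slice N)) 𝓘(ℝ, E × slice N) ∞
      (fun x : Mat N × TrivBundle 𝒜 => matAct x.1 x.2)
      {x | x.1 ∈ Matrix.specialUnitaryGroup (Fin N) ℂ} (g, p) := by
  have h₀ := mem_chart_source (matAct g p)
  have hbase : ∀ (h : Mat N) (q : TrivBundle 𝒜), (matAct h q).base = q.base := by
    intro h q; unfold matAct; split_ifs <;> rfl
  refine contMDiffWithinAt_of h₀ ?_ fun A => ?_
  · simp only [hbase]
    exact (contMDiff_base.contMDiffAt).comp_contMDiffWithinAt (g, p) contMDiffWithinAt_snd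
  · have h1 : ContMDiffWithinAt (𝓘(ℝ, Mat N).prod 𝓘(ℝ, E × slice N)) 𝓘(ℝ, Mat N) ∞
        (fun x : Mat N × TrivBundle 𝒜 => (matAct g p).comp x.2 A)
        {x | x.1 ∈ Matrix.specialUnitaryGroup (Fin N) ℂ} (g, p) :=
      (contMDiffAt_comp (matAct g p) A (p := p)
        (by rw [hbase]; exact 𝒜.mem_dom _)).comp_contMDiffWithinAt (g, p) contMDiffWithinAt_snd
    have h2 : ContMDiffWithinAt (𝓘(ℝ, Mat N).prod 𝓘(ℝ, E × slice N)) 𝓘(ℝ, Mat N) ∞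
        (fun x : Mat N × TrivBundle 𝒜 => star x.1)
        {x | x.1 ∈ Matrix.specialUnitaryGroup (Fin N) ℂ} (g, p) :=
      (contDiff_star.contMDiff.contMDiffAt).comp_contMDiffWithinAt (g, p) contMDiffWithinAt_fst
    refine ((contMDiffWithinAt_fst.matMul h1).matMul h2).congr ?_ ?_
    · intro x hx
      rw [show matAct x.1 x.2 = (⟨x.1, hx⟩ : SU N) • x.2 from dif_pos hx, comp_smul]
    · rw [show matAct g p = (⟨g, hg⟩ : SU N) • p from dif_pos hg, comp_smul]

end TrivBundle

end Trivializations

/-- A smooth complex vector bundle with model fibre `F` over a manifold `M` modelled on `B`. -/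
structure ComplexVectorBundle (F : Type*) [NormedAddCommGroup F] [NormedSpace ℂ F]
    [NormedSpace ℝ F] [IsScalarTower ℝ ℂ F] (B : Type*) [NormedAddCommGroup B] [NormedSpace ℝ B]
    (M : Type*) [TopologicalSpace M] [ChartedSpace B M] where
  /-- The fibres. -/
  Fiber : M → Type*
  [addCommGroup : ∀ x, AddCommGroup (Fiber x)]
  [module : ∀ x, Module ℂ (Fiber x)]
  [topologicalSpaceFiber : ∀ x, TopologicalSpace (Fiber x)]
  [topologicalSpaceTotal : TopologicalSpace (TotalSpace F Fiber)]
  [fiberBundle : FiberBundle F Fiber]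
  [vectorBundle : VectorBundle ℂ F Fiber]
  [contMDiffVectorBundle : ContMDiffVectorBundle ∞ F Fiber 𝓘(ℝ, B)]

namespace ComplexVectorBundle

attribute [instance] addCommGroup module topologicalSpaceFiber topologicalSpaceTotal fiberBundle
  vectorBundle contMDiffVectorBundle

end ComplexVectorBundle

section Bundles

variable {N : ℕ} [NeZero N] {E : Type*} [NormedAddCommGroup E] [NormedSpace ℝ E]
  {Z : Type*} [TopologicalSpace Z] [ChartedSpace E Z]

open Classical in
/-- A smooth complex vector bundle over the bundle of trivializations of an Azumaya bundle, with a
smooth action of `SU(N)` on its total space which is linear between the fibres and covers the action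
on the base. Smoothness on `SU(N) × V` is smoothness within the subset `SU(N) × V` of the
product of the space of all matrices with the total space. -/
structure EquivariantBundle (F : Type*) [NormedAddCommGroup F] [NormedSpace ℂ F]
    [NormedSpace ℝ F] [IsScalarTower ℝ ℂ F] (𝒜 : AzumayaBundle N E Z)
    [IsManifold 𝓘(ℝ, E) ∞ Z] extends
    ComplexVectorBundle F (E × slice N) (TrivBundle 𝒜) where
  /-- The action, from the fibre at `p` to the fibre at `g • p`. -/
  act : ∀ (g : SU N) (p : TrivBundle 𝒜), Fiber p →ₗ[ℂ] Fiber (g • p)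
  act_one : ∀ (p : TrivBundle 𝒜) (v : Fiber p),
    (⟨(1 : SU N) • p, act 1 p v⟩ : TotalSpace F Fiber) = ⟨p, v⟩
  act_mul : ∀ (g h : SU N) (p : TrivBundle 𝒜) (v : Fiber p),
    (⟨(g * h) • p, act (g * h) p v⟩ : TotalSpace F Fiber) = ⟨g • h • p, act g (h • p) (act h p v)⟩
  contMDiffOn_act : ContMDiffOn
    (𝓘(ℝ, Mat N).prod (𝓘(ℝ, E × slice N).prod 𝓘(ℝ, F))) (𝓘(ℝ, E × slice N).prod 𝓘(ℝ, F)) ∞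
    (fun x : Mat N × TotalSpace F Fiber =>
      if h : x.1 ∈ Matrix.specialUnitaryGroup (Fin N) ℂ then
        (⟨(⟨x.1, h⟩ : SU N) • x.2.proj, act ⟨x.1, h⟩ x.2.proj x.2.2⟩ : TotalSpace F Fiber)
      else x.2)
    {x | x.1 ∈ Matrix.specialUnitaryGroup (Fin N) ℂ}

/-- A representing bundle for the Azumaya bundle `𝒜`. Its rank is `N`, as forced by the isomorphism.
The isomorphism of `𝒜` with the bundle over the base to which `hom V` descends is given
as an equivariant isomorphism of the pullback of `𝒜` with `hom V`. The scalar
matrices in `SU(N)` are its center. -/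
structure RepresentingBundle (𝒜 : AzumayaBundle N E Z) [IsManifold 𝓘(ℝ, E) ∞ Z] extends
    EquivariantBundle (Fin N → ℂ) 𝒜 where
  act_center : ∀ (g : SU N), (∃ ζ : ℂ, (g : Mat N) = ζ • (1 : Mat N)) → ∀ p : TrivBundle 𝒜, ∃ c : ℂ,
    ∀ v : Fiber p, (⟨g • p, act g p v⟩ : TotalSpace (Fin N → ℂ) Fiber) = ⟨p, c • v⟩
  /-- The isomorphism of the fibres of `𝒜` with the endomorphisms. -/
  homIso : ∀ p : TrivBundle 𝒜, 𝒜.Fiber p.base ≃ₐ[ℂ] Module.End ℂ (Fiber p)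
  contMDiffAt_homIso : ∀ (p₀ : TrivBundle 𝒜) (a : ∀ z, 𝒜.Fiber z) (v : ∀ p, Fiber p),
    ContMDiffAt 𝓘(ℝ, E) (𝓘(ℝ, E).prod 𝓘(ℝ, Mat N)) ∞
      (fun z => (⟨z, a z⟩ : TotalSpace (Mat N) 𝒜.Fiber)) p₀.base →
    ContMDiffAt 𝓘(ℝ, E × slice N) (𝓘(ℝ, E × slice N).prod 𝓘(ℝ, Fin N → ℂ)) ∞
      (fun p => (⟨p, v p⟩ : TotalSpace (Fin N → ℂ) Fiber)) p₀ →
    ContMDiffAt 𝓘(ℝ, E × slice N) (𝓘(ℝ, E × slice N).prod 𝓘(ℝ, Fin N → ℂ)) ∞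
      (fun p => (⟨p, homIso p (a p.base) (v p)⟩ : TotalSpace (Fin N → ℂ) Fiber)) p₀
  act_homIso : ∀ (g : SU N) (p : TrivBundle 𝒜) (a : 𝒜.Fiber p.base) (v : Fiber p),
    act g p (homIso p a v) = homIso (g • p) a (act g p v)

variable {𝒜 : AzumayaBundle N E Z} [IsManifold 𝓘(ℝ, E) ∞ Z]

/-- An equivalence of representing bundles: an isomorphism of smooth vector bundles over the identity
which intertwines the actions of `SU(N)` and the isomorphisms with the Azumaya bundle. -/
structure RepresentingBundle.Equivalence (V W : RepresentingBundle 𝒜) where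
  /-- The isomorphism on the fibres. -/
  fiberEquiv : ∀ p, V.Fiber p ≃ₗ[ℂ] W.Fiber p
  contMDiff_fiberEquiv : ContMDiff (𝓘(ℝ, E × slice N).prod 𝓘(ℝ, Fin N → ℂ))
    (𝓘(ℝ, E × slice N).prod 𝓘(ℝ, Fin N → ℂ)) ∞
    (fun x : TotalSpace (Fin N → ℂ) V.Fiber =>
      (⟨x.proj, fiberEquiv x.proj x.2⟩ : TotalSpace (Fin N → ℂ) W.Fiber))
  contMDiff_fiberEquiv_symm : ContMDiff (𝓘(ℝ, E × slice N).prod 𝓘(ℝ, Fin N → ℂ))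
    (𝓘(ℝ, E × slice N).prod 𝓘(ℝ, Fin N → ℂ)) ∞
    (fun x : TotalSpace (Fin N → ℂ) W.Fiber =>
      (⟨x.proj, (fiberEquiv x.proj).symm x.2⟩ : TotalSpace (Fin N → ℂ) V.Fiber))
  fiberEquiv_act : ∀ (g : SU N) (p : TrivBundle 𝒜) (v : V.Fiber p),
    fiberEquiv (g • p) (V.act g p v) = W.act g p (fiberEquiv p v)
  fiberEquiv_homIso : ∀ (p : TrivBundle 𝒜) (a : 𝒜.Fiber p.base) (v : V.Fiber p),
    fiberEquiv p (V.homIso p a v) = W.homIso p a (fiberEquiv p v)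

section FibreHolonomy

instance {F : Type*} [NormedAddCommGroup F] [NormedSpace ℂ F] [NormedSpace ℝ F]
    [IsScalarTower ℝ ℂ F] {B : Type*} [NormedAddCommGroup B] [NormedSpace ℝ B]
    {M : Type*} [TopologicalSpace M] [ChartedSpace B M] (V : ComplexVectorBundle F B M) (x : M) :
    IsTopologicalAddGroup (V.Fiber x) :=
  (VectorBundle.continuousLinearEquivAt ℂ F V.Fiber x).toContinuousAddEquiv.isTopologicalAddGroup

instance {F : Type*} [NormedAddCommGroup F] [NormedSpace ℂ F] [NormedSpace ℝ F]
    [IsScalarTower ℝ ℂ F] {B : Type*} [NormedAddCommGroup B] [NormedSpace ℝ B]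
    {M : Type*} [TopologicalSpace M] [ChartedSpace B M] (V : ComplexVectorBundle F B M) (x : M) :
    ContinuousSMul ℝ (V.Fiber x) :=
  (VectorBundle.continuousLinearEquivAt ℝ F V.Fiber x).continuousSMul

variable (L : EquivariantBundle ℂ 𝒜)

/-- A smooth complex connection on a line bundle over the bundle of trivializations. -/
structure IsConnection (cov : CovariantDerivative 𝓘(ℝ, E × slice N) ℂ L.Fiber) : Prop where
  smooth : CovariantDerivative.ContMDiffCovariantDerivative cov ∞
  complex_linear : ∀ (c : ℂ) (σ : ∀ p, L.Fiber p) (p : TrivBundle 𝒜),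
    MDifferentiableAt 𝓘(ℝ, E × slice N) (𝓘(ℝ, E × slice N).prod 𝓘(ℝ, ℂ))
      (fun p => (⟨p, σ p⟩ : TotalSpace ℂ L.Fiber)) p →
    ∀ X : TangentSpace 𝓘(ℝ, E × slice N) p, cov (fun q => c • σ q) p X = c • cov σ p X

/-- The curvature of the restriction of a connection to every fibre of the bundle of trivializations
vanishes. -/
def IsFibreFlat (cov : CovariantDerivative 𝓘(ℝ, E × slice N) ℂ L.Fiber) : Prop :=
  ∀ (X Y : ∀ p : TrivBundle 𝒜, TangentSpace 𝓘(ℝ, E × slice N) p) (σ : ∀ p, L.Fiber p),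
    ContMDiff 𝓘(ℝ, E × slice N) 𝓘(ℝ, E × slice N).tangent ∞
      (fun p => (⟨p, X p⟩ : TangentBundle 𝓘(ℝ, E × slice N) (TrivBundle 𝒜))) →
    ContMDiff 𝓘(ℝ, E × slice N) 𝓘(ℝ, E × slice N).tangent ∞
      (fun p => (⟨p, Y p⟩ : TangentBundle 𝓘(ℝ, E × slice N) (TrivBundle 𝒜))) →
    ContMDiff 𝓘(ℝ, E × slice N) (𝓘(ℝ, E × slice N).prod 𝓘(ℝ, ℂ)) ∞
      (fun p => (⟨p, σ p⟩ : TotalSpace ℂ L.Fiber)) →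
    (∀ p, mfderiv 𝓘(ℝ, E × slice N) 𝓘(ℝ, E) (TrivBundle.base (𝒜 := 𝒜)) p (X p) = 0) →
    (∀ p, mfderiv 𝓘(ℝ, E × slice N) 𝓘(ℝ, E) (TrivBundle.base (𝒜 := 𝒜)) p (Y p) = 0) →
    ∀ p, cov (fun q => cov σ q (Y q)) p (X p) - cov (fun q => cov σ q (X q)) p (Y p) -
      cov σ p (VectorField.mlieBracket 𝓘(ℝ, E × slice N) X Y p) = 0

/-- A section `s` of a line bundle along a curve `γ` is parallel: close to every time, `s` is a
multiple `f • (σ ∘ γ)` of a smooth section `σ`, and `f' σ + f ∇_{γ'} σ = 0`. -/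
def IsParallel (cov : CovariantDerivative 𝓘(ℝ, E × slice N) ℂ L.Fiber)
    (γ : ℝ → TrivBundle 𝒜) (s : ∀ t, L.Fiber (γ t)) : Prop :=
  ∀ t₀ : ℝ, ∃ (σ : ∀ p, L.Fiber p) (f : ℝ → ℂ),
    ContMDiffAt 𝓘(ℝ, E × slice N) (𝓘(ℝ, E × slice N).prod 𝓘(ℝ, ℂ)) ∞
      (fun p => (⟨p, σ p⟩ : TotalSpace ℂ L.Fiber)) (γ t₀) ∧
    DifferentiableAt ℝ f t₀ ∧
    (∀ᶠ t in 𝓝 t₀, s t = f t • σ (γ t)) ∧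
    deriv f t₀ • σ (γ t₀) +
      f t₀ • cov σ (γ t₀) (mfderiv 𝓘(ℝ, ℝ) 𝓘(ℝ, E × slice N) γ t₀ (1 : ℝ)) = 0

/-- The action of `SU(N)` on the line bundle `L` is a fibre-holonomy action: it is parallel
transport along the fibres of the bundle of trivializations, for a connection which is flat on these
fibres. As `SU(N)` is the universal covering group of `PU(N)`, the curves in `PU(N)` starting at
the identity are the images of such curves `c` in `SU(N)`. -/
def IsFibreHolonomy : Prop :=
  ∃ cov : CovariantDerivative 𝓘(ℝ, E × slice N) ℂ L.Fiber,
    IsConnection L cov ∧ IsFibreFlat L cov ∧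
    ∀ c : ℝ → SU N, ContDiff ℝ ∞ (fun t => (c t : Mat N)) → c 0 = 1 →
      ∀ (p : TrivBundle 𝒜) (l : L.Fiber p),
        IsParallel L cov (fun t => c t • p) (fun t => L.act (c t) p l)

end FibreHolonomy

end Bundles

section LineTensor

open TensorProduct

variable {F : Type*} [NormedAddCommGroup F] [NormedSpace ℂ F] [NormedSpace ℝ F]
  [IsScalarTower ℝ ℂ F] {B : Type*} [NormedAddCommGroup B] [NormedSpace ℝ B]
  {M : Type*} [TopologicalSpace M] [ChartedSpace B M]
  (L : ComplexVectorBundle ℂ B M) (V : ComplexVectorBundle F B M)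

/-- The fibre of the tensor product of a line bundle with a vector bundle. -/
def TensorFiber (x : M) : Type _ := L.Fiber x ⊗[ℂ] V.Fiber x

namespace TensorFiber

instance (x : M) : AddCommGroup (TensorFiber L V x) :=
  inferInstanceAs (AddCommGroup (L.Fiber x ⊗[ℂ] V.Fiber x))

instance (x : M) : Module ℂ (TensorFiber L V x) :=
  inferInstanceAs (Module ℂ (L.Fiber x ⊗[ℂ] V.Fiber x))

variable {L V}

/-- Pure tensors. -/
def tmul {x : M} (l : L.Fiber x) (v : V.Fiber x) : TensorFiber L V x := l ⊗ₜ[ℂ] v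

/-- The tensor product of linear maps. -/
def map {x y : M} (f : L.Fiber x →ₗ[ℂ] L.Fiber y) (g : V.Fiber x →ₗ[ℂ] V.Fiber y) :
    TensorFiber L V x →ₗ[ℂ] TensorFiber L V y := TensorProduct.map f g

lemma map_tmul {x y : M} (f : L.Fiber x →ₗ[ℂ] L.Fiber y) (g : V.Fiber x →ₗ[ℂ] V.Fiber y)
    (l : L.Fiber x) (v : V.Fiber x) : map f g (tmul l v) = tmul (f l) (g v) :=
  TensorProduct.map_tmul f g l v

/-- The isomorphism with the model fibre given by isomorphisms of both factors. -/
def toModel {x : M} (f : L.Fiber x ≃ₗ[ℂ] ℂ) (g : V.Fiber x ≃ₗ[ℂ] F) : TensorFiber L V x ≃ₗ[ℂ] F :=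
  (TensorProduct.congr f g).trans (TensorProduct.lid ℂ F)

lemma toModel_tmul {x : M} (f : L.Fiber x ≃ₗ[ℂ] ℂ) (g : V.Fiber x ≃ₗ[ℂ] F) (l : L.Fiber x)
    (v : V.Fiber x) : toModel f g (tmul l v) = f l • g v := by
  change TensorProduct.lid ℂ F (TensorProduct.congr f g (l ⊗ₜ[ℂ] v)) = _
  rw [TensorProduct.congr_tmul, TensorProduct.lid_tmul]

lemma toModel_symm {x : M} (f : L.Fiber x ≃ₗ[ℂ] ℂ) (g : V.Fiber x ≃ₗ[ℂ] F) (w : F) :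
    (toModel f g).symm w = tmul (f.symm 1) (g.symm w) := by
  rw [LinearEquiv.symm_apply_eq, toModel_tmul]; simp

lemma eq_tmul {x : M} (f : L.Fiber x ≃ₗ[ℂ] ℂ) (g : V.Fiber x ≃ₗ[ℂ] F) (t : TensorFiber L V x) :
    t = tmul (f.symm 1) (g.symm (toModel f g t)) := by
  rw [← toModel_symm, LinearEquiv.symm_apply_apply]

end TensorFiber

namespace ComplexVectorBundle

variable {L V} in
/-- The trivialization around a point, as an isomorphism on a fibre. -/
def triv (x₀ x : M) (h : x ∈ (trivializationAt F V.Fiber x₀).baseSet) : V.Fiber x ≃ₗ[ℂ] F :=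
  (trivializationAt F V.Fiber x₀).linearEquivAt ℂ x h

lemma triv_apply (x₀ x : M) (h : x ∈ (trivializationAt F V.Fiber x₀).baseSet) (v : V.Fiber x) :
    triv x₀ x h v = (trivializationAt F V.Fiber x₀ ⟨x, v⟩).2 := rfl

lemma triv_symm_apply (x₀ x : M) (h : x ∈ (trivializationAt F V.Fiber x₀).baseSet) (w : F) :
    (triv (V := V) x₀ x h).symm w = (trivializationAt F V.Fiber x₀).symm x w := rfl

/-- The common domain of the two trivializations around `x₀`. -/
def tensorDom (x₀ : M) : Set M :=
  (trivializationAt ℂ L.Fiber x₀).baseSet ∩ (trivializationAt F V.Fiber x₀).baseSet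

lemma mem_tensorDom (x₀ : M) : x₀ ∈ tensorDom L V x₀ :=
  ⟨mem_baseSet_trivializationAt _ _ _, mem_baseSet_trivializationAt _ _ _⟩

lemma isOpen_tensorDom (x₀ : M) : IsOpen (tensorDom L V x₀) :=
  (trivializationAt ℂ L.Fiber x₀).open_baseSet.inter (trivializationAt F V.Fiber x₀).open_baseSet

/-- The tensor product of the two trivializations around `x₀`, on a fibre. -/
def tensorTriv (x₀ x : M) (h : x ∈ tensorDom L V x₀) : TensorFiber L V x ≃ₗ[ℂ] F :=
  TensorFiber.toModel (triv x₀ x h.1) (triv x₀ x h.2)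

open Classical in
/-- The tensor product of the two trivializations around `x₀`. -/
def tensorPretriv (x₀ : M) : Pretrivialization F (π F (TensorFiber L V)) where
  toFun t := (t.proj, if h : t.proj ∈ tensorDom L V x₀ then tensorTriv L V x₀ t.proj h t.2 else 0)
  invFun y := ⟨y.1, if h : y.1 ∈ tensorDom L V x₀ then (tensorTriv L V x₀ y.1 h).symm y.2 else 0⟩
  source := π F (TensorFiber L V) ⁻¹' tensorDom L V x₀
  target := tensorDom L V x₀ ×ˢ Set.univ
  map_source' t h := ⟨h, trivial⟩
  map_target' y h := h.1
  left_inv' := by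
    rintro ⟨x, t⟩ h
    have h' : x ∈ tensorDom L V x₀ := h
    simp [h']
  right_inv' := by
    rintro ⟨x, w⟩ ⟨h, -⟩
    have h' : x ∈ tensorDom L V x₀ := h
    simp [h']
  open_target := (isOpen_tensorDom L V x₀).prod isOpen_univ
  baseSet := tensorDom L V x₀
  open_baseSet := isOpen_tensorDom L V x₀
  source_eq := rfl
  target_eq := rfl
  proj_toFun t h := rfl

lemma tensorPretriv_apply (x₀ x : M) (h : x ∈ tensorDom L V x₀) (t : TensorFiber L V x) :
    (tensorPretriv L V x₀ ⟨x, t⟩).2 = tensorTriv L V x₀ x h t := dif_pos h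

lemma tensorPretriv_symm (x₀ x : M) (h : x ∈ tensorDom L V x₀) (w : F) :
    (tensorPretriv L V x₀).symm x w = (tensorTriv L V x₀ x h).symm w := by
  have h1 := tensorPretriv_apply L V x₀ x h ((tensorTriv L V x₀ x h).symm w)
  rw [LinearEquiv.apply_symm_apply] at h1
  have := (tensorPretriv L V x₀).symm_apply_apply_mk h ((tensorTriv L V x₀ x h).symm w)
  rwa [h1] at this

instance (x : M) : TopologicalSpace (TensorFiber L V x) :=
  TopologicalSpace.induced (tensorTriv L V x x (mem_tensorDom L V x)) inferInstance

lemma tensor_coordChange (x₀ x₁ x : M) (h₀ : x ∈ tensorDom L V x₀) (h₁ : x ∈ tensorDom L V x₁)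
    (w : F) : (tensorPretriv L V x₁ ⟨x, (tensorPretriv L V x₀).symm x w⟩).2 =
      ((trivializationAt ℂ L.Fiber x₀).coordChangeL ℂ (trivializationAt ℂ L.Fiber x₁) x 1) •
      ((trivializationAt F V.Fiber x₀).coordChangeL ℂ (trivializationAt F V.Fiber x₁) x w) := by
  rw [tensorPretriv_apply _ _ _ _ h₁, tensorPretriv_symm _ _ _ _ h₀, tensorTriv, tensorTriv,
    TensorFiber.toModel_symm, TensorFiber.toModel_tmul,
    Trivialization.coordChangeL_apply _ _ ⟨h₀.1, h₁.1⟩,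
    Trivialization.coordChangeL_apply _ _ ⟨h₀.2, h₁.2⟩]
  rfl

/-- The tensor product of a line bundle with a vector bundle, as a prebundle. -/
def tensorPrebundle : VectorPrebundle ℂ F (TensorFiber L V) where
  pretrivializationAtlas := Set.range (tensorPretriv L V)
  pretrivialization_linear' := by
    rintro _ ⟨x₀, rfl⟩
    refine ⟨fun x hx => ⟨fun s t => ?_, fun c t => ?_⟩⟩
    · rw [tensorPretriv_apply L V x₀ x hx, tensorPretriv_apply L V x₀ x hx,
        tensorPretriv_apply L V x₀ x hx, map_add]
    · rw [tensorPretriv_apply L V x₀ x hx, tensorPretriv_apply L V x₀ x hx, map_smul]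
  pretrivializationAt := tensorPretriv L V
  mem_base_pretrivializationAt := mem_tensorDom L V
  pretrivialization_mem_atlas x := Set.mem_range_self x
  exists_coordChange := by
    rintro _ ⟨x₀, rfl⟩ _ ⟨x₁, rfl⟩
    refine ⟨fun x =>
      ((trivializationAt ℂ L.Fiber x₀).coordChangeL ℂ (trivializationAt ℂ L.Fiber x₁) x 1 : ℂ) •
      ((trivializationAt F V.Fiber x₀).coordChangeL ℂ (trivializationAt F V.Fiber x₁) x :
        F →L[ℂ] F), ?_, ?_⟩
    · have hL := (continuousOn_coordChange ℂ (trivializationAt ℂ L.Fiber x₀)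
        (trivializationAt ℂ L.Fiber x₁)).clm_apply (continuousOn_const (c := (1 : ℂ)))
      have hV := continuousOn_coordChange ℂ (trivializationAt F V.Fiber x₀)
        (trivializationAt F V.Fiber x₁)
      exact (hL.mono fun x hx => ⟨hx.1.1, hx.2.1⟩).smul (hV.mono fun x hx => ⟨hx.1.2, hx.2.2⟩)
    · rintro x ⟨h₀, h₁⟩ w
      rw [tensor_coordChange L V x₀ x₁ x h₀ h₁]; rfl
  totalSpaceMk_isInducing x := by
    have h : (tensorPretriv L V x ∘ TotalSpace.mk x) =
        fun t => (x, tensorTriv L V x x (mem_tensorDom L V x) t) := by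
      funext t
      exact Prod.ext rfl (tensorPretriv_apply L V x x (mem_tensorDom L V x) t)
    rw [h]
    exact (isInducing_prodMkRight x).comp ⟨rfl⟩

instance : TopologicalSpace (TotalSpace F (TensorFiber L V)) :=
  (tensorPrebundle L V).totalSpaceTopology

instance : FiberBundle F (TensorFiber L V) := (tensorPrebundle L V).toFiberBundle

instance : VectorBundle ℂ F (TensorFiber L V) := (tensorPrebundle L V).toVectorBundle

lemma trivializationAt_tensor_apply (x₀ x : M) (h : x ∈ tensorDom L V x₀) (t : TensorFiber L V x) :
    (trivializationAt F (TensorFiber L V) x₀ ⟨x, t⟩).2 = tensorTriv L V x₀ x h t :=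
  tensorPretriv_apply L V x₀ x h t

instance : ContMDiffVectorBundle ∞ F (TensorFiber L V) 𝓘(ℝ, B) where
  contMDiffOn_coordChangeL := by
    intro e e' me me'
    have i1 := isLinear_real F (TensorFiber L V) e
    have i2 := isLinear_real F (TensorFiber L V) e'
    obtain ⟨_, ⟨x₀, rfl⟩, rfl⟩ := me
    obtain ⟨_, ⟨x₁, rfl⟩, rfl⟩ := me'
    have hL := (contMDiffOn_coordChangeL (n := ∞) (IB := 𝓘(ℝ, B)) (𝕜 := ℝ)
      (trivializationAt ℂ L.Fiber x₀) (trivializationAt ℂ L.Fiber x₁)).clm_apply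
        (contMDiffOn_const (c := (1 : ℂ)))
    have hV := contMDiffOn_coordChangeL (n := ∞) (IB := 𝓘(ℝ, B)) (𝕜 := ℝ)
      (trivializationAt F V.Fiber x₀) (trivializationAt F V.Fiber x₁)
    have hs : ContDiff ℝ ∞ (fun p : ℂ × (F →L[ℝ] F) => p.1 • p.2) := contDiff_fst.smul contDiff_snd
    have sL : tensorDom L V x₀ ∩ tensorDom L V x₁ ⊆
        (trivializationAt ℂ L.Fiber x₀).baseSet ∩ (trivializationAt ℂ L.Fiber x₁).baseSet :=
      fun x hx => ⟨hx.1.1, hx.2.1⟩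
    have sV : tensorDom L V x₀ ∩ tensorDom L V x₁ ⊆
        (trivializationAt F V.Fiber x₀).baseSet ∩ (trivializationAt F V.Fiber x₁).baseSet :=
      fun x hx => ⟨hx.1.2, hx.2.2⟩
    have hL' := hL.mono sL
    have hV' := hV.mono sV
    have h := hs.contMDiff.comp_contMDiffOn (hL'.prodMk_space hV')
    refine h.congr fun x hx => ?_
    ext w
    rw [ContinuousLinearEquiv.coe_coe, Trivialization.coordChangeL_apply _ _ hx]
    refine (tensor_coordChange L V x₀ x₁ x hx.1 hx.2 w).trans ?_
    simp only [Function.comp, _root_.smul_apply, ContinuousLinearEquiv.coe_coe]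
    rw [Trivialization.coordChangeL_apply _ _ ⟨hx.1.1, hx.2.1⟩,
      Trivialization.coordChangeL_apply _ _ ⟨hx.1.2, hx.2.2⟩,
      Trivialization.coordChangeL_apply _ _ ⟨hx.1.1, hx.2.1⟩,
      Trivialization.coordChangeL_apply _ _ ⟨hx.1.2, hx.2.2⟩]

/-- The tensor product `L ⊗ V` of a line bundle with a vector bundle. -/
def lineTensor : ComplexVectorBundle F B M where
  Fiber := TensorFiber L V

end ComplexVectorBundle

end LineTensor

section Twist

open TensorProduct

variable {F : Type*} [NormedAddCommGroup F] [NormedSpace ℂ F] [NormedSpace ℝ F]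
  [IsScalarTower ℝ ℂ F]

namespace TensorFiber

variable {B : Type*} [NormedAddCommGroup B] [NormedSpace ℝ B]
  {M : Type*} [TopologicalSpace M] [ChartedSpace B M]
  {L : ComplexVectorBundle ℂ B M} {V : ComplexVectorBundle F B M}

lemma exists_eq_tmul {x : M} (t : TensorFiber L V x) : ∃ l v, t = tmul (L := L) (V := V) l v :=
  ⟨_, _, eq_tmul (ComplexVectorBundle.triv x x (mem_baseSet_trivializationAt _ _ _))
    (ComplexVectorBundle.triv x x (mem_baseSet_trivializationAt _ _ _)) t⟩

lemma mk_map_eq {x y z : M} {f : L.Fiber x →ₗ[ℂ] L.Fiber y} {g : V.Fiber x →ₗ[ℂ] V.Fiber y}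
    {f' : L.Fiber x →ₗ[ℂ] L.Fiber z} {g' : V.Fiber x →ₗ[ℂ] V.Fiber z}
    (hf : ∀ l, (⟨y, f l⟩ : TotalSpace ℂ L.Fiber) = ⟨z, f' l⟩)
    (hg : ∀ v, (⟨y, g v⟩ : TotalSpace F V.Fiber) = ⟨z, g' v⟩) (t : TensorFiber L V x) :
    (⟨y, map f g t⟩ : TotalSpace F (TensorFiber L V)) = ⟨z, map f' g' t⟩ := by
  obtain rfl : y = z := congrArg TotalSpace.proj (hf 0)
  have e1 : f = f' := LinearMap.ext fun l => TotalSpace.mk_inj.1 (hf l)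
  have e2 : g = g' := LinearMap.ext fun v => TotalSpace.mk_inj.1 (hg v)
  rw [e1, e2]

lemma map_id_id {x : M} (t : TensorFiber L V x) :
    map (LinearMap.id : L.Fiber x →ₗ[ℂ] L.Fiber x) (LinearMap.id : V.Fiber x →ₗ[ℂ] V.Fiber x) t
      = t := by
  obtain ⟨l, v, rfl⟩ := exists_eq_tmul t
  rw [map_tmul]; rfl

lemma map_map {x y z : M} (f : L.Fiber x →ₗ[ℂ] L.Fiber y) (g : V.Fiber x →ₗ[ℂ] V.Fiber y)
    (f' : L.Fiber y →ₗ[ℂ] L.Fiber z) (g' : V.Fiber y →ₗ[ℂ] V.Fiber z) (t : TensorFiber L V x) :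
    map f' g' (map f g t) = map (f' ∘ₗ f) (g' ∘ₗ g) t := by
  obtain ⟨l, v, rfl⟩ := exists_eq_tmul t
  simp only [map_tmul, LinearMap.comp_apply]

/-- The identification with the fibre of the second bundle by an isomorphism of the line with `ℂ`. -/
def toRight (x : M) : TensorFiber L V x ≃ₗ[ℂ] V.Fiber x :=
  (TensorProduct.congr (ComplexVectorBundle.triv (V := L) x x (mem_baseSet_trivializationAt _ _ _))
    (LinearEquiv.refl ℂ (V.Fiber x))).trans (TensorProduct.lid ℂ (V.Fiber x))

lemma toRight_tmul {x : M} (l : L.Fiber x) (v : V.Fiber x) :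
    toRight x (tmul (L := L) l v) =
      ComplexVectorBundle.triv (V := L) x x (mem_baseSet_trivializationAt _ _ _) l • v := rfl

lemma toRight_map {x : M} (T : Module.End ℂ (V.Fiber x)) (t : TensorFiber L V x) :
    toRight x (map LinearMap.id T t) = T (toRight x t) := by
  obtain ⟨l, v, rfl⟩ := exists_eq_tmul t
  rw [map_tmul, toRight_tmul, toRight_tmul, map_smul]; rfl

/-- Endomorphisms of the tensor product with a line are endomorphisms `id ⊗ T`. -/
def endEquiv (L : ComplexVectorBundle ℂ B M) (V : ComplexVectorBundle F B M) (x : M) :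
    Module.End ℂ (V.Fiber x) ≃ₐ[ℂ] Module.End ℂ (TensorFiber L V x) where
  toFun T := map LinearMap.id T
  invFun S := (toRight x).toLinearMap ∘ₗ S ∘ₗ (toRight x).symm.toLinearMap
  left_inv T := by
    ext v
    change toRight x (map LinearMap.id T ((toRight x).symm v)) = T v
    rw [toRight_map, LinearEquiv.apply_symm_apply]
  right_inv S := by
    apply LinearMap.ext
    intro t
    apply (toRight x).injective
    rw [toRight_map]
    simp
  map_mul' T T' := by
    apply LinearMap.ext
    intro t
    change _ = map LinearMap.id T (map LinearMap.id T' t)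
    rw [map_map]; rfl
  map_add' T T' := TensorProduct.map_add_right _ _ _
  commutes' c := by
    apply LinearMap.ext
    intro t
    obtain ⟨l, v, rfl⟩ := exists_eq_tmul t
    rw [map_tmul, Module.algebraMap_end_apply, Module.algebraMap_end_apply]
    exact TensorProduct.tmul_smul c l v

lemma endEquiv_apply {x : M} (T : Module.End ℂ (V.Fiber x)) (t : TensorFiber L V x) :
    endEquiv L V x T t = map LinearMap.id T t := rfl

end TensorFiber

section TrivSymm

variable {B : Type*} [NormedAddCommGroup B] [NormedSpace ℝ B]
  {M : Type*} [TopologicalSpace M] [ChartedSpace B M] (V : ComplexVectorBundle F B M)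
  {EM : Type*} [NormedAddCommGroup EM] [NormedSpace ℝ EM] {HM : Type*} [TopologicalSpace HM]
  {IM : ModelWithCorners ℝ EM HM} {M' : Type*} [TopologicalSpace M'] [ChartedSpace HM M']

lemma ComplexVectorBundle.contMDiffWithinAt_symm [IsManifold 𝓘(ℝ, B) ∞ M] (q₀ : M) {f : M' → M}
    {w : M' → F}
    {s : Set M'} {x₀ : M'} (h₀ : f x₀ ∈ (trivializationAt F V.Fiber q₀).baseSet)
    (hf : ContMDiffWithinAt IM 𝓘(ℝ, B) ∞ f s x₀) (hw : ContMDiffWithinAt IM 𝓘(ℝ, F) ∞ w s x₀) :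
    ContMDiffWithinAt IM (𝓘(ℝ, B).prod 𝓘(ℝ, F)) ∞
      (fun x => (⟨f x, (trivializationAt F V.Fiber q₀).symm (f x) (w x)⟩ :
        TotalSpace F V.Fiber)) s x₀ := by
  rw [(trivializationAt F V.Fiber q₀).contMDiffWithinAt_iff
    ((trivializationAt F V.Fiber q₀).mem_source.2 h₀)]
  refine ⟨hf, hw.congr_of_eventuallyEq ?_ ?_⟩
  · filter_upwards [hf.continuousWithinAt.eventually_mem
      ((trivializationAt F V.Fiber q₀).open_baseSet.mem_nhds h₀)] with x hx
    rw [(trivializationAt F V.Fiber q₀).apply_mk_symm hx]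
  · rw [(trivializationAt F V.Fiber q₀).apply_mk_symm h₀]

end TrivSymm

variable {N : ℕ} [NeZero N] {E : Type*} [NormedAddCommGroup E] [NormedSpace ℝ E]
  {Z : Type*} [TopologicalSpace Z] [ChartedSpace E Z] {𝒜 : AzumayaBundle N E Z}
  [IsManifold 𝓘(ℝ, E) ∞ Z]

namespace EquivariantBundle

open ComplexVectorBundle

open Classical in
/-- The action of a matrix on the total space, trivial outside `SU(N)`. -/
def totalAct (V : EquivariantBundle F 𝒜) (x : Mat N × TotalSpace F V.Fiber) :
    TotalSpace F V.Fiber :=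
  if h : x.1 ∈ Matrix.specialUnitaryGroup (Fin N) ℂ then
    ⟨(⟨x.1, h⟩ : SU N) • x.2.proj, V.act ⟨x.1, h⟩ x.2.proj x.2.2⟩
  else x.2

lemma totalAct_of_mem (V : EquivariantBundle F 𝒜) (x : Mat N × TotalSpace F V.Fiber)
    (h : x.1 ∈ Matrix.specialUnitaryGroup (Fin N) ℂ) :
    V.totalAct x = ⟨(⟨x.1, h⟩ : SU N) • x.2.proj, V.act ⟨x.1, h⟩ x.2.proj x.2.2⟩ := dif_pos h

lemma contMDiffOn_totalAct (V : EquivariantBundle F 𝒜) : ContMDiffOn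
    (𝓘(ℝ, Mat N).prod (𝓘(ℝ, E × slice N).prod 𝓘(ℝ, F))) (𝓘(ℝ, E × slice N).prod 𝓘(ℝ, F)) ∞
    V.totalAct {x | x.1 ∈ Matrix.specialUnitaryGroup (Fin N) ℂ} := V.contMDiffOn_act

/-- The action on a section given by a local trivialization, in coordinates, is smooth. -/
lemma contMDiffWithinAt_coord (V : EquivariantBundle F 𝒜) {M' : Type*} [TopologicalSpace M']
    {EM : Type*} [NormedAddCommGroup EM] [NormedSpace ℝ EM] {HM : Type*} [TopologicalSpace HM]
    {IM : ModelWithCorners ℝ EM HM} [ChartedSpace HM M'] {g : M' → Mat N} {f : M' → TrivBundle 𝒜}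
    {w : M' → F} {s : Set M'} {x₀ : M'} {p₀ q₀ : TrivBundle 𝒜}
    (hs : ∀ x ∈ s, g x ∈ Matrix.specialUnitaryGroup (Fin N) ℂ)
    (hg : ContMDiffWithinAt IM 𝓘(ℝ, Mat N) ∞ g s x₀)
    (hf : ContMDiffWithinAt IM 𝓘(ℝ, E × slice N) ∞ f s x₀)
    (hw : ContMDiffWithinAt IM 𝓘(ℝ, F) ∞ w s x₀)
    (h₀ : g x₀ ∈ Matrix.specialUnitaryGroup (Fin N) ℂ)
    (h₁ : f x₀ ∈ (trivializationAt F V.Fiber p₀).baseSet)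
    (h₂ : (⟨g x₀, h₀⟩ : SU N) • f x₀ ∈ (trivializationAt F V.Fiber q₀).baseSet) :
    ContMDiffWithinAt IM 𝓘(ℝ, F) ∞ (fun x => (trivializationAt F V.Fiber q₀
      (V.totalAct (g x, ⟨f x, (trivializationAt F V.Fiber p₀).symm (f x) (w x)⟩))).2) s x₀ := by
  have h3 := V.toComplexVectorBundle.contMDiffWithinAt_symm p₀ h₁ hf hw
  have hm : Set.MapsTo (fun x => (g x, (⟨f x, (trivializationAt F V.Fiber p₀).symm (f x) (w x)⟩ :
      TotalSpace F V.Fiber))) s {x | x.1 ∈ Matrix.specialUnitaryGroup (Fin N) ℂ} := hs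
  have h4 := (V.contMDiffOn_totalAct (g x₀,
    ⟨f x₀, (trivializationAt F V.Fiber p₀).symm (f x₀) (w x₀)⟩) h₀).comp x₀ (hg.prodMk h3) hm
  have hp : (V.totalAct (g x₀, ⟨f x₀, (trivializationAt F V.Fiber p₀).symm (f x₀) (w x₀)⟩)).proj =
      (⟨g x₀, h₀⟩ : SU N) • f x₀ := by
    rw [totalAct_of_mem V (g x₀, ⟨f x₀, (trivializationAt F V.Fiber p₀).symm (f x₀) (w x₀)⟩) h₀]
  have h5 := ((trivializationAt F V.Fiber q₀).contMDiffWithinAt_iff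
    ((trivializationAt F V.Fiber q₀).mem_source.2 (by
      change (V.totalAct _).proj ∈ _
      rw [hp]; exact h₂))).1 h4
  exact h5.2

open Classical in
lemma contMDiffOn_tensorAct (L : EquivariantBundle ℂ 𝒜) (V : EquivariantBundle F 𝒜) : ContMDiffOn
    (𝓘(ℝ, Mat N).prod (𝓘(ℝ, E × slice N).prod 𝓘(ℝ, F))) (𝓘(ℝ, E × slice N).prod 𝓘(ℝ, F)) ∞
    (fun x : Mat N × TotalSpace F (TensorFiber L.toComplexVectorBundle V.toComplexVectorBundle) =>
      if h : x.1 ∈ Matrix.specialUnitaryGroup (Fin N) ℂ then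
        (⟨(⟨x.1, h⟩ : SU N) • x.2.proj,
          TensorFiber.map (L.act ⟨x.1, h⟩ x.2.proj) (V.act ⟨x.1, h⟩ x.2.proj) x.2.2⟩ :
          TotalSpace F (TensorFiber L.toComplexVectorBundle V.toComplexVectorBundle))
      else x.2)
    {x | x.1 ∈ Matrix.specialUnitaryGroup (Fin N) ℂ} := by
  set L' := L.toComplexVectorBundle with hL'
  set V' := V.toComplexVectorBundle with hV'
  rintro ⟨g₀, x₀⟩ hg₀
  have hg₀' : g₀ ∈ Matrix.specialUnitaryGroup (Fin N) ℂ := hg₀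
  set S : Set (Mat N × TotalSpace F (TensorFiber L' V')) :=
    {x | x.1 ∈ Matrix.specialUnitaryGroup (Fin N) ℂ}
  set p₀ := x₀.proj with hp₀
  set q₀ : TrivBundle 𝒜 := (⟨g₀, hg₀'⟩ : SU N) • p₀ with hq₀
  -- the components of the point
  have hfst : ContMDiffWithinAt (𝓘(ℝ, Mat N).prod (𝓘(ℝ, E × slice N).prod 𝓘(ℝ, F)))
      𝓘(ℝ, Mat N) ∞ (fun x : Mat N × TotalSpace F (TensorFiber L' V') => x.1) S (g₀, x₀) :=
    contMDiffWithinAt_fst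
  have hproj : ContMDiffWithinAt (𝓘(ℝ, Mat N).prod (𝓘(ℝ, E × slice N).prod 𝓘(ℝ, F)))
      𝓘(ℝ, E × slice N) ∞ (fun x : Mat N × TotalSpace F (TensorFiber L' V') => x.2.proj) S
      (g₀, x₀) :=
    (Bundle.contMDiffAt_proj (TensorFiber L' V')).comp_contMDiffWithinAt (g₀, x₀)
      contMDiffWithinAt_snd
  have hw : ContMDiffWithinAt (𝓘(ℝ, Mat N).prod (𝓘(ℝ, E × slice N).prod 𝓘(ℝ, F)))
      𝓘(ℝ, F) ∞ (fun x : Mat N × TotalSpace F (TensorFiber L' V') =>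
        (trivializationAt F (TensorFiber L' V') p₀ x.2).2) S (g₀, x₀) := by
    have h : ContMDiffWithinAt (𝓘(ℝ, Mat N).prod (𝓘(ℝ, E × slice N).prod 𝓘(ℝ, F)))
      (𝓘(ℝ, E × slice N).prod 𝓘(ℝ, F)) ∞
      (fun x : Mat N × TotalSpace F (TensorFiber L' V') => x.2) S (g₀, x₀) := contMDiffWithinAt_snd
    exact (Bundle.contMDiffWithinAt_totalSpace.1 h).2
  have hbase : ContMDiffWithinAt (𝓘(ℝ, Mat N).prod (𝓘(ℝ, E × slice N).prod 𝓘(ℝ, F)))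
      𝓘(ℝ, E × slice N) ∞ (fun x : Mat N × TotalSpace F (TensorFiber L' V') =>
        TrivBundle.matAct x.1 x.2.proj) S (g₀, x₀) :=
    (TrivBundle.contMDiffWithinAt_matAct hg₀' p₀).comp (g₀, x₀) (hfst.prodMk hproj)
      (fun x hx => hx)
  have hcL := L.contMDiffWithinAt_coord (p₀ := p₀) (q₀ := q₀) (fun x (hx : x ∈ S) => hx) hfst hproj
    (contMDiffWithinAt_const (c := (1 : ℂ))) hg₀' (mem_baseSet_trivializationAt ℂ L.Fiber p₀)
    (mem_baseSet_trivializationAt ℂ L.Fiber q₀)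
  have hcV := V.contMDiffWithinAt_coord (p₀ := p₀) (q₀ := q₀) (fun x (hx : x ∈ S) => hx) hfst hproj
    hw hg₀' (mem_baseSet_trivializationAt F V.Fiber p₀) (mem_baseSet_trivializationAt F V.Fiber q₀)
  have hs : ContDiff ℝ ∞ (fun p : ℂ × F => p.1 • p.2) := contDiff_fst.smul contDiff_snd
  have hc := hs.contMDiff.contMDiffAt.comp_contMDiffWithinAt (g₀, x₀) (hcL.prodMk_space hcV)
  -- the key identity
  have key : ∀ x ∈ S, x.2.proj ∈ tensorDom L' V' p₀ →
      TrivBundle.matAct x.1 x.2.proj ∈ tensorDom L' V' q₀ → ∀ h : x.1 ∈ Matrix.specialUnitaryGroup (Fin N) ℂ,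
      (trivializationAt F (TensorFiber L' V') q₀ (⟨(⟨x.1, h⟩ : SU N) • x.2.proj,
          TensorFiber.map (L.act ⟨x.1, h⟩ x.2.proj) (V.act ⟨x.1, h⟩ x.2.proj) x.2.2⟩ :
          TotalSpace F (TensorFiber L' V'))).2 =
      (trivializationAt ℂ L'.Fiber q₀ (L.totalAct (x.1, ⟨x.2.proj,
        (trivializationAt ℂ L'.Fiber p₀).symm x.2.proj 1⟩))).2 •
      (trivializationAt F V'.Fiber q₀ (V.totalAct (x.1, ⟨x.2.proj,
        (trivializationAt F V'.Fiber p₀).symm x.2.proj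
          (trivializationAt F (TensorFiber L' V') p₀ x.2).2⟩))).2 := by
    rintro ⟨g, ⟨p, t⟩⟩ - hp hq h
    have hq' : (⟨g, h⟩ : SU N) • p ∈ tensorDom L' V' q₀ := by
      rwa [show TrivBundle.matAct g p = _ from TrivBundle.matAct_of_mem ⟨g, h⟩ p] at hq
    have eL := totalAct_of_mem L (g, ⟨p, (trivializationAt ℂ L'.Fiber p₀).symm p 1⟩) h
    have eV := totalAct_of_mem V (g, ⟨p, (trivializationAt F V'.Fiber p₀).symm p
      (trivializationAt F (TensorFiber L' V') p₀ ⟨p, t⟩).2⟩) h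
    dsimp only at eL eV ⊢
    rw [eL, eV]
    rw [trivializationAt_tensor_apply L' V' q₀ _ hq', trivializationAt_tensor_apply L' V' p₀ _ hp]
    conv_lhs => rw [TensorFiber.eq_tmul (triv p₀ p hp.1) (triv p₀ p hp.2) t]
    rw [TensorFiber.map_tmul]
    exact TensorFiber.toModel_tmul _ _ _ _
  have ev1 : ∀ᶠ x in 𝓝[S] (g₀, x₀), x.2.proj ∈ tensorDom L' V' p₀ :=
    hproj.continuousWithinAt.eventually_mem
      ((isOpen_tensorDom L' V' p₀).mem_nhds (mem_tensorDom L' V' p₀))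
  have hq00 : TrivBundle.matAct g₀ p₀ = q₀ := TrivBundle.matAct_of_mem ⟨g₀, hg₀'⟩ p₀
  have ev2 : ∀ᶠ x in 𝓝[S] (g₀, x₀), TrivBundle.matAct x.1 x.2.proj ∈ tensorDom L' V' q₀ := by
    refine hbase.continuousWithinAt.eventually_mem ((isOpen_tensorDom L' V' q₀).mem_nhds ?_)
    change TrivBundle.matAct g₀ p₀ ∈ _
    rw [hq00]
    exact mem_tensorDom L' V' q₀
  rw [(trivializationAt F (TensorFiber L' V') q₀).contMDiffWithinAt_iff]
  · refine ⟨hbase.congr ?_ ?_, hc.congr_of_eventuallyEq ?_ ?_⟩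
    · intro x hx
      have hx' : x.1 ∈ Matrix.specialUnitaryGroup (Fin N) ℂ := hx
      rw [dif_pos hx']
      exact (TrivBundle.matAct_of_mem ⟨x.1, hx'⟩ x.2.proj).symm
    · rw [dif_pos hg₀']
      exact (TrivBundle.matAct_of_mem ⟨g₀, hg₀'⟩ p₀).symm
    · filter_upwards [ev1, ev2, self_mem_nhdsWithin] with x h1 h2 h3
      have hx' : x.1 ∈ Matrix.specialUnitaryGroup (Fin N) ℂ := h3
      rw [dif_pos hx']
      exact key x h3 h1 h2 hx'
    · rw [dif_pos hg₀']
      exact key (g₀, x₀) hg₀ (mem_tensorDom L' V' p₀) (hq00 ▸ mem_tensorDom L' V' q₀) hg₀'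
  · rw [dif_pos hg₀']
    exact (trivializationAt F (TensorFiber L' V') q₀).mem_source.2
      (mem_baseSet_trivializationAt _ _ _)

/-- The tensor product of an equivariant line bundle with an equivariant bundle, with the induced
action of `SU(N)`. -/
def lineTensor (L : EquivariantBundle ℂ 𝒜) (V : EquivariantBundle F 𝒜) : EquivariantBundle F 𝒜 where
  toComplexVectorBundle := L.toComplexVectorBundle.lineTensor V.toComplexVectorBundle
  act g p := TensorFiber.map (L := L.toComplexVectorBundle) (V := V.toComplexVectorBundle)
    (L.act g p) (V.act g p)
  act_one p t := by
    refine (TensorFiber.mk_map_eq (f' := LinearMap.id) (g' := LinearMap.id) (L.act_one p)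
      (V.act_one p) t).trans ?_
    exact congrArg (TotalSpace.mk p) (TensorFiber.map_id_id
      (L := L.toComplexVectorBundle) (V := V.toComplexVectorBundle) t)
  act_mul g h p t := by
    refine (TensorFiber.mk_map_eq (f' := L.act g (h • p) ∘ₗ L.act h p)
      (g' := V.act g (h • p) ∘ₗ V.act h p) (L.act_mul g h p) (V.act_mul g h p) t).trans ?_
    exact congrArg (TotalSpace.mk (g • h • p)) (TensorFiber.map_map
      (L := L.toComplexVectorBundle) (V := V.toComplexVectorBundle) _ _ _ _ t).symm
  contMDiffOn_act := contMDiffOn_tensorAct L V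

end EquivariantBundle

lemma ComplexVectorBundle.contMDiffAt_tensorMap {B : Type*} [NormedAddCommGroup B]
    [NormedSpace ℝ B] {M : Type*} [TopologicalSpace M] [ChartedSpace B M] [IsManifold 𝓘(ℝ, B) ∞ M]
    (L : ComplexVectorBundle ℂ B M) (V : ComplexVectorBundle F B M)
    (T : ∀ p, Module.End ℂ (V.Fiber p)) (p₀ : M)
    (hT : ∀ v : ∀ p, V.Fiber p,
      ContMDiffAt 𝓘(ℝ, B) (𝓘(ℝ, B).prod 𝓘(ℝ, F)) ∞ (fun p => (⟨p, v p⟩ : TotalSpace F V.Fiber)) p₀ →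
      ContMDiffAt 𝓘(ℝ, B) (𝓘(ℝ, B).prod 𝓘(ℝ, F)) ∞
        (fun p => (⟨p, T p (v p)⟩ : TotalSpace F V.Fiber)) p₀)
    (t : ∀ p, TensorFiber L V p)
    (ht : ContMDiffAt 𝓘(ℝ, B) (𝓘(ℝ, B).prod 𝓘(ℝ, F)) ∞
      (fun p => (⟨p, t p⟩ : TotalSpace F (TensorFiber L V))) p₀) :
    ContMDiffAt 𝓘(ℝ, B) (𝓘(ℝ, B).prod 𝓘(ℝ, F)) ∞
      (fun p => (⟨p, TensorFiber.map LinearMap.id (T p) (t p)⟩ : TotalSpace F (TensorFiber L V)))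
      p₀ := by
  have hw := (Bundle.contMDiffAt_section (s := t) p₀).1 ht
  have hv := V.contMDiffWithinAt_symm (s := Set.univ) (x₀ := p₀) (f := fun p => p) p₀
    (mem_baseSet_trivializationAt F V.Fiber p₀) contMDiffWithinAt_id hw
  have h1 := hT _ hv
  have h2 := (Bundle.contMDiffAt_section p₀).1 h1
  refine (Bundle.contMDiffAt_section p₀).2 ?_
  refine h2.congr_of_eventuallyEq ?_
  filter_upwards [(isOpen_tensorDom L V p₀).mem_nhds (mem_tensorDom L V p₀)] with p hp
  rw [trivializationAt_tensor_apply L V p₀ p hp, trivializationAt_tensor_apply L V p₀ p hp]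
  conv_lhs => rw [TensorFiber.eq_tmul (triv p₀ p hp.1) (triv p₀ p hp.2) (t p)]
  rw [TensorFiber.map_tmul, tensorTriv, TensorFiber.toModel_tmul,
    LinearMap.id_apply, LinearEquiv.apply_symm_apply, one_smul]
  rfl

/-- A linear map between the fibres of a line bundle over equal points is a scalar. -/
lemma EquivariantBundle.exists_scalar (L : EquivariantBundle ℂ 𝒜) {p q : TrivBundle 𝒜} (h : q = p)
    (f : L.Fiber p →ₗ[ℂ] L.Fiber q) :
    ∃ c : ℂ, ∀ l, (⟨q, f l⟩ : TotalSpace ℂ L.Fiber) = ⟨p, c • l⟩ := by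
  subst h
  let e : L.Fiber q ≃ₗ[ℂ] ℂ := ComplexVectorBundle.triv (V := L.toComplexVectorBundle) q q
    (mem_baseSet_trivializationAt _ _ _)
  refine ⟨e (f (e.symm 1)), fun l => ?_⟩
  congr 1
  apply e.injective
  have : l = e l • e.symm 1 := by rw [← map_smul]; simp
  conv_lhs => rw [this]
  rw [map_smul, map_smul, map_smul, smul_eq_mul, smul_eq_mul, mul_comm]

/-- The twist `L ⊗ V` of a representing bundle by an equivariant line bundle, with the isomorphism
`id ⊗ homIso`. -/
def RepresentingBundle.twist (L : EquivariantBundle ℂ 𝒜) (V : RepresentingBundle 𝒜) :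
    RepresentingBundle 𝒜 where
  toEquivariantBundle := L.lineTensor V.toEquivariantBundle
  act_center := by
    intro g hg p
    obtain ⟨c, hc⟩ := V.act_center g hg p
    have hp : g • p = p := congrArg TotalSpace.proj (hc 0)
    obtain ⟨d, hd⟩ := L.exists_scalar hp (L.act g p)
    refine ⟨d * c, fun t => ?_⟩
    refine (TensorFiber.mk_map_eq (f' := d • LinearMap.id) (g' := c • LinearMap.id) hd hc t).trans ?_
    refine congrArg (TotalSpace.mk p) ?_
    obtain ⟨l, v, rfl⟩ := TensorFiber.exists_eq_tmul t
    rw [TensorFiber.map_tmul]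
    change (d • l) ⊗ₜ[ℂ] (c • v) = (d * c) • (l ⊗ₜ[ℂ] v)
    rw [TensorProduct.smul_tmul_smul]
  homIso p := (V.homIso p).trans
    (TensorFiber.endEquiv L.toComplexVectorBundle V.toComplexVectorBundle p)
  contMDiffAt_homIso := by
    intro p₀ a t ha ht
    exact ComplexVectorBundle.contMDiffAt_tensorMap L.toComplexVectorBundle V.toComplexVectorBundle
      (fun p => V.homIso p (a p.base)) p₀ (fun v hv => V.contMDiffAt_homIso p₀ a v ha hv) t ht
  act_homIso g p a t := by
    obtain ⟨l, v, rfl⟩ := TensorFiber.exists_eq_tmul t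
    change TensorFiber.map _ _ (TensorFiber.map _ _ _) =
      TensorFiber.map _ _ (TensorFiber.map _ _ _)
    simp only [TensorFiber.map_tmul, LinearMap.id_apply]
    exact congrArg _ (V.act_homIso g p a v)

/-- The action of a special unitary matrix on vectors. -/
def stdAct (g : SU N) : (Fin N → ℂ) →ₗ[ℂ] (Fin N → ℂ) := Matrix.mulVecLin g.1

variable (𝒜) in
/-- The trivial bundle `ℂ^N` over the bundle of trivializations. -/
def trivialBundle : ComplexVectorBundle (Fin N → ℂ) (E × slice N) (TrivBundle 𝒜) where
  Fiber := Bundle.Trivial (TrivBundle 𝒜) (Fin N → ℂ)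
  contMDiffVectorBundle := Bundle.Trivial.contMDiffVectorBundle _

lemma smul_eq_of_scalar {g : SU N} {ζ : ℂ} (h : (g : Mat N) = ζ • (1 : Mat N))
    (p : TrivBundle 𝒜) : g • p = p := by
  have h1 : g.1 * star g.1 = 1 := (Unitary.mem_iff.1 g.2.1).2
  have h2 : (g • p).iso = p.iso := by
    ext1 a
    rw [TrivBundle.smul_iso]
    have : g.1 * p.iso a = p.iso a * g.1 := by
      rw [show g.1 = ζ • (1 : Mat N) from h, Matrix.smul_mul, Matrix.mul_smul, one_mul, mul_one]
    rw [this, mul_assoc, h1, mul_one]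
  exact congrArg (fun φ => (⟨p.base, φ⟩ : TrivBundle 𝒜)) h2

lemma contDiff_mulVec : ContDiff ℝ ∞ (fun x : Mat N × (Fin N → ℂ) => x.1 *ᵥ x.2) := by
  refine contDiff_pi.2 fun i => ?_
  change ContDiff ℝ ∞ (fun x : Mat N × (Fin N → ℂ) => ∑ j, x.1 i j * x.2 j)
  refine ContDiff.sum fun j _ => ?_
  have h1 : ContDiff ℝ ∞ (fun x : Mat N × (Fin N → ℂ) => x.1 i j) :=
    (contDiff_entry i j).comp contDiff_fst
  have h2 : ContDiff ℝ ∞ (fun v : Fin N → ℂ => v j) := contDiff_apply ℝ ℂ j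
  exact h1.mul (h2.comp contDiff_snd)

lemma stdAct_of_scalar {g : SU N} {ζ : ℂ} (h : (g : Mat N) = ζ • (1 : Mat N)) (v : Fin N → ℂ) :
    stdAct g v = ζ • v := by
  change g.1 *ᵥ v = ζ • v
  rw [show g.1 = ζ • (1 : Mat N) from h, Matrix.smul_mulVec, Matrix.one_mulVec]

/-- The algebra isomorphism underlying a trivialization, acting on vectors. -/
def stdIso (p : TrivBundle 𝒜) : 𝒜.Fiber p.base ≃ₐ[ℂ] Module.End ℂ (Fin N → ℂ) :=
  (AlgEquivClass.toAlgEquiv p.iso).trans Matrix.toLinAlgEquiv'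

lemma stdIso_apply (p : TrivBundle 𝒜) (a : 𝒜.Fiber p.base) (v : Fin N → ℂ) :
    stdIso p a v = p.iso a *ᵥ v := rfl

lemma stdAct_stdIso (g : SU N) (p : TrivBundle 𝒜) (a : 𝒜.Fiber p.base) (v : Fin N → ℂ) :
    stdAct g (stdIso p a v) = stdIso (g • p) a (stdAct g v) := by
  change g.1 *ᵥ (p.iso a *ᵥ v) = (g • p).iso a *ᵥ (g.1 *ᵥ v)
  have h1 : star g.1 * g.1 = 1 := (Unitary.mem_iff.1 g.2.1).1
  rw [TrivBundle.smul_iso, Matrix.mulVec_mulVec, Matrix.mulVec_mulVec, mul_assoc, h1, mul_one]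

lemma contMDiffAt_iso (p₀ : TrivBundle 𝒜) (a : ∀ z, 𝒜.Fiber z)
    (ha : ContMDiffAt 𝓘(ℝ, E) (𝓘(ℝ, E).prod 𝓘(ℝ, Mat N)) ∞
      (fun z => (⟨z, a z⟩ : TotalSpace (Mat N) 𝒜.Fiber)) p₀.base) :
    ContMDiffAt 𝓘(ℝ, E × slice N) 𝓘(ℝ, Mat N) ∞
      (fun p : TrivBundle 𝒜 => p.iso (a p.base)) p₀ := by
  have h1 := (Bundle.contMDiffAt_section p₀.base).1 ha
  let T : Mat N ≃⋆ₐ[ℂ] Mat N := (𝒜.frame p₀.base p₀.base).symm.trans p₀.iso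
  have h2 : ContMDiffAt 𝓘(ℝ, E) 𝓘(ℝ, Mat N) ∞ (fun z => p₀.sec z (a z)) p₀.base := by
    have h3 : ContMDiffAt 𝓘(ℝ, E) 𝓘(ℝ, Mat N) ∞
        (fun z => T (trivializationAt (Mat N) 𝒜.Fiber p₀.base ⟨z, a z⟩).2) p₀.base :=
      TrivBundle.contMDiffWithinAt_apply (f := fun _ => (T : Mat N →ₗ[ℂ] Mat N))
        (fun A => contMDiffWithinAt_const) h1
    refine h3.congr_of_eventuallyEq ?_
    filter_upwards [(𝒜.isOpen_dom p₀.base).mem_nhds (𝒜.mem_dom p₀.base)] with z hz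
    exact congrArg T (𝒜.frame_apply hz (a z))
  have h4 : ContMDiffAt 𝓘(ℝ, E × slice N) 𝓘(ℝ, Mat N) ∞
      (fun p : TrivBundle 𝒜 => p₀.sec p.base (a p.base)) p₀ :=
    ContMDiffAt.comp (g := fun z => p₀.sec z (a z)) p₀ h2 TrivBundle.contMDiff_base.contMDiffAt
  have h5 : ContMDiffAt 𝓘(ℝ, E × slice N) 𝓘(ℝ, Mat N) ∞
      (fun p : TrivBundle 𝒜 => p₀.comp p (p₀.sec p.base (a p.base))) p₀ :=
    TrivBundle.contMDiffWithinAt_apply (f := fun p => (p₀.comp p : Mat N →ₗ[ℂ] Mat N))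
      (fun A => p₀.contMDiffAt_comp A (𝒜.mem_dom p₀.base)) h4
  refine h5.congr_of_eventuallyEq (Filter.Eventually.of_forall fun p => ?_)
  change _ = p.iso ((p₀.sec p.base).symm (p₀.sec p.base (a p.base)))
  rw [StarAlgEquiv.symm_apply_apply]

lemma contMDiffAt_iso_mulVec (p₀ : TrivBundle 𝒜) (a : ∀ z, 𝒜.Fiber z)
    (v : TrivBundle 𝒜 → Fin N → ℂ)
    (ha : ContMDiffAt 𝓘(ℝ, E) (𝓘(ℝ, E).prod 𝓘(ℝ, Mat N)) ∞
      (fun z => (⟨z, a z⟩ : TotalSpace (Mat N) 𝒜.Fiber)) p₀.base)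
    (hv : ContMDiffAt 𝓘(ℝ, E × slice N) 𝓘(ℝ, Fin N → ℂ) ∞ v p₀) :
    ContMDiffAt 𝓘(ℝ, E × slice N) 𝓘(ℝ, Fin N → ℂ) ∞
      (fun p : TrivBundle 𝒜 => stdIso p (a p.base) (v p)) p₀ :=
  contDiff_mulVec.contMDiff.contMDiffAt.comp p₀ ((contMDiffAt_iso p₀ a ha).prodMk_space hv)

variable (𝒜) in
open Classical in
lemma contMDiffOn_stdAct : ContMDiffOn
    (𝓘(ℝ, Mat N).prod (𝓘(ℝ, E × slice N).prod 𝓘(ℝ, Fin N → ℂ)))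
    (𝓘(ℝ, E × slice N).prod 𝓘(ℝ, Fin N → ℂ)) ∞
    (fun x : Mat N × TotalSpace (Fin N → ℂ) (trivialBundle 𝒜).Fiber =>
      if h : x.1 ∈ Matrix.specialUnitaryGroup (Fin N) ℂ then
        (⟨(⟨x.1, h⟩ : SU N) • x.2.proj, stdAct ⟨x.1, h⟩ x.2.2⟩ :
          TotalSpace (Fin N → ℂ) (trivialBundle 𝒜).Fiber)
      else x.2)
    {x | x.1 ∈ Matrix.specialUnitaryGroup (Fin N) ℂ} := by
  rintro ⟨g₀, x₀⟩ hg₀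
  have hg₀' : g₀ ∈ Matrix.specialUnitaryGroup (Fin N) ℂ := hg₀
  set S : Set (Mat N × TotalSpace (Fin N → ℂ) (trivialBundle 𝒜).Fiber) :=
    {x | x.1 ∈ Matrix.specialUnitaryGroup (Fin N) ℂ} with hS
  have hfst : ContMDiffWithinAt (𝓘(ℝ, Mat N).prod (𝓘(ℝ, E × slice N).prod 𝓘(ℝ, Fin N → ℂ)))
      𝓘(ℝ, Mat N) ∞ (fun x : Mat N × TotalSpace (Fin N → ℂ) (trivialBundle 𝒜).Fiber => x.1) S
      (g₀, x₀) := contMDiffWithinAt_fst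
  have hsnd := (Bundle.contMDiffWithinAt_totalSpace (E := (trivialBundle 𝒜).Fiber)
    (F := Fin N → ℂ)
    (f := fun x : Mat N × TotalSpace (Fin N → ℂ) (trivialBundle 𝒜).Fiber => x.2)).1
    (contMDiffWithinAt_snd (s := S) (p := (g₀, x₀)) (I := 𝓘(ℝ, Mat N))
      (J := 𝓘(ℝ, E × slice N).prod 𝓘(ℝ, Fin N → ℂ)) (n := ∞))
  have hbase : ContMDiffWithinAt (𝓘(ℝ, Mat N).prod (𝓘(ℝ, E × slice N).prod 𝓘(ℝ, Fin N → ℂ)))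
      𝓘(ℝ, E × slice N) ∞
      (fun x : Mat N × TotalSpace (Fin N → ℂ) (trivialBundle 𝒜).Fiber =>
        TrivBundle.matAct x.1 x.2.proj) S (g₀, x₀) :=
    (TrivBundle.contMDiffWithinAt_matAct hg₀' x₀.proj).comp (g₀, x₀) (hfst.prodMk hsnd.1)
      (fun x hx => hx)
  have hc := contDiff_mulVec.contMDiff.contMDiffAt.comp_contMDiffWithinAt (g₀, x₀)
    (hfst.prodMk_space hsnd.2)
  refine Bundle.contMDiffWithinAt_totalSpace.2 ⟨hbase.congr ?_ ?_, hc.congr ?_ ?_⟩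
  · intro x hx
    have hx' : x.1 ∈ Matrix.specialUnitaryGroup (Fin N) ℂ := hx
    rw [dif_pos hx']
    exact (TrivBundle.matAct_of_mem ⟨x.1, hx'⟩ x.2.proj).symm
  · rw [dif_pos hg₀']
    exact (TrivBundle.matAct_of_mem ⟨g₀, hg₀'⟩ x₀.proj).symm
  · intro x hx
    have hx' : x.1 ∈ Matrix.specialUnitaryGroup (Fin N) ℂ := hx
    rw [dif_pos hx']
    rfl
  · rw [dif_pos hg₀']
    rfl

variable (𝒜) in
/-- The standard representing bundle: the trivial bundle `ℂ^N` over the bundle of trivializations,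
with the standard action of `SU(N)`, and `p.iso` as the isomorphism at `p`. -/
def RepresentingBundle.standard : RepresentingBundle 𝒜 where
  toComplexVectorBundle := trivialBundle 𝒜
  act g p := stdAct g
  act_one p v := by
    rw [one_smul]
    refine congrArg (TotalSpace.mk p) ?_
    exact Matrix.one_mulVec v
  act_mul g h p v := by
    rw [mul_smul]
    refine congrArg (TotalSpace.mk (g • h • p)) ?_
    exact (Matrix.mulVec_mulVec v g.1 h.1).symm
  contMDiffOn_act := contMDiffOn_stdAct 𝒜
  act_center := by
    rintro g ⟨ζ, hζ⟩ p
    refine ⟨ζ, fun v => ?_⟩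
    rw [smul_eq_of_scalar hζ]
    exact congrArg (TotalSpace.mk p) (stdAct_of_scalar hζ v)
  homIso p := stdIso p
  contMDiffAt_homIso := by
    intro p₀ a v ha hv
    have h1 : ContMDiffAt 𝓘(ℝ, E × slice N) 𝓘(ℝ, Fin N → ℂ) ∞ (fun p => (v p : Fin N → ℂ)) p₀ :=
      (Bundle.contMDiffAt_section (E := (trivialBundle 𝒜).Fiber) p₀).1 hv
    exact (Bundle.contMDiffAt_section (E := (trivialBundle 𝒜).Fiber) p₀).2
      (contMDiffAt_iso_mulVec p₀ a _ ha h1)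
  act_homIso g p a v := stdAct_stdIso g p a v

end Twist

end

end ProjectiveBundle

universe uE uZ uA uV

/-! The proof is Morita theory for `M_N(ℂ)`, carried out smoothly and equivariantly, followed by a
fact about line bundles: every smooth linear `SU(N)`-action on a line bundle over `𝒫` is a
fibre-holonomy action.

At a point `p` the isomorphisms `p.iso` and `V.homIso p` together identify `M_N(ℂ)` with `End(V_p)`;
this is `RepresentingBundle.rep`. So the image `L_p` of the matrix unit `E₀₀` is a line
(`exists_eq_smul`), and on it a matrix acts through its first column only. Hence `l ⊗ w ↦ A l`, with
`A` any matrix of first column `w`, is an isomorphism from `L_p ⊗ ℂ^N` to `V_p` (`fromTwisted`, with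
inverse `toTwisted`). The action of `g` on `V` carries the action of `A` to that of `g A g*`
(`act_rep`). So `g` followed by the matrix `g*` commutes with all matrices and maps `L_p` to
`L_{gp}`. This is the action on the line bundle (`lineAct`), and its tensor product with the
standard action is the given action (`fromTwisted_act`). Smoothness of all these maps comes from
that of the matrix action on the total space (`contMDiff_rep`).

For the holonomy statement, a point `p` near `p₀` is written smoothly as `g(p) • σ(z)`, with `σ` a
local section of `𝒫` over `Z` and `g(p)` in `SU(N)` (`TrivBundle.lift`). Lifts from `PU(N)` to
`SU(N)` are unique up to the centre, which is finite, so `g(h • p) = h g(p)` for `h` close to `1`.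
Moving a nonzero section along `σ` by `g(p)` therefore gives a local frame which is invariant under
group elements close to `1` (`isFibreFrame_invariantSec`). Two such frames have a locally constant
ratio on each fibre (`IsFibreFrame.mvfderiv_ratio`), so the connections for which they are parallel
agree in vertical directions. Since `𝒫` is compact and Hausdorff, a finite partition of unity glues
these connections to a global one, which in vertical directions is still the one given by any
invariant frame (`cov_apply_of_vertical`). It is flat on the fibres, and `c(t) · l` is locally a
constant multiple of an invariant frame, hence parallel. -/

namespace ProjectiveBundle

open Matrix Bundle Topology
open scoped Manifold ContDiff Matrix.Norms.Operator

noncomputable section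

/-! ### Automorphisms of the matrix algebra -/

section

variable {N : ℕ} [NeZero N]

/-- For `β` the conjugation by a unitary `U`, this is `conj (U k 0) • U`. -/
def gramColumn (β : Mat N ≃⋆ₐ[ℂ] Mat N) (k : Fin N) : Mat N :=
  Matrix.of fun a b => β (Matrix.single b 0 1) a k

/-- Column `b` of the matrix is column `k` of `β(E_b0)`, and `A E_b0` is the combination of the
`E_c0` with coefficients from column `b` of `A`. -/
lemma gramColumn_intertwines (β : Mat N ≃⋆ₐ[ℂ] Mat N) (k : Fin N) (A : Mat N) :
    β A * gramColumn β k = gramColumn β k * A := by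
  ext a b
  have h1 : (β A * gramColumn β k) a b = β (A * Matrix.single b 0 1) a k := by
    rw [map_mul, Matrix.mul_apply, Matrix.mul_apply]; rfl
  have h2 : A * Matrix.single b 0 1 = ∑ c, A c b • (Matrix.single c 0 1 : Mat N) := by
    ext i j
    rw [Matrix.sum_apply]
    by_cases hj : j = 0
    · subst hj
      rw [Matrix.mul_single_apply_same, Finset.sum_eq_single i]
      · simp
      · intro c _ hc; simp [Matrix.single_apply, hc]
      · simp
    · rw [Matrix.mul_single_apply_of_ne _ _ _ _ _ hj, Finset.sum_eq_zero]
      intro c _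
      simp [Matrix.single_apply, Ne.symm hj]
  rw [h1, h2, map_sum, Matrix.sum_apply, Matrix.mul_apply]
  refine Finset.sum_congr rfl fun c _ => ?_
  rw [map_smul, Matrix.smul_apply, smul_eq_mul, mul_comm]; rfl

/-- The inner product of columns `b` and `c` is the `(k, k)` entry of `β(E_0b E_c0)`, which vanishes
unless `b = c`. -/
lemma star_gramColumn_mul (β : Mat N ≃⋆ₐ[ℂ] Mat N) (k : Fin N) :
    star (gramColumn β k) * gramColumn β k = (β (Matrix.single 0 0 1) k k) • (1 : Mat N) := by
  ext b c
  have h1 : (star (gramColumn β k) * gramColumn β k) b c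
      = (star (β (Matrix.single b 0 1)) * β (Matrix.single c 0 1)) k k := by
    simp only [Matrix.mul_apply, Matrix.star_apply, gramColumn, Matrix.of_apply]
  have h2 : star (Matrix.single b 0 1 : Mat N) = Matrix.single 0 b 1 := by
    change (Matrix.single b 0 1)ᴴ = _
    rw [Matrix.conjTranspose_single, star_one]
  rw [h1, ← map_star, ← map_mul, h2]
  by_cases hbc : b = c
  · subst hbc
    rw [Matrix.single_mul_single_same, mul_one]
    simp
  · rw [Matrix.single_mul_single_of_ne _ _ _ _ hbc, map_zero]
    simp [Matrix.one_apply_ne hbc]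

/-- Every automorphism of the matrix algebra is the conjugation by a special unitary matrix. -/
lemma exists_conj_of_starAlgEquiv (β : Mat N ≃⋆ₐ[ℂ] Mat N) :
    ∃ g : SU N, ∀ A, β A = g.1 * A * star g.1 := by
  -- For a general `β` the column used in `gram` may vanish, so `k` is chosen such that column `k`
  -- of `β(E₀₀)` does not. That column is the first column of `G`.
  obtain ⟨k, a, hka⟩ : ∃ k a, β (Matrix.single 0 0 1) a k ≠ 0 := by
    by_contra! h
    have h1 : β (Matrix.single 0 0 1) = 0 := by ext a k; exact h k a
    have h2 := (map_eq_zero_iff β (EquivLike.injective β)).1 h1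
    simpa using congrFun (congrFun h2 0) 0
  set G := gramColumn β k with hG
  obtain ⟨r, hr, hGG⟩ : ∃ r : ℝ, 0 < r ∧ star G * G = (r : ℂ) • (1 : Mat N) := by
    have h := star_gramColumn_mul β k
    refine ⟨∑ j, Complex.normSq (G j 0), ?_, ?_⟩
    · refine Finset.sum_pos' (fun j _ => Complex.normSq_nonneg _) ⟨a, Finset.mem_univ _, ?_⟩
      exact Complex.normSq_pos.2 hka
    · rw [h]
      have h0 := congrFun (congrFun h 0) 0
      rw [Matrix.smul_apply, Matrix.one_apply_eq, smul_eq_mul, mul_one, Matrix.mul_apply] at h0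
      rw [← h0]
      push_cast
      congr 1
      refine Finset.sum_congr rfl fun j _ => ?_
      rw [Matrix.star_apply, RCLike.star_def, mul_comm, Complex.mul_conj]
  have hdet : G.det ≠ 0 := by
    intro h0
    have := congrArg Matrix.det hGG
    rw [Matrix.det_mul, h0, mul_zero, Matrix.det_smul, Matrix.det_one, mul_one] at this
    exact pow_ne_zero _ (Complex.ofReal_ne_zero.2 hr.ne') this.symm
  -- An `N`-th root of `1 / det G` rescales `G` to determinant one.
  obtain ⟨c, hc⟩ := IsAlgClosed.exists_pow_nat_eq (G.det)⁻¹ (Nat.pos_of_ne_zero (NeZero.ne N))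
  have hS : (c • G).det = 1 := by
    rw [Matrix.det_smul, Fintype.card_fin, hc, inv_mul_cancel₀ hdet]
  have hSS : star (c • G) * (c • G) = ((Complex.normSq c * r : ℝ) : ℂ) • (1 : Mat N) := by
    rw [star_smul, Matrix.smul_mul, Matrix.mul_smul, hGG, smul_smul, smul_smul]
    congr 1
    push_cast
    rw [← Complex.mul_conj, RCLike.star_def]
    ring
  -- Unitarity is then automatic: `(cG)*(cG)` is a nonnegative multiple `t` of the identity, and
  -- determinants give `t ^ N = 1`.
  have ht : Complex.normSq c * r = 1 := by
    have h1 := congrArg Matrix.det hSS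
    rw [Matrix.det_mul, hS, mul_one, Matrix.star_eq_conjTranspose, Matrix.det_conjTranspose, hS,
      star_one, Matrix.det_smul, Matrix.det_one, mul_one, Fintype.card_fin] at h1
    have h2 : (Complex.normSq c * r) ^ N = 1 := by exact_mod_cast h1.symm
    exact (pow_eq_one_iff_of_nonneg (mul_nonneg (Complex.normSq_nonneg _) hr.le) (NeZero.ne N)).1 h2
  rw [ht, Complex.ofReal_one, one_smul] at hSS
  have hSS' := mul_eq_one_comm.1 hSS
  refine ⟨⟨c • G, Matrix.mem_specialUnitaryGroup_iff.2 ⟨Unitary.mem_iff.2 ⟨hSS, hSS'⟩, hS⟩⟩, fun A => ?_⟩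
  change β A = (c • G) * A * star (c • G)
  rw [Matrix.smul_mul, ← gramColumn_intertwines, ← Matrix.mul_smul, mul_assoc, hSS', mul_one]

variable {E : Type*} [NormedAddCommGroup E] [NormedSpace ℝ E]
  {Z : Type*} [TopologicalSpace Z] [ChartedSpace E Z] {𝒜 : AzumayaBundle N E Z}

section Smooth

variable {EM : Type*} [NormedAddCommGroup EM] [NormedSpace ℝ EM] {HM : Type*} [TopologicalSpace HM]
  {IM : ModelWithCorners ℝ EM HM} {M : Type*} [TopologicalSpace M] [ChartedSpace HM M]

/-- The inverses of a smooth family of automorphisms form a smooth family. -/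
lemma contMDiffAt_starAlgEquiv_symm {f : M → Mat N ≃⋆ₐ[ℂ] Mat N} {x₀ : M}
    (h₀ : f x₀ ∈ (autChart N).source)
    (hc : ∀ A, ContMDiffAt IM 𝓘(ℝ, Mat N) ∞ (fun x => f x A) x₀) (A : Mat N) :
    ContMDiffAt IM 𝓘(ℝ, Mat N) ∞ (fun x => (f x).symm A) x₀ := by
  have hg : ContMDiffAt IM 𝓘(ℝ, Mat N) ∞ (fun x => gram (f x)) x₀ :=
    TrivBundle.contMDiffWithinAt_gram (s := Set.univ) hc
  have hU : ContMDiffAt IM 𝓘(ℝ, Mat N) ∞ (fun x => rescale (gram (f x))) x₀ :=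
    (contDiffAt_rescale h₀.1).contMDiffAt.comp x₀ hg
  have hU' : ContMDiffAt IM 𝓘(ℝ, Mat N) ∞ (fun x => star (rescale (gram (f x)))) x₀ :=
    TrivBundle.contDiff_star.contMDiff.contMDiffAt.comp x₀ hU
  have h1 : ∀ᶠ x in 𝓝 x₀, gram (f x) ∈ gramDom N :=
    hg.continuousAt.eventually_mem (isOpen_gramDom.mem_nhds h₀)
  -- Near `x₀` the automorphism is the conjugation by the smooth unitary `U = rescale (gram (f x))`,
  -- so its inverse is `A ↦ U* A U`.
  have h2 := ContMDiffWithinAt.matMul (s := Set.univ) (ContMDiffWithinAt.matMul (s := Set.univ)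
    hU' (contMDiffWithinAt_const (c := A))) hU
  refine ContMDiffAt.congr_of_eventuallyEq h2 ?_
  filter_upwards [h1] with x hx
  have hu := (Unitary.mem_iff.1 (rescale_mem_unitary hx.1)).1
  apply EquivLike.injective (f x)
  rw [StarAlgEquiv.apply_symm_apply, ← conj_rescale hx.1]
  have hu' := (Unitary.mem_iff.1 (rescale_mem_unitary hx.1)).2
  set U := rescale (gram (f x))
  calc A = (U * star U) * A * (U * star U) := by rw [hu']; simp
    _ = _ := by noncomm_ring

end Smooth

/-! ### Smooth dependence of the inverse trivializations on the point -/

namespace TrivBundle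

variable [IsManifold 𝓘(ℝ, E) ∞ Z]

lemma comp_self (p : TrivBundle 𝒜) : p.comp p = StarAlgEquiv.refl ℂ (Mat N) := by
  ext1 A; rw [comp_apply, sec_self]; simp

/-- At `p₀` itself the comparison automorphism is the identity, which lies in the domain of
`autChart`; smoothness at this one point is enough below. -/
lemma contMDiffAt_comp_symm (p₀ : TrivBundle 𝒜) (A : Mat N) :
    ContMDiffAt 𝓘(ℝ, E × slice N) 𝓘(ℝ, Mat N) ∞ (fun q : TrivBundle 𝒜 => (p₀.comp q).symm A) p₀ :=
  contMDiffAt_starAlgEquiv_symm (f := fun q => p₀.comp q)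
    (by rw [comp_self]; exact one_mem_autChart_source)
    (fun A => p₀.contMDiffAt_comp A (𝒜.mem_dom _)) A

/-- The local sections of the Azumaya bundle given by matrices are smooth. -/
lemma contMDiffAt_sec_symm (p₀ : TrivBundle 𝒜) (A : Mat N) :
    ContMDiffAt 𝓘(ℝ, E) (𝓘(ℝ, E).prod 𝓘(ℝ, Mat N)) ∞
      (fun z => (⟨z, (p₀.sec z).symm A⟩ : TotalSpace (Mat N) 𝒜.Fiber)) p₀.base := by
  refine (Bundle.contMDiffAt_section p₀.base).2 ?_
  -- In the trivialization around `p₀.base` the section is constant.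
  refine (contMDiffAt_const (c := (𝒜.frame p₀.base p₀.base) (p₀.iso.symm A))).congr_of_eventuallyEq ?_
  filter_upwards [(𝒜.isOpen_dom p₀.base).mem_nhds (𝒜.mem_dom p₀.base)] with z hz
  rw [← 𝒜.frame_apply hz]
  simp [sec]

/-- The smoothness condition on `homIso` only concerns sections of `𝒜` over `Z`, while `p.iso.symm
A` varies along the fibres of `𝒫`. The expansion separates smooth coefficients on `𝒫` from sections
pulled back from `Z`. -/
lemma iso_symm_eq_sum (p₀ p : TrivBundle 𝒜) (A : Mat N) :
    p.iso.symm A = ∑ a, ∑ b, (p₀.comp p).symm A a b •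
      (p₀.sec p.base).symm (Matrix.single a b 1) := by
  have h : p.iso.symm A = (p₀.sec p.base).symm ((p₀.comp p).symm A) := by
    apply EquivLike.injective p.iso
    rw [StarAlgEquiv.apply_symm_apply, ← comp_apply, StarAlgEquiv.apply_symm_apply]
  rw [h]
  exact map_eq_sum ((p₀.sec p.base).symm : Mat N →ₗ[ℂ] 𝒜.Fiber p.base) _

end TrivBundle

/-! ### The fibres of a representing bundle as modules over the matrix algebra -/

namespace RepresentingBundle

variable [IsManifold 𝓘(ℝ, E) ∞ Z] (V : RepresentingBundle 𝒜)

/-- The fibre of a representing bundle at a trivialization is a module over the matrix algebra. -/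
def rep (p : TrivBundle 𝒜) : Mat N ≃ₐ[ℂ] Module.End ℂ (V.Fiber p) :=
  (AlgEquivClass.toAlgEquiv p.iso).symm.trans (V.homIso p)

lemma rep_apply (p : TrivBundle 𝒜) (A : Mat N) : V.rep p A = V.homIso p (p.iso.symm A) := rfl

lemma rep_iso (p : TrivBundle 𝒜) (a : 𝒜.Fiber p.base) : V.rep p (p.iso a) = V.homIso p a := by
  rw [rep_apply, StarAlgEquiv.symm_apply_apply]

/-- The equivariance of `homIso`, rewritten with `(g • p).iso a = g (p.iso a) g*`. It is the source
of the action on the line bundle and of the equivariance of the equivalence. -/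
lemma act_rep (g : SU N) (p : TrivBundle 𝒜) (A : Mat N) (v : V.Fiber p) :
    V.act g p (V.rep p A v) = V.rep (g • p) (g.1 * A * star g.1) (V.act g p v) := by
  rw [rep_apply, V.act_homIso, ← rep_iso, TrivBundle.smul_iso]
  erw [StarAlgEquiv.apply_symm_apply]

lemma rep_eq_sum (p₀ p : TrivBundle 𝒜) (A : Mat N) (v : V.Fiber p) :
    V.rep p A v = ∑ a, ∑ b, (p₀.comp p).symm A a b •
      V.homIso p ((p₀.sec p.base).symm (Matrix.single a b 1)) v := by
  rw [rep_apply, TrivBundle.iso_symm_eq_sum p₀ p A]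
  simp only [map_sum, map_smul, LinearMap.sum_apply, LinearMap.smul_apply]

/-- The action of matrices on smooth sections is smooth. -/
lemma contMDiffAt_rep_section (p₀ : TrivBundle 𝒜) (A : Mat N) (v : ∀ p, V.Fiber p)
    (hv : ContMDiffAt 𝓘(ℝ, E × slice N) (𝓘(ℝ, E × slice N).prod 𝓘(ℝ, Fin N → ℂ)) ∞
      (fun p => (⟨p, v p⟩ : TotalSpace (Fin N → ℂ) V.Fiber)) p₀) :
    ContMDiffAt 𝓘(ℝ, E × slice N) 𝓘(ℝ, Fin N → ℂ) ∞
      (fun p => (trivializationAt (Fin N → ℂ) V.Fiber p₀ ⟨p, V.rep p A (v p)⟩).2) p₀ := by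
  have h1 : ∀ a b, ContMDiffAt 𝓘(ℝ, E × slice N) 𝓘(ℝ, Fin N → ℂ) ∞
      (fun p => (trivializationAt (Fin N → ℂ) V.Fiber p₀
        ⟨p, V.homIso p ((p₀.sec p.base).symm (Matrix.single a b 1)) (v p)⟩).2) p₀ := fun a b =>
    (Bundle.contMDiffAt_section p₀).1
      (V.contMDiffAt_homIso p₀ _ v (p₀.contMDiffAt_sec_symm (Matrix.single a b 1)) hv)
  have h2 : ∀ a b, ContMDiffAt 𝓘(ℝ, E × slice N) 𝓘(ℝ, ℂ) ∞
      (fun p => (p₀.comp p).symm A a b) p₀ := fun a b =>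
    (contDiff_entry a b).contMDiff.contMDiffAt.comp p₀ (p₀.contMDiffAt_comp_symm A)
  have hs : ContDiff ℝ ∞ (fun p : ℂ × (Fin N → ℂ) => p.1 • p.2) := contDiff_fst.smul contDiff_snd
  have h3 : ContMDiffAt 𝓘(ℝ, E × slice N) 𝓘(ℝ, Fin N → ℂ) ∞
      (fun p => ∑ a, ∑ b, (p₀.comp p).symm A a b • (trivializationAt (Fin N → ℂ) V.Fiber p₀
        ⟨p, V.homIso p ((p₀.sec p.base).symm (Matrix.single a b 1)) (v p)⟩).2) p₀ :=
    contMDiffAt_finsetSum fun a _ => contMDiffAt_finsetSum fun b _ =>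
      hs.contMDiff.contMDiffAt.comp p₀ ((h2 a b).prodMk_space (h1 a b))
  refine h3.congr_of_eventuallyEq ?_
  filter_upwards [(trivializationAt (Fin N → ℂ) V.Fiber p₀).open_baseSet.mem_nhds
    (mem_baseSet_trivializationAt _ _ p₀)] with p hp
  rw [V.rep_eq_sum p₀ p]
  simp only [← ComplexVectorBundle.triv_apply V.toComplexVectorBundle p₀ p hp, map_sum, map_smul]

/-- The action of matrices on the fibres is smooth on the total space. -/
lemma contMDiff_rep : ContMDiff
    (𝓘(ℝ, Mat N).prod (𝓘(ℝ, E × slice N).prod 𝓘(ℝ, Fin N → ℂ)))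
    (𝓘(ℝ, E × slice N).prod 𝓘(ℝ, Fin N → ℂ)) ∞
    (fun x : Mat N × TotalSpace (Fin N → ℂ) V.Fiber =>
      (⟨x.2.proj, V.rep x.2.proj x.1 x.2.2⟩ : TotalSpace (Fin N → ℂ) V.Fiber)) := by
  rintro ⟨A₀, x₀⟩
  set p₀ := x₀.proj with hp₀
  set e := trivializationAt (Fin N → ℂ) V.Fiber p₀ with he
  have hbase := mem_baseSet_trivializationAt (Fin N → ℂ) V.Fiber p₀
  have hfst : ContMDiffAt (𝓘(ℝ, Mat N).prod (𝓘(ℝ, E × slice N).prod 𝓘(ℝ, Fin N → ℂ)))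
      𝓘(ℝ, Mat N) ∞ (fun x : Mat N × TotalSpace (Fin N → ℂ) V.Fiber => x.1) (A₀, x₀) :=
    contMDiffAt_fst
  have hsnd := (Bundle.contMDiffAt_totalSpace (E := V.Fiber)
    (F := Fin N → ℂ) (f := fun x : Mat N × TotalSpace (Fin N → ℂ) V.Fiber => x.2)).1
    (contMDiffAt_snd (p := (A₀, x₀)) (I := 𝓘(ℝ, Mat N))
      (J := 𝓘(ℝ, E × slice N).prod 𝓘(ℝ, Fin N → ℂ)) (n := ∞))
  refine Bundle.contMDiffAt_totalSpace.2 ⟨hsnd.1, ?_⟩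
  -- The result on sections is applied to finitely many matrix units and to the coordinate sections
  -- of the trivialization. By bilinearity these determine the action, with coefficients that are
  -- smooth on the product.
  have hR : ∀ a b j, ContMDiffAt (𝓘(ℝ, Mat N).prod (𝓘(ℝ, E × slice N).prod 𝓘(ℝ, Fin N → ℂ)))
      𝓘(ℝ, Fin N → ℂ) ∞ (fun x : Mat N × TotalSpace (Fin N → ℂ) V.Fiber =>
        (e ⟨x.2.proj, V.rep x.2.proj (Matrix.single a b 1)
          (e.symm x.2.proj (Pi.single j 1))⟩).2) (A₀, x₀) := by
    intro a b j
    have h1 := V.contMDiffAt_rep_section p₀ (Matrix.single a b 1)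
      (fun p => e.symm p (Pi.single j 1))
      (V.contMDiffWithinAt_symm (s := Set.univ) (f := fun p => p) p₀ hbase contMDiffWithinAt_id
        contMDiffWithinAt_const)
    exact ContMDiffAt.comp (g := fun p : TrivBundle 𝒜 => (e ⟨p, V.rep p (Matrix.single a b 1)
          (e.symm p (Pi.single j 1))⟩).2) (A₀, x₀) h1 hsnd.1
  have hs : ContDiff ℝ ∞ (fun p : ℂ × (Fin N → ℂ) => p.1 • p.2) := contDiff_fst.smul contDiff_snd
  have hS : ContMDiffAt (𝓘(ℝ, Mat N).prod (𝓘(ℝ, E × slice N).prod 𝓘(ℝ, Fin N → ℂ)))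
      𝓘(ℝ, Fin N → ℂ) ∞ (fun x : Mat N × TotalSpace (Fin N → ℂ) V.Fiber =>
        ∑ a, ∑ b, x.1 a b • ∑ j, (e x.2).2 j • (e ⟨x.2.proj, V.rep x.2.proj (Matrix.single a b 1)
          (e.symm x.2.proj (Pi.single j 1))⟩).2) (A₀, x₀) := by
    refine contMDiffAt_finsetSum fun a _ => contMDiffAt_finsetSum fun b _ => ?_
    refine hs.contMDiff.contMDiffAt.comp (A₀, x₀) (ContMDiffAt.prodMk_space
      ((contDiff_entry a b).contMDiff.contMDiffAt.comp (A₀, x₀) hfst)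
      (contMDiffAt_finsetSum fun j _ => ?_))
    refine hs.contMDiff.contMDiffAt.comp (A₀, x₀) (ContMDiffAt.prodMk_space ?_ (hR a b j))
    exact (contDiff_apply ℝ ℂ j).contMDiff.contMDiffAt.comp (A₀, x₀) hsnd.2
  refine hS.congr_of_eventuallyEq ?_
  filter_upwards [hsnd.1.continuousAt.eventually_mem (e.open_baseSet.mem_nhds hbase)] with x hx
  obtain ⟨A, p, v⟩ := x
  change p ∈ e.baseSet at hx
  change (e ⟨p, V.rep p A v⟩).2 = _
  have h1 : V.rep p A = ∑ a, ∑ b, A a b • V.rep p (Matrix.single a b 1) :=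
    TrivBundle.map_eq_sum (V.rep p).toLinearMap A
  have h2 : v = ∑ j, (e ⟨p, v⟩).2 j • e.symm p (Pi.single j 1) := by
    apply (ComplexVectorBundle.triv (V := V.toComplexVectorBundle) p₀ p hx).injective
    simp only [map_sum, map_smul]
    ext i
    simp only [← ComplexVectorBundle.triv_symm_apply V.toComplexVectorBundle p₀ p hx, he,
      LinearEquiv.apply_symm_apply]
    simp [Finset.sum_apply, Pi.single_apply]
    rfl
  conv_lhs => rw [h1, h2]
  simp only [he, ← ComplexVectorBundle.triv_apply V.toComplexVectorBundle p₀ p hx, map_sum, map_smul, LinearMap.sum_apply,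
    LinearMap.smul_apply]
  simp only [Finset.smul_sum]
  rw [Finset.sum_comm]
  refine Finset.sum_congr rfl fun a _ => ?_
  rw [Finset.sum_comm]
  exact Finset.sum_congr rfl fun b _ => Finset.sum_congr rfl fun j _ => smul_comm _ _ _

end RepresentingBundle

end

/-! ### The line bundle cut out by the first matrix unit -/

section

section

variable {EM : Type*} [NormedAddCommGroup EM] [NormedSpace ℝ EM] {HM : Type*} [TopologicalSpace HM]
  {IM : ModelWithCorners ℝ EM HM} {M : Type*} [TopologicalSpace M] [ChartedSpace HM M]

lemma _root_.ContMDiffWithinAt.complexMul {f g : M → ℂ} {s : Set M} {x₀ : M}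
    (hf : ContMDiffWithinAt IM 𝓘(ℝ, ℂ) ∞ f s x₀) (hg : ContMDiffWithinAt IM 𝓘(ℝ, ℂ) ∞ g s x₀) :
    ContMDiffWithinAt IM 𝓘(ℝ, ℂ) ∞ (fun x => f x * g x) s x₀ := by
  have h : ContDiff ℝ ∞ (fun p : ℂ × ℂ => p.1 * p.2) := contDiff_fst.mul contDiff_snd
  exact h.contMDiff.contMDiffAt.comp_contMDiffWithinAt x₀ (hf.prodMk_space hg)

end

variable {N : ℕ} [NeZero N]
variable {E : Type*} [NormedAddCommGroup E] [NormedSpace ℝ E]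
  {Z : Type*} [TopologicalSpace Z] [ChartedSpace E Z] {𝒜 : AzumayaBundle N E Z}

namespace RepresentingBundle

variable [IsManifold 𝓘(ℝ, E) ∞ Z] (V : RepresentingBundle 𝒜)

lemma rep_mul_apply (p : TrivBundle 𝒜) (A B : Mat N) (v : V.Fiber p) :
    V.rep p A (V.rep p B v) = V.rep p (A * B) v := by
  rw [map_mul]; rfl

/-- The line on which the first diagonal matrix unit acts as the identity. -/
def LineFiber (p : TrivBundle 𝒜) : Type _ := LinearMap.range (V.rep p (Matrix.single 0 0 1))

instance (p : TrivBundle 𝒜) : AddCommGroup (V.LineFiber p) :=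
  inferInstanceAs (AddCommGroup (LinearMap.range (V.rep p (Matrix.single 0 0 1))))

instance (p : TrivBundle 𝒜) : Module ℂ (V.LineFiber p) :=
  inferInstanceAs (Module ℂ (LinearMap.range (V.rep p (Matrix.single 0 0 1))))

/-- The inclusion of the line. -/
def incl (p : TrivBundle 𝒜) : V.LineFiber p →ₗ[ℂ] V.Fiber p :=
  (LinearMap.range (V.rep p (Matrix.single 0 0 1))).subtype

/-- The projection to the line. -/
def proj (p : TrivBundle 𝒜) : V.Fiber p →ₗ[ℂ] V.LineFiber p :=
  (V.rep p (Matrix.single 0 0 1)).rangeRestrict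

variable {V} in
lemma incl_injective {p : TrivBundle 𝒜} : Function.Injective (V.incl p) := Subtype.val_injective

lemma incl_proj (p : TrivBundle 𝒜) (v : V.Fiber p) :
    V.incl p (V.proj p v) = V.rep p (Matrix.single 0 0 1) v := rfl

lemma rep_incl (p : TrivBundle 𝒜) (l : V.LineFiber p) :
    V.rep p (Matrix.single 0 0 1) (V.incl p l) = V.incl p l := by
  obtain ⟨_, v, rfl⟩ := l
  change V.rep p _ (V.rep p _ v) = V.rep p _ v
  rw [rep_mul_apply, Matrix.single_mul_single_same, mul_one]

lemma proj_incl (p : TrivBundle 𝒜) (l : V.LineFiber p) : V.proj p (V.incl p l) = l :=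
  incl_injective (by rw [incl_proj, rep_incl])

/-- Since `rep` is injective, `E₀₀` does not act as zero. -/
lemma exists_line_ne_zero (p : TrivBundle 𝒜) : ∃ l : V.LineFiber p, l ≠ 0 := by
  by_contra! h
  have h1 : V.rep p (Matrix.single 0 0 1) = 0 := by
    ext v
    rw [← incl_proj, h (V.proj p v), map_zero]; rfl
  have h2 := (map_eq_zero_iff (V.rep p) (V.rep p).injective).1 h1
  simpa using congrFun (congrFun h2 0) 0

/-- The line is one-dimensional because every endomorphism is a matrix: some `A` takes `s` to `l`,
both are fixed by `E₀₀`, and `E₀₀ A E₀₀ = A₀₀ E₀₀`, so `l = A₀₀ s`. -/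
lemma exists_eq_smul (p : TrivBundle 𝒜) {s : V.LineFiber p} (hs : s ≠ 0) (l : V.LineFiber p) :
    ∃ c : ℂ, l = c • s := by
  have hs' : V.incl p s ≠ 0 := fun h => hs (incl_injective (by rw [h, map_zero]))
  obtain ⟨d, hd⟩ := Module.Projective.exists_dual_eq_one ℂ hs'
  obtain ⟨A, hA⟩ := (V.rep p).surjective (d.smulRight (V.incl p l))
  have hT : V.rep p A (V.incl p s) = V.incl p l := by
    rw [hA, LinearMap.smulRight_apply, hd, one_smul]
  refine ⟨A 0 0, incl_injective ?_⟩
  have h1 : Matrix.single 0 0 1 * (A * Matrix.single 0 0 1) = A 0 0 • (Matrix.single 0 0 1 : Mat N) := by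
    rw [← mul_assoc, Matrix.single_mul_mul_single]
    simp
  calc V.incl p l = V.rep p (Matrix.single 0 0 1) (V.rep p A
        (V.rep p (Matrix.single 0 0 1) (V.incl p s))) := by rw [rep_incl, hT, rep_incl]
    _ = V.rep p (A 0 0 • (Matrix.single 0 0 1 : Mat N)) (V.incl p s) := by
      rw [rep_mul_apply, rep_mul_apply, mul_assoc, h1]
    _ = A 0 0 • V.rep p (Matrix.single 0 0 1) (V.incl p s) := by rw [map_smul]; rfl
    _ = _ := by rw [rep_incl, map_smul]

section Triv

open ComplexVectorBundle

variable {EM : Type*} [NormedAddCommGroup EM] [NormedSpace ℝ EM] {HM : Type*} [TopologicalSpace HM]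
  {IM : ModelWithCorners ℝ EM HM} {M : Type*} [TopologicalSpace M] [ChartedSpace HM M]

/-- A coordinate of the trivialization around `p₀` does not vanish on the line at `p₀`. -/
lemma exists_frameVec (p₀ : TrivBundle 𝒜) : ∃ (w : Fin N → ℂ) (i : Fin N),
    (trivializationAt (Fin N → ℂ) V.Fiber p₀ ⟨p₀, V.rep p₀ (Matrix.single 0 0 1)
      ((trivializationAt (Fin N → ℂ) V.Fiber p₀).symm p₀ w)⟩).2 i ≠ 0 := by
  have hp := mem_baseSet_trivializationAt (Fin N → ℂ) V.Fiber p₀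
  obtain ⟨l, hl⟩ := V.exists_line_ne_zero p₀
  have h1 : triv p₀ p₀ hp (V.incl p₀ l) ≠ 0 := by
    rw [Ne, LinearEquiv.map_eq_zero_iff]
    exact fun h => hl (incl_injective (by rw [h, map_zero]))
  obtain ⟨i, hi⟩ := Function.ne_iff.1 h1
  -- The coordinate vector of a nonzero element of the line, which the projection `E₀₀` fixes.
  refine ⟨triv p₀ p₀ hp (V.incl p₀ l), i, ?_⟩
  rw [← triv_symm_apply V.toComplexVectorBundle p₀ p₀ hp, LinearEquiv.symm_apply_apply, rep_incl]
  exact hi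

/-- A vector which projects to a nonzero element of the line at `p₀`, in the trivialization around
`p₀`. -/
def frameVec (p₀ : TrivBundle 𝒜) : Fin N → ℂ := (V.exists_frameVec p₀).choose

/-- The index of a coordinate which does not vanish on the line at `p₀`. -/
def frameIdx (p₀ : TrivBundle 𝒜) : Fin N := (V.exists_frameVec p₀).choose_spec.choose

/-- A local section of the line bundle around `p₀`. -/
def frameSec (p₀ p : TrivBundle 𝒜) : V.LineFiber p :=
  V.proj p ((trivializationAt (Fin N → ℂ) V.Fiber p₀).symm p (V.frameVec p₀))

/-- A coordinate of the trivialization around `p₀`. -/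
def coord (p₀ : TrivBundle 𝒜) (x : TotalSpace (Fin N → ℂ) V.Fiber) : ℂ :=
  (trivializationAt (Fin N → ℂ) V.Fiber p₀ x).2 (V.frameIdx p₀)

/-- The coordinate of the local section. -/
def frameCoord (p₀ p : TrivBundle 𝒜) : ℂ := V.coord p₀ ⟨p, V.incl p (V.frameSec p₀ p)⟩

lemma frameCoord_self (p₀ : TrivBundle 𝒜) : V.frameCoord p₀ p₀ ≠ 0 :=
  (V.exists_frameVec p₀).choose_spec.choose_spec

/-- The domain of the local trivialization of the line bundle around `p₀`. -/
def lineDom (p₀ : TrivBundle 𝒜) : Set (TrivBundle 𝒜) :=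
  (trivializationAt (Fin N → ℂ) V.Fiber p₀).baseSet ∩ V.frameCoord p₀ ⁻¹' {0}ᶜ

lemma mem_lineDom (p₀ : TrivBundle 𝒜) : p₀ ∈ V.lineDom p₀ :=
  ⟨mem_baseSet_trivializationAt _ _ _, V.frameCoord_self p₀⟩

lemma contMDiffWithinAt_coord' {f : M → TotalSpace (Fin N → ℂ) V.Fiber} {s : Set M} {x₀ : M}
    {p₀ : TrivBundle 𝒜} (h₀ : (f x₀).proj ∈ (trivializationAt (Fin N → ℂ) V.Fiber p₀).baseSet)
    (hf : ContMDiffWithinAt IM (𝓘(ℝ, E × slice N).prod 𝓘(ℝ, Fin N → ℂ)) ∞ f s x₀) :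
    ContMDiffWithinAt IM 𝓘(ℝ, ℂ) ∞ (fun x => V.coord p₀ (f x)) s x₀ :=
  (contDiff_apply ℝ ℂ (V.frameIdx p₀)).contMDiff.contMDiffAt.comp_contMDiffWithinAt x₀
    ((((trivializationAt (Fin N → ℂ) V.Fiber p₀).contMDiffWithinAt_iff
      ((trivializationAt (Fin N → ℂ) V.Fiber p₀).mem_source.2 h₀)).1 hf).2)

/-- A smooth family of matrices, applied to a smooth family of vectors. -/
lemma contMDiffWithinAt_rep {A : M → Mat N} {f : M → TotalSpace (Fin N → ℂ) V.Fiber} {s : Set M}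
    {x₀ : M} (hA : ContMDiffWithinAt IM 𝓘(ℝ, Mat N) ∞ A s x₀)
    (hf : ContMDiffWithinAt IM (𝓘(ℝ, E × slice N).prod 𝓘(ℝ, Fin N → ℂ)) ∞ f s x₀) :
    ContMDiffWithinAt IM (𝓘(ℝ, E × slice N).prod 𝓘(ℝ, Fin N → ℂ)) ∞ (fun x =>
      (⟨(f x).proj, V.rep (f x).proj (A x) (f x).2⟩ : TotalSpace (Fin N → ℂ) V.Fiber)) s x₀ :=
  (V.contMDiff_rep (A x₀, f x₀)).comp_contMDiffWithinAt x₀ (hA.prodMk hf)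

lemma contMDiffAt_incl_frameSec (p₀ : TrivBundle 𝒜) {p : TrivBundle 𝒜}
    (hp : p ∈ (trivializationAt (Fin N → ℂ) V.Fiber p₀).baseSet) :
    ContMDiffAt 𝓘(ℝ, E × slice N) (𝓘(ℝ, E × slice N).prod 𝓘(ℝ, Fin N → ℂ)) ∞
      (fun p => (⟨p, V.incl p (V.frameSec p₀ p)⟩ : TotalSpace (Fin N → ℂ) V.Fiber)) p :=
  V.contMDiffWithinAt_rep (s := Set.univ) (contMDiffWithinAt_const (c := Matrix.single 0 0 1))
    (V.contMDiffWithinAt_symm (f := fun p => p) p₀ hp contMDiffWithinAt_id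
      (contMDiffWithinAt_const (c := V.frameVec p₀)))

lemma contMDiffAt_coord_frameSec (p₀ p₁ : TrivBundle 𝒜) {p : TrivBundle 𝒜}
    (hp₀ : p ∈ (trivializationAt (Fin N → ℂ) V.Fiber p₀).baseSet)
    (hp₁ : p ∈ (trivializationAt (Fin N → ℂ) V.Fiber p₁).baseSet) :
    ContMDiffAt 𝓘(ℝ, E × slice N) 𝓘(ℝ, ℂ) ∞
      (fun p => V.coord p₁ ⟨p, V.incl p (V.frameSec p₀ p)⟩) p :=
  V.contMDiffWithinAt_coord' hp₁ (V.contMDiffAt_incl_frameSec p₀ hp₀)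

lemma isOpen_lineDom (p₀ : TrivBundle 𝒜) : IsOpen (V.lineDom p₀) := by
  refine ContinuousOn.isOpen_inter_preimage (fun p hp => ?_)
    (trivializationAt (Fin N → ℂ) V.Fiber p₀).open_baseSet isOpen_compl_singleton
  exact (V.contMDiffAt_coord_frameSec p₀ p₀ hp hp).continuousAt.continuousWithinAt

/-- The coordinate is linear on the fibres of the line bundle. -/
def coordLin (p₀ p : TrivBundle 𝒜) (hp : p ∈ V.lineDom p₀) : V.LineFiber p →ₗ[ℂ] ℂ :=
  LinearMap.proj (V.frameIdx p₀) ∘ₗ (triv p₀ p hp.1).toLinearMap ∘ₗ V.incl p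

lemma coordLin_apply (p₀ p : TrivBundle 𝒜) (hp : p ∈ V.lineDom p₀) (l : V.LineFiber p) :
    V.coordLin p₀ p hp l = V.coord p₀ ⟨p, V.incl p l⟩ := rfl

/-- The local trivialization of the line bundle around `p₀`, on a fibre. -/
def lineTriv (p₀ p : TrivBundle 𝒜) (hp : p ∈ V.lineDom p₀) : V.LineFiber p ≃ₗ[ℂ] ℂ :=
  { V.coordLin p₀ p hp with
    invFun := fun c => (c / V.frameCoord p₀ p) • V.frameSec p₀ p
    left_inv := by
      intro l
      have h0 : V.frameCoord p₀ p ≠ 0 := hp.2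
      have hs : V.frameSec p₀ p ≠ 0 := by
        intro h
        apply h0
        rw [frameCoord, ← V.coordLin_apply p₀ p hp, h, map_zero]
      obtain ⟨c, rfl⟩ := V.exists_eq_smul p hs l
      change (V.coordLin p₀ p hp (c • V.frameSec p₀ p) / _) • _ = _
      rw [map_smul, coordLin_apply, smul_eq_mul]
      change (c * V.frameCoord p₀ p / _) • _ = _
      rw [mul_div_cancel_right₀ _ h0]
    right_inv := by
      intro c
      have h0 : V.frameCoord p₀ p ≠ 0 := hp.2
      change V.coordLin p₀ p hp _ = c
      rw [map_smul, coordLin_apply, smul_eq_mul]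
      change _ * V.frameCoord p₀ p = _
      rw [div_mul_cancel₀ _ h0] }

lemma lineTriv_apply (p₀ p : TrivBundle 𝒜) (hp : p ∈ V.lineDom p₀) (l : V.LineFiber p) :
    V.lineTriv p₀ p hp l = V.coord p₀ ⟨p, V.incl p l⟩ := rfl

lemma lineTriv_symm_apply (p₀ p : TrivBundle 𝒜) (hp : p ∈ V.lineDom p₀) (c : ℂ) :
    (V.lineTriv p₀ p hp).symm c = (c / V.frameCoord p₀ p) • V.frameSec p₀ p := rfl

open Classical in
/-- The local trivialization of the line bundle around `p₀`. -/
def linePretriv (p₀ : TrivBundle 𝒜) : Pretrivialization ℂ (π ℂ V.LineFiber) where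
  toFun t := (t.proj, if h : t.proj ∈ V.lineDom p₀ then V.lineTriv p₀ t.proj h t.2 else 0)
  invFun y := ⟨y.1, if h : y.1 ∈ V.lineDom p₀ then (V.lineTriv p₀ y.1 h).symm y.2 else 0⟩
  source := π ℂ V.LineFiber ⁻¹' V.lineDom p₀
  target := V.lineDom p₀ ×ˢ Set.univ
  map_source' t h := ⟨h, trivial⟩
  map_target' y h := h.1
  left_inv' := by
    rintro ⟨x, t⟩ h
    have h' : x ∈ V.lineDom p₀ := h
    simp [h']
  right_inv' := by
    rintro ⟨x, w⟩ ⟨h, -⟩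
    have h' : x ∈ V.lineDom p₀ := h
    simp [h']
  open_target := (V.isOpen_lineDom p₀).prod isOpen_univ
  baseSet := V.lineDom p₀
  open_baseSet := V.isOpen_lineDom p₀
  source_eq := rfl
  target_eq := rfl
  proj_toFun t h := rfl

lemma linePretriv_apply (p₀ p : TrivBundle 𝒜) (h : p ∈ V.lineDom p₀) (t : V.LineFiber p) :
    (V.linePretriv p₀ ⟨p, t⟩).2 = V.lineTriv p₀ p h t := dif_pos h

lemma linePretriv_symm (p₀ p : TrivBundle 𝒜) (h : p ∈ V.lineDom p₀) (w : ℂ) :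
    (V.linePretriv p₀).symm p w = (V.lineTriv p₀ p h).symm w := by
  have h1 := V.linePretriv_apply p₀ p h ((V.lineTriv p₀ p h).symm w)
  rw [LinearEquiv.apply_symm_apply] at h1
  have := (V.linePretriv p₀).symm_apply_apply_mk h ((V.lineTriv p₀ p h).symm w)
  rwa [h1] at this

instance (p : TrivBundle 𝒜) : TopologicalSpace (V.LineFiber p) :=
  TopologicalSpace.induced (V.lineTriv p p (V.mem_lineDom p)) inferInstance

lemma line_coordChange (p₀ p₁ p : TrivBundle 𝒜) (h₀ : p ∈ V.lineDom p₀) (h₁ : p ∈ V.lineDom p₁)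
    (w : ℂ) : (V.linePretriv p₁ ⟨p, (V.linePretriv p₀).symm p w⟩).2 =
      ((V.frameCoord p₀ p)⁻¹ * V.coord p₁ ⟨p, V.incl p (V.frameSec p₀ p)⟩) • w := by
  rw [linePretriv_apply _ _ _ h₁, linePretriv_symm _ _ _ h₀, lineTriv_symm_apply, map_smul,
    lineTriv_apply, smul_eq_mul, smul_eq_mul]
  ring

lemma contMDiffAt_line_coordChange (p₀ p₁ : TrivBundle 𝒜) {p : TrivBundle 𝒜}
    (h₀ : p ∈ V.lineDom p₀) (h₁ : p ∈ V.lineDom p₁) :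
    ContMDiffAt 𝓘(ℝ, E × slice N) 𝓘(ℝ, ℂ) ∞
      (fun p => (V.frameCoord p₀ p)⁻¹ * V.coord p₁ ⟨p, V.incl p (V.frameSec p₀ p)⟩) p := by
  have e1 : ContMDiffAt 𝓘(ℝ, E × slice N) 𝓘(ℝ, ℂ) ∞ (fun p => (V.frameCoord p₀ p)⁻¹) p :=
    ContMDiffAt.comp p (g := fun z : ℂ => z⁻¹) (_root_.contDiffAt_inv ℝ h₀.2).contMDiffAt
      (V.contMDiffAt_coord_frameSec p₀ p₀ h₀.1 h₀.1)
  exact ContMDiffWithinAt.complexMul e1 (V.contMDiffAt_coord_frameSec p₀ p₁ h₀.1 h₁.1)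

/-- The line bundle, as a prebundle. -/
def linePrebundle : VectorPrebundle ℂ ℂ V.LineFiber where
  pretrivializationAtlas := Set.range V.linePretriv
  pretrivialization_linear' := by
    rintro _ ⟨p₀, rfl⟩
    refine ⟨fun x hx => ⟨fun s t => ?_, fun c t => ?_⟩⟩
    · rw [V.linePretriv_apply p₀ x hx, V.linePretriv_apply p₀ x hx,
        V.linePretriv_apply p₀ x hx, map_add]
    · rw [V.linePretriv_apply p₀ x hx, V.linePretriv_apply p₀ x hx, map_smul]
  pretrivializationAt := V.linePretriv
  mem_base_pretrivializationAt := V.mem_lineDom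
  pretrivialization_mem_atlas x := Set.mem_range_self x
  exists_coordChange := by
    rintro _ ⟨p₀, rfl⟩ _ ⟨p₁, rfl⟩
    refine ⟨fun p => ((V.frameCoord p₀ p)⁻¹ * V.coord p₁ ⟨p, V.incl p (V.frameSec p₀ p)⟩) •
      ContinuousLinearMap.id ℂ ℂ, ?_, ?_⟩
    · intro p hp
      exact ((V.contMDiffAt_line_coordChange p₀ p₁ hp.1 hp.2).continuousAt.smul
        continuousAt_const).continuousWithinAt
    · rintro p ⟨h₀, h₁⟩ w
      rw [V.line_coordChange p₀ p₁ p h₀ h₁]; rfl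
  totalSpaceMk_isInducing x := by
    have h : (V.linePretriv x ∘ TotalSpace.mk x) =
        fun t => (x, V.lineTriv x x (V.mem_lineDom x) t) := by
      -- The topology of the fibre was defined as the one induced by the trivialization around its
      -- own base point, which is the one occurring here.
      funext t
      exact Prod.ext rfl (V.linePretriv_apply x x (V.mem_lineDom x) t)
    rw [h]
    exact (isInducing_prodMkRight x).comp ⟨rfl⟩

instance : TopologicalSpace (TotalSpace ℂ V.LineFiber) := V.linePrebundle.totalSpaceTopology

instance : FiberBundle ℂ V.LineFiber := V.linePrebundle.toFiberBundle

instance : VectorBundle ℂ ℂ V.LineFiber := V.linePrebundle.toVectorBundle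

lemma trivializationAt_line_apply (p₀ p : TrivBundle 𝒜) (h : p ∈ V.lineDom p₀)
    (t : V.LineFiber p) :
    (trivializationAt ℂ V.LineFiber p₀ ⟨p, t⟩).2 = V.coord p₀ ⟨p, V.incl p t⟩ :=
  V.linePretriv_apply p₀ p h t

instance : ContMDiffVectorBundle ∞ ℂ V.LineFiber 𝓘(ℝ, E × slice N) where
  contMDiffOn_coordChangeL := by
    intro e e' me me'
    have i1 := isLinear_real ℂ V.LineFiber e
    have i2 := isLinear_real ℂ V.LineFiber e'
    obtain ⟨_, ⟨p₀, rfl⟩, rfl⟩ := me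
    obtain ⟨_, ⟨p₁, rfl⟩, rfl⟩ := me'
    have hs : ContDiff ℝ ∞ (fun c : ℂ => c • ContinuousLinearMap.id ℝ ℂ) :=
      contDiff_id.smul contDiff_const
    have h : ContMDiffOn 𝓘(ℝ, E × slice N) 𝓘(ℝ, ℂ →L[ℝ] ℂ) ∞ (fun p => ((V.frameCoord p₀ p)⁻¹ *
        V.coord p₁ ⟨p, V.incl p (V.frameSec p₀ p)⟩) • ContinuousLinearMap.id ℝ ℂ)
        (V.lineDom p₀ ∩ V.lineDom p₁) := fun p hp =>
      (hs.contMDiff.contMDiffAt.comp p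
        (V.contMDiffAt_line_coordChange p₀ p₁ hp.1 hp.2)).contMDiffWithinAt
    refine h.congr fun x hx => ?_
    ext1
    rw [ContinuousLinearEquiv.coe_coe, Trivialization.coordChangeL_apply _ _ hx]
    exact V.line_coordChange p₀ p₁ x hx.1 hx.2 _

/-- The line bundle of a representing bundle. -/
def lineBundle : ComplexVectorBundle ℂ (E × slice N) (TrivBundle 𝒜) where
  Fiber := V.LineFiber

/-- A family of elements of the lines is smooth if it is smooth as a family of vectors. -/
lemma contMDiffWithinAt_line {f : M → TotalSpace ℂ V.LineFiber} {s : Set M} {x₀ : M}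
    (hf : ContMDiffWithinAt IM (𝓘(ℝ, E × slice N).prod 𝓘(ℝ, Fin N → ℂ)) ∞
      (fun x => (⟨(f x).proj, V.incl _ (f x).2⟩ : TotalSpace (Fin N → ℂ) V.Fiber)) s x₀) :
    ContMDiffWithinAt IM (𝓘(ℝ, E × slice N).prod 𝓘(ℝ, ℂ)) ∞ f s x₀ := by
  have h1 := (Bundle.contMDiffWithinAt_totalSpace.1 hf).1
  have h2 := V.contMDiffWithinAt_coord' (p₀ := (f x₀).proj)
    (mem_baseSet_trivializationAt _ _ (f x₀).proj) hf
  refine Bundle.contMDiffWithinAt_totalSpace.2 ⟨h1, h2.congr_of_eventuallyEq ?_ ?_⟩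
  · filter_upwards [h1.continuousWithinAt.eventually_mem
      ((V.isOpen_lineDom (f x₀).proj).mem_nhds (V.mem_lineDom _))] with x hx
    exact V.trivializationAt_line_apply _ _ hx _
  · exact V.trivializationAt_line_apply _ _ (V.mem_lineDom _) _

/-- The inclusion of the line bundle is smooth. -/
lemma contMDiffWithinAt_incl {f : M → TotalSpace ℂ V.LineFiber} {s : Set M} {x₀ : M}
    (hf : ContMDiffWithinAt IM (𝓘(ℝ, E × slice N).prod 𝓘(ℝ, ℂ)) ∞ f s x₀) :
    ContMDiffWithinAt IM (𝓘(ℝ, E × slice N).prod 𝓘(ℝ, Fin N → ℂ)) ∞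
      (fun x => (⟨(f x).proj, V.incl _ (f x).2⟩ : TotalSpace (Fin N → ℂ) V.Fiber)) s x₀ := by
  obtain ⟨h1, h2⟩ := Bundle.contMDiffWithinAt_totalSpace.1 hf
  set p₀ := (f x₀).proj with hp₀
  have hm := V.mem_lineDom p₀
  have e1 : ContMDiffWithinAt IM 𝓘(ℝ, ℂ) ∞ (fun x => (V.frameCoord p₀ (f x).proj)⁻¹) s x₀ :=
    ContMDiffAt.comp_contMDiffWithinAt (g := fun p => (V.frameCoord p₀ p)⁻¹) x₀
      (ContMDiffAt.comp p₀ (g := fun z : ℂ => z⁻¹) (_root_.contDiffAt_inv ℝ hm.2).contMDiffAt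
        (V.contMDiffAt_coord_frameSec p₀ p₀ hm.1 hm.1)) h1
  have e2 : ContMDiffWithinAt IM 𝓘(ℝ, Fin N → ℂ) ∞ (fun x =>
      (trivializationAt (Fin N → ℂ) V.Fiber p₀
        ⟨(f x).proj, V.incl _ (V.frameSec p₀ (f x).proj)⟩).2) s x₀ :=
    ContMDiffAt.comp_contMDiffWithinAt (g := fun p => (trivializationAt (Fin N → ℂ) V.Fiber p₀
        ⟨p, V.incl _ (V.frameSec p₀ p)⟩).2) x₀ ((Bundle.contMDiffAt_section p₀).1
        (V.contMDiffAt_incl_frameSec p₀ hm.1)) h1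
  have hs : ContDiff ℝ ∞ (fun p : ℂ × (Fin N → ℂ) => p.1 • p.2) := contDiff_fst.smul contDiff_snd
  have e3 := hs.contMDiff.contMDiffAt.comp_contMDiffWithinAt x₀ ((h2.complexMul e1).prodMk_space e2)
  -- An element of the line is the multiple of the local section `frameSec` by the quotient of the
  -- coordinates, and that section is smooth in `V`.
  have key : ∀ x, (f x).proj ∈ V.lineDom p₀ → (trivializationAt (Fin N → ℂ) V.Fiber p₀
      ⟨(f x).proj, V.incl _ (f x).2⟩).2 = ((trivializationAt ℂ V.LineFiber p₀ (f x)).2 *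
        (V.frameCoord p₀ (f x).proj)⁻¹) • (trivializationAt (Fin N → ℂ) V.Fiber p₀
        ⟨(f x).proj, V.incl _ (V.frameSec p₀ (f x).proj)⟩).2 := by
    intro x hx
    have h3 := (V.lineTriv p₀ _ hx).symm_apply_apply (f x).2
    rw [lineTriv_symm_apply, lineTriv_apply, ← V.trivializationAt_line_apply _ _ hx] at h3
    rw [← triv_apply V.toComplexVectorBundle p₀ _ hx.1, ← triv_apply V.toComplexVectorBundle p₀ _ hx.1,
      ← map_smul, ← map_smul, ← div_eq_mul_inv]
    exact congrArg (fun l => triv p₀ _ hx.1 (V.incl _ l)) h3.symm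
  refine Bundle.contMDiffWithinAt_totalSpace.2 ⟨h1, e3.congr_of_eventuallyEq ?_ (key x₀ hm)⟩
  filter_upwards [h1.continuousWithinAt.eventually_mem
      ((V.isOpen_lineDom p₀).mem_nhds hm)] with x hx using key x hx

end Triv

end RepresentingBundle

end

section

variable {N : ℕ} [NeZero N]
variable {E : Type*} [NormedAddCommGroup E] [NormedSpace ℝ E]
  {Z : Type*} [TopologicalSpace Z] [ChartedSpace E Z] {𝒜 : AzumayaBundle N E Z}

namespace RepresentingBundle

variable [IsManifold 𝓘(ℝ, E) ∞ Z] (V : RepresentingBundle 𝒜)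

/-! ### The action of `SU(N)` on the line bundle -/

section Action

/-- The action of `SU(N)` between the lines. -/
def lineAct (g : SU N) (p : TrivBundle 𝒜) : V.LineFiber p →ₗ[ℂ] V.LineFiber (g • p) :=
  V.proj (g • p) ∘ₗ V.rep (g • p) (star g.1) ∘ₗ V.act g p ∘ₗ V.incl p

/-- By `act_rep`, the action of `g` followed by the matrix `g*` commutes with all matrices, so it
already maps the line to the line. The factor `E₀₀` comes from the projection, which fixes the
result and serves to land in the type of the line. -/
lemma incl_lineAct (g : SU N) (p : TrivBundle 𝒜) (l : V.LineFiber p) :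
    V.incl (g • p) (V.lineAct g p l) =
      V.rep (g • p) (Matrix.single 0 0 1 * star g.1) (V.act g p (V.incl p l)) := by
  rw [← rep_mul_apply]; rfl

/-- The action of a matrix on the total space. -/
def totalRep (A : Mat N) (x : TotalSpace (Fin N → ℂ) V.Fiber) : TotalSpace (Fin N → ℂ) V.Fiber :=
  ⟨x.proj, V.rep x.proj A x.2⟩

/-- The inclusion of the total space of the line bundle. -/
def totalIncl (x : TotalSpace ℂ V.LineFiber) : TotalSpace (Fin N → ℂ) V.Fiber :=
  ⟨x.proj, V.incl x.proj x.2⟩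

lemma totalIncl_injective : Function.Injective V.totalIncl := by
  rintro ⟨p, l⟩ ⟨q, m⟩ h
  obtain rfl : p = q := congrArg TotalSpace.proj h
  exact congrArg (TotalSpace.mk p) (incl_injective (TotalSpace.mk_inj.1 h))

lemma star_mul_self_coe (g : SU N) : star g.1 * g.1 = 1 := (Unitary.mem_iff.1 g.2.1).1

/-- Moving the matrix `E₀₀ h*` past the action of `g` conjugates it by `g`, and `E₀₀ g* (g E₀₀ h*
g*) = E₀₀ (gh)*`. -/
lemma incl_lineAct_lineAct (g h : SU N) (p : TrivBundle 𝒜) (l : V.LineFiber p) :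
    V.incl (g • h • p) (V.lineAct g (h • p) (V.lineAct h p l)) =
      V.rep (g • h • p) (Matrix.single 0 0 1 * star (g * h).1)
        (V.act g (h • p) (V.act h p (V.incl p l))) := by
  rw [incl_lineAct, incl_lineAct, act_rep, rep_mul_apply]
  congr 2
  change _ = _ * star (g.1 * h.1)
  rw [star_mul]
  symm
  calc (Matrix.single 0 0 1 : Mat N) * (star h.1 * star g.1)
      = (Matrix.single 0 0 1 * Matrix.single 0 0 1) * (star h.1 * star g.1) := by
        rw [Matrix.single_mul_single_same, mul_one]
    _ = Matrix.single 0 0 1 * (star g.1 * g.1) * Matrix.single 0 0 1 * (star h.1 * star g.1) := by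
        rw [star_mul_self_coe, mul_one]
    _ = _ := by noncomm_ring

-- Smoothness may be tested after the inclusion into `V`. There the map is a composite of the smooth
-- action of `SU(N)` on `V` and of the smooth matrix action.
open Classical in
lemma contMDiffOn_lineAct : ContMDiffOn
    (𝓘(ℝ, Mat N).prod (𝓘(ℝ, E × slice N).prod 𝓘(ℝ, ℂ))) (𝓘(ℝ, E × slice N).prod 𝓘(ℝ, ℂ)) ∞
    (fun x : Mat N × TotalSpace ℂ V.LineFiber =>
      if h : x.1 ∈ Matrix.specialUnitaryGroup (Fin N) ℂ then
        (⟨(⟨x.1, h⟩ : SU N) • x.2.proj, V.lineAct ⟨x.1, h⟩ x.2.proj x.2.2⟩ :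
          TotalSpace ℂ V.LineFiber)
      else x.2)
    {x | x.1 ∈ Matrix.specialUnitaryGroup (Fin N) ℂ} := by
  intro x₀ hx₀
  refine V.contMDiffWithinAt_line ?_
  set S : Set (Mat N × TotalSpace ℂ V.LineFiber) :=
    {x | x.1 ∈ Matrix.specialUnitaryGroup (Fin N) ℂ} with hS
  have hfst : ContMDiffWithinAt (𝓘(ℝ, Mat N).prod (𝓘(ℝ, E × slice N).prod 𝓘(ℝ, ℂ)))
      𝓘(ℝ, Mat N) ∞ (fun x : Mat N × TotalSpace ℂ V.LineFiber => x.1) S x₀ :=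
    contMDiffWithinAt_fst
  have hincl := V.contMDiffWithinAt_incl (contMDiffWithinAt_snd (s := S) (p := x₀)
      (I := 𝓘(ℝ, Mat N)) (J := 𝓘(ℝ, E × slice N).prod 𝓘(ℝ, ℂ)) (n := ∞))
  have hact := (V.contMDiffOn_totalAct (x₀.1, V.totalIncl x₀.2) hx₀).comp x₀ (hfst.prodMk hincl)
    (fun x hx => hx)
  have hA : ContMDiffWithinAt (𝓘(ℝ, Mat N).prod (𝓘(ℝ, E × slice N).prod 𝓘(ℝ, ℂ)))
      𝓘(ℝ, Mat N) ∞ (fun x : Mat N × TotalSpace ℂ V.LineFiber =>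
        Matrix.single 0 0 1 * star x.1) S x₀ :=
    contMDiffWithinAt_const.matMul
      ((TrivBundle.contDiff_star.contMDiff.contMDiffAt).comp_contMDiffWithinAt x₀ hfst)
  have h := V.contMDiffWithinAt_rep hA hact
  have key : ∀ x ∈ S, V.totalIncl (if h : x.1 ∈ Matrix.specialUnitaryGroup (Fin N) ℂ then
        (⟨(⟨x.1, h⟩ : SU N) • x.2.proj, V.lineAct ⟨x.1, h⟩ x.2.proj x.2.2⟩ :
          TotalSpace ℂ V.LineFiber) else x.2) =
      V.totalRep (Matrix.single 0 0 1 * star x.1) (V.totalAct (x.1, V.totalIncl x.2)) := by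
    intro x hx
    have hx' : x.1 ∈ Matrix.specialUnitaryGroup (Fin N) ℂ := hx
    rw [dif_pos hx', EquivariantBundle.totalAct_of_mem _ (x.1, V.totalIncl x.2) hx']
    exact congrArg (TotalSpace.mk _) (V.incl_lineAct ⟨x.1, hx'⟩ x.2.proj x.2.2)
  exact h.congr key (key x₀ hx₀)

/-- The line bundle of a representing bundle, with its action of `SU(N)`. -/
def equivariantLine : EquivariantBundle ℂ 𝒜 where
  toComplexVectorBundle := V.lineBundle
  act := V.lineAct
  act_one p l := by
    apply V.totalIncl_injective
    have h1 : V.totalIncl ⟨(1 : SU N) • p, V.lineAct 1 p l⟩ =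
        V.totalRep (Matrix.single 0 0 1 * star (1 : Mat N)) ⟨(1 : SU N) • p, V.act 1 p (V.incl p l)⟩ :=
      congrArg (TotalSpace.mk _) (V.incl_lineAct 1 p l)
    refine h1.trans ?_
    rw [V.act_one, star_one, mul_one]
    exact congrArg (TotalSpace.mk p) (V.rep_incl p l)
  act_mul g h p l := by
    apply V.totalIncl_injective
    have h1 : V.totalIncl ⟨(g * h) • p, V.lineAct (g * h) p l⟩ =
        V.totalRep (Matrix.single 0 0 1 * star (g * h).1)
          ⟨(g * h) • p, V.act (g * h) p (V.incl p l)⟩ :=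
      congrArg (TotalSpace.mk _) (V.incl_lineAct (g * h) p l)
    refine h1.trans ?_
    rw [V.act_mul]
    exact congrArg (TotalSpace.mk (g • h • p)) (V.incl_lineAct_lineAct g h p l).symm
  contMDiffOn_act := V.contMDiffOn_lineAct

end Action

/-! ### The equivalence with the twist of the standard bundle -/

section Equivalence

open ComplexVectorBundle TensorProduct

/-- The matrix whose first column is a given vector, the other columns being zero. -/
def col : (Fin N → ℂ) →ₗ[ℂ] Mat N where
  toFun w := Matrix.vecMulVec w (Pi.single 0 1)
  map_add' _ _ := Matrix.add_vecMulVec _ _ _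
  map_smul' _ _ := Matrix.smul_vecMulVec _ _ _

lemma col_apply (w : Fin N → ℂ) : col w = Matrix.vecMulVec w (Pi.single 0 1) := rfl

lemma mul_col (A : Mat N) (w : Fin N → ℂ) : A * col w = col (A *ᵥ w) := by
  rw [col_apply, col_apply, Matrix.mul_vecMulVec]

lemma col_mul_single (w : Fin N → ℂ) : col w * Matrix.single 0 0 1 = col w := by
  rw [col_apply, Matrix.vecMulVec_mul]
  congr 1
  ext j
  simp [Matrix.single_apply, Pi.single_apply, eq_comm]

/-- This identity makes the `i`-th summand of `toTwisted` recover the `i`-th coordinate of `w`. -/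
lemma single_mul_col (i : Fin N) (w : Fin N → ℂ) :
    Matrix.single 0 i 1 * col w = w i • (Matrix.single 0 0 1 : Mat N) := by
  ext a b
  rw [Matrix.smul_apply, Matrix.single_apply]
  by_cases ha : a = 0
  · subst ha
    rw [Matrix.single_mul_apply_same, col_apply, Matrix.vecMulVec_apply, one_mul, smul_eq_mul,
      Pi.single_apply]
    simp [eq_comm]
  · rw [Matrix.single_mul_apply_of_ne _ _ _ _ _ ha, if_neg (fun h => ha h.1.symm), smul_zero]

lemma col_single (i : Fin N) : col (Pi.single i 1) = Matrix.single i 0 1 := by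
  rw [col_apply, Matrix.single_eq_single_vecMulVec_single]

/-- The fibres of the tensor product of the line bundle with the standard bundle. -/
abbrev Twisted (p : TrivBundle 𝒜) : Type _ :=
  TensorFiber V.lineBundle (trivialBundle 𝒜) p

/-- Pure tensors of elements of the line and vectors. -/
def tens (p : TrivBundle 𝒜) (l : V.LineFiber p) (w : Fin N → ℂ) : V.Twisted p :=
  TensorFiber.tmul (L := V.lineBundle) (V := trivialBundle 𝒜) l w

lemma exists_eq_tens (p : TrivBundle 𝒜) (t : V.Twisted p) : ∃ l w, t = V.tens p l w :=
  TensorFiber.exists_eq_tmul t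

lemma sum_tens (p : TrivBundle 𝒜) (l : V.LineFiber p) (w : Fin N → ℂ) :
    ∑ i, V.tens p (w i • l) (Pi.single i 1) = V.tens p l w := by
  change (∑ i, (w i • l) ⊗ₜ[ℂ] (Pi.single i 1 : Fin N → ℂ) : V.LineFiber p ⊗[ℂ] (Fin N → ℂ)) =
    l ⊗ₜ[ℂ] w
  simp only [TensorProduct.smul_tmul]
  rw [← TensorProduct.tmul_sum]
  congr 1
  ext j
  simp [Finset.sum_apply, Pi.single_apply]

/-- The map from the tensor product of the line with `ℂ^N`. -/
def fromTwisted (p : TrivBundle 𝒜) : V.Twisted p →ₗ[ℂ] V.Fiber p :=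
  (TensorProduct.lift (LinearMap.flip
    { toFun := fun w : Fin N → ℂ => V.rep p (col w) ∘ₗ V.incl p
      map_add' := fun w w' => by
        rw [map_add col, ← LinearMap.add_comp]
        exact congrArg (fun T => T ∘ₗ V.incl p) ((V.rep p).toLinearMap.map_add (col w) (col w'))
      map_smul' := fun c w => by
        rw [map_smul col, RingHom.id_apply, ← LinearMap.smul_comp]
        exact congrArg (fun T => T ∘ₗ V.incl p) ((V.rep p).toLinearMap.map_smul c (col w)) }) :
    V.LineFiber p ⊗[ℂ] (Fin N → ℂ) →ₗ[ℂ] V.Fiber p)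

/-- The vector `l` plays the role of the first basis vector `e₀` of `ℂ^N`: a vector `w = A e₀` goes
to `A l`, with `A = col w`. -/
lemma fromTwisted_tens (p : TrivBundle 𝒜) (l : V.LineFiber p) (w : Fin N → ℂ) :
    V.fromTwisted p (V.tens p l w) = V.rep p (col w) (V.incl p l) := rfl

/-- The tensor product with a vector. -/
def tensRight (p : TrivBundle 𝒜) (w : Fin N → ℂ) : V.LineFiber p →ₗ[ℂ] V.Twisted p :=
  (TensorProduct.mk ℂ (V.LineFiber p) (Fin N → ℂ)).flip w

/-- The map to the tensor product of the line with `ℂ^N`. -/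
def toTwisted (p : TrivBundle 𝒜) : V.Fiber p →ₗ[ℂ] V.Twisted p :=
  ∑ i, V.tensRight p (Pi.single i 1) ∘ₗ V.proj p ∘ₗ V.rep p (Matrix.single 0 i 1)

lemma toTwisted_apply (p : TrivBundle 𝒜) (v : V.Fiber p) :
    V.toTwisted p v = ∑ i, V.tens p (V.proj p (V.rep p (Matrix.single 0 i 1) v)) (Pi.single i 1) := by
  rw [toTwisted, LinearMap.sum_apply]
  rfl

/-- The composite is the action of `∑ E_i0 E₀₀ E_0i = ∑ E_ii = 1`. -/
lemma fromTwisted_toTwisted (p : TrivBundle 𝒜) (v : V.Fiber p) :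
    V.fromTwisted p (V.toTwisted p v) = v := by
  rw [toTwisted_apply, map_sum]
  have h : ∀ i : Fin N, V.fromTwisted p (V.tens p (V.proj p (V.rep p (Matrix.single 0 i 1) v))
      (Pi.single i 1)) = V.rep p (Matrix.single i i 1) v := by
    intro i
    rw [fromTwisted_tens, incl_proj, rep_mul_apply, rep_mul_apply, col_single,
      Matrix.single_mul_single_same, Matrix.single_mul_single_same, mul_one, mul_one]
  have h1 : ∑ i : Fin N, V.rep p (Matrix.single i i 1) = 1 := by
    rw [← map_one (V.rep p), ← Matrix.sum_single_one]
    exact (map_sum (V.rep p).toLinearMap _ _).symm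
  rw [Finset.sum_congr rfl fun i _ => h i, ← LinearMap.sum_apply, h1]
  rfl

lemma toTwisted_fromTwisted (p : TrivBundle 𝒜) (t : V.Twisted p) :
    V.toTwisted p (V.fromTwisted p t) = t := by
  obtain ⟨l, w, rfl⟩ := V.exists_eq_tens p t
  rw [toTwisted_apply]
  refine (Finset.sum_congr rfl fun i _ => ?_).trans (V.sum_tens p l w)
  congr 1
  rw [fromTwisted_tens, rep_mul_apply, single_mul_col, map_smul, LinearMap.smul_apply, rep_incl,
    map_smul, proj_incl]

/-- The isomorphism of a representing bundle with the tensor product, on a fibre. -/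
def twistEquiv (p : TrivBundle 𝒜) : V.Fiber p ≃ₗ[ℂ] V.Twisted p :=
  LinearEquiv.ofLinearMap (V.toTwisted p) (V.fromTwisted p)
    (LinearMap.ext (V.toTwisted_fromTwisted p)) (LinearMap.ext (V.fromTwisted_toTwisted p))

/-- On `l ⊗ w` the left side is the matrix `col (g w) E₀₀ g* = g (col w) g*` applied to the image of
`l` under `g`. By `act_rep` this is the image under `g` of `(col w) l`. -/
lemma fromTwisted_act (g : SU N) (p : TrivBundle 𝒜) (t : V.Twisted p) :
    V.fromTwisted (g • p) ((twist V.equivariantLine (standard 𝒜)).act g p t) =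
      V.act g p (V.fromTwisted p t) := by
  obtain ⟨l, w, rfl⟩ := V.exists_eq_tens p t
  rw [fromTwisted_tens]
  change V.fromTwisted (g • p) (V.tens (g • p) (V.lineAct g p l) (g.1 *ᵥ w)) = _
  rw [fromTwisted_tens, incl_lineAct, act_rep, rep_mul_apply, ← mul_assoc, col_mul_single, mul_col]

lemma fromTwisted_homIso (p : TrivBundle 𝒜) (a : 𝒜.Fiber p.base) (t : V.Twisted p) :
    V.fromTwisted p ((twist V.equivariantLine (standard 𝒜)).homIso p a t) =
      V.homIso p a (V.fromTwisted p t) := by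
  obtain ⟨l, w, rfl⟩ := V.exists_eq_tens p t
  rw [fromTwisted_tens]
  change V.fromTwisted p (V.tens p l (p.iso a *ᵥ w)) = _
  rw [fromTwisted_tens, ← rep_iso, rep_mul_apply, mul_col]

lemma tensorTriv_tens (p₀ p : TrivBundle 𝒜) (h : p ∈ tensorDom V.lineBundle (trivialBundle 𝒜) p₀)
    (l : V.LineFiber p) (w : Fin N → ℂ) :
    tensorTriv V.lineBundle (trivialBundle 𝒜) p₀ p h (V.tens p l w) =
      V.coord p₀ ⟨p, V.incl p l⟩ • w := by
  have h1 := TensorFiber.toModel_tmul (L := V.lineBundle) (V := trivialBundle 𝒜)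
    (triv p₀ p h.1) (triv p₀ p h.2) l w
  refine h1.trans ?_
  have h2 : triv (V := V.lineBundle) p₀ p h.1 l = V.coord p₀ ⟨p, V.incl p l⟩ :=
    V.trivializationAt_line_apply p₀ p h.1 l
  rw [h2]; rfl

lemma contMDiff_twistEquiv : ContMDiff (𝓘(ℝ, E × slice N).prod 𝓘(ℝ, Fin N → ℂ))
    (𝓘(ℝ, E × slice N).prod 𝓘(ℝ, Fin N → ℂ)) ∞
    (fun x : TotalSpace (Fin N → ℂ) V.Fiber =>
      (⟨x.proj, V.twistEquiv x.proj x.2⟩ : TotalSpace (Fin N → ℂ)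
        (TensorFiber V.lineBundle (trivialBundle 𝒜)))) := by
  intro x₀
  set p₀ := x₀.proj with hp₀
  have hid : ContMDiffAt (𝓘(ℝ, E × slice N).prod 𝓘(ℝ, Fin N → ℂ))
    (𝓘(ℝ, E × slice N).prod 𝓘(ℝ, Fin N → ℂ)) ∞ (fun x : TotalSpace (Fin N → ℂ) V.Fiber => x) x₀ :=
    contMDiffAt_id
  have hb := (Bundle.contMDiffAt_totalSpace.1 hid).1
  refine Bundle.contMDiffAt_totalSpace.2 ⟨hb, ?_⟩
  have hs : ContDiff ℝ ∞ (fun p : ℂ × (Fin N → ℂ) => p.1 • p.2) := contDiff_fst.smul contDiff_snd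
  -- In the trivialization of the tensor product, the `i`-th coordinate of the image of `v` is the
  -- line coordinate of `E_0i v`.
  have h1 : ContMDiffAt (𝓘(ℝ, E × slice N).prod 𝓘(ℝ, Fin N → ℂ)) 𝓘(ℝ, Fin N → ℂ) ∞
      (fun x : TotalSpace (Fin N → ℂ) V.Fiber => ∑ i : Fin N, V.coord p₀
        ⟨x.proj, V.rep x.proj (Matrix.single 0 i 1) x.2⟩ • (Pi.single i 1 : Fin N → ℂ)) x₀ := by
    refine contMDiffAt_finsetSum fun i _ => ?_
    refine hs.contMDiff.contMDiffAt.comp x₀ (ContMDiffAt.prodMk_space ?_ contMDiffAt_const)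
    exact V.contMDiffWithinAt_coord' (s := Set.univ)
      (mem_baseSet_trivializationAt _ _ p₀) (V.contMDiffWithinAt_rep contMDiffWithinAt_const hid)
  refine h1.congr_of_eventuallyEq ?_
  filter_upwards [hb.continuousAt.eventually_mem
    ((isOpen_tensorDom V.lineBundle (trivialBundle 𝒜) p₀).mem_nhds (mem_tensorDom _ _ p₀))] with x hx
  change (trivializationAt (Fin N → ℂ) (TensorFiber V.lineBundle (trivialBundle 𝒜)) p₀
    ⟨x.proj, V.toTwisted x.proj x.2⟩).2 = _
  rw [trivializationAt_tensor_apply _ _ _ _ hx, toTwisted_apply, map_sum]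
  refine Finset.sum_congr rfl fun i _ => ?_
  rw [tensorTriv_tens, incl_proj, rep_mul_apply, Matrix.single_mul_single_same, mul_one]

lemma contMDiff_twistEquiv_symm : ContMDiff (𝓘(ℝ, E × slice N).prod 𝓘(ℝ, Fin N → ℂ))
    (𝓘(ℝ, E × slice N).prod 𝓘(ℝ, Fin N → ℂ)) ∞
    (fun x : TotalSpace (Fin N → ℂ) (TensorFiber V.lineBundle (trivialBundle 𝒜)) =>
      (⟨x.proj, (V.twistEquiv x.proj).symm x.2⟩ : TotalSpace (Fin N → ℂ) V.Fiber)) := by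
  intro x₀
  set p₀ := x₀.proj with hp₀
  have hid : ContMDiffAt (𝓘(ℝ, E × slice N).prod 𝓘(ℝ, Fin N → ℂ))
    (𝓘(ℝ, E × slice N).prod 𝓘(ℝ, Fin N → ℂ)) ∞
    (fun x : TotalSpace (Fin N → ℂ) (TensorFiber V.lineBundle (trivialBundle 𝒜)) => x) x₀ :=
    contMDiffAt_id
  obtain ⟨hb, hv⟩ := Bundle.contMDiffAt_totalSpace.1 hid
  have hcol : ContDiff ℝ ∞ (fun w : Fin N → ℂ => col w) :=
    (LinearMap.toContinuousLinearMap ((col (N := N)).restrictScalars ℝ)).contDiff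
  have hA := hcol.contMDiff.contMDiffAt.comp x₀ hv
  have hl : ContMDiffAt (𝓘(ℝ, E × slice N).prod 𝓘(ℝ, Fin N → ℂ))
      (𝓘(ℝ, E × slice N).prod 𝓘(ℝ, ℂ)) ∞
      (fun x : TotalSpace (Fin N → ℂ) (TensorFiber V.lineBundle (trivialBundle 𝒜)) =>
        (⟨x.proj, (trivializationAt ℂ V.LineFiber p₀).symm x.proj 1⟩ :
          TotalSpace ℂ V.LineFiber)) x₀ :=
    V.lineBundle.contMDiffWithinAt_symm (s := Set.univ) p₀ (mem_baseSet_trivializationAt _ _ p₀) hb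
      contMDiffWithinAt_const
  have h1 := V.contMDiffWithinAt_rep (s := Set.univ) hA (V.contMDiffWithinAt_incl hl)
  refine ContMDiffAt.congr_of_eventuallyEq h1 ?_
  filter_upwards [hb.continuousAt.eventually_mem
    ((isOpen_tensorDom V.lineBundle (trivialBundle 𝒜) p₀).mem_nhds (mem_tensorDom _ _ p₀))] with x hx
  refine congrArg (TotalSpace.mk x.proj) ?_
  change V.fromTwisted x.proj x.2 = _
  -- Near `p₀` every tensor is the local frame of the line tensored with its own coordinate vector,
  -- and both factors are smooth.
  have h2 : x.2 = V.tens x.proj ((trivializationAt ℂ V.LineFiber p₀).symm x.proj 1)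
      (trivializationAt (Fin N → ℂ) (TensorFiber V.lineBundle (trivialBundle 𝒜)) p₀ x).2 := by
    have h3 := TensorFiber.eq_tmul (L := V.lineBundle) (V := trivialBundle 𝒜)
      (triv p₀ x.proj hx.1) (triv p₀ x.proj hx.2) x.2
    have h4 := trivializationAt_tensor_apply V.lineBundle (trivialBundle 𝒜) p₀ x.proj hx x.2
    refine h3.trans ?_
    change _ = V.tens x.proj _ ((trivializationAt (Fin N → ℂ) (TensorFiber V.lineBundle
      (trivialBundle 𝒜)) p₀ ⟨x.proj, x.2⟩).2)
    rw [h4]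
    have h5 : ∀ w : Fin N → ℂ, (triv (V := trivialBundle 𝒜) p₀ x.proj hx.2).symm w = w := fun w =>
      (LinearEquiv.symm_apply_eq _).2 rfl
    exact congrArg (V.tens x.proj _) (h5 _)
  conv_lhs => rw [h2]
  rw [fromTwisted_tens]
  rfl

lemma toTwisted_act (g : SU N) (p : TrivBundle 𝒜) (v : V.Fiber p) :
    V.toTwisted (g • p) (V.act g p v) =
      (twist V.equivariantLine (standard 𝒜)).act g p (V.toTwisted p v) := by
  have h := V.fromTwisted_act g p (V.toTwisted p v)
  rw [fromTwisted_toTwisted] at h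
  exact (congrArg _ h.symm).trans (V.toTwisted_fromTwisted _ _)

lemma toTwisted_homIso (p : TrivBundle 𝒜) (a : 𝒜.Fiber p.base) (v : V.Fiber p) :
    V.toTwisted p (V.homIso p a v) =
      (twist V.equivariantLine (standard 𝒜)).homIso p a (V.toTwisted p v) := by
  have h := V.fromTwisted_homIso p a (V.toTwisted p v)
  rw [fromTwisted_toTwisted] at h
  exact (congrArg _ h.symm).trans (V.toTwisted_fromTwisted _ _)

/-- Every representing bundle is equivalent to the twist of the standard one by its line bundle. -/
def twistEquivalence : V.Equivalence (twist V.equivariantLine (standard 𝒜)) where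
  fiberEquiv := V.twistEquiv
  contMDiff_fiberEquiv := V.contMDiff_twistEquiv
  contMDiff_fiberEquiv_symm := V.contMDiff_twistEquiv_symm
  fiberEquiv_act := V.toTwisted_act
  fiberEquiv_homIso := V.toTwisted_homIso

end Equivalence

end RepresentingBundle

end

/-! ### Special unitary matrices: normalization, centre, compactness -/

section

variable {N : ℕ} [NeZero N]

/-- Taking determinants gives `t ^ N = 1`, so `t = 1` since `t` is nonnegative. -/
lemma mem_specialUnitary_of_det_eq_one {S : Mat N} {t : ℝ} (ht : 0 ≤ t)
    (h : star S * S = (t : ℂ) • (1 : Mat N)) (hS : S.det = 1) :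
    S ∈ Matrix.specialUnitaryGroup (Fin N) ℂ := by
  have ht : t = 1 := by
    have h1 := congrArg Matrix.det h
    rw [Matrix.det_mul, hS, mul_one, Matrix.star_eq_conjTranspose, Matrix.det_conjTranspose, hS,
      star_one, Matrix.det_smul, Matrix.det_one, mul_one, Fintype.card_fin] at h1
    have h2 : t ^ N = 1 := by exact_mod_cast h1.symm
    exact (pow_eq_one_iff_of_nonneg ht (NeZero.ne N)).1 h2
  rw [ht, Complex.ofReal_one, one_smul] at h
  exact Matrix.mem_specialUnitaryGroup_iff.2 ⟨Unitary.mem_iff.2 ⟨h, mul_eq_one_comm.1 h⟩, hS⟩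

/-- Rescaling to determinant one. -/
def normalize (U : Mat N) : Mat N := (U.det ^ ((N : ℂ)⁻¹))⁻¹ • U

lemma normalize_one : normalize (1 : Mat N) = 1 := by
  rw [normalize, Matrix.det_one, Complex.one_cpow, inv_one, one_smul]

/-- Any branch of the `N`-th root serves here; the choice of branch only matters for smoothness. -/
lemma normalize_mem {U : Mat N} (h : U ∈ unitary (Mat N)) :
    normalize U ∈ Matrix.specialUnitaryGroup (Fin N) ℂ := by
  have h1 : star U * U = 1 := (Unitary.mem_iff.1 h).1
  have hd : U.det ≠ 0 := by
    intro h0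
    have := congrArg Matrix.det h1
    rw [Matrix.det_mul, h0, mul_zero, Matrix.det_one] at this
    exact zero_ne_one this
  refine mem_specialUnitary_of_det_eq_one (Complex.normSq_nonneg ((U.det ^ ((N : ℂ)⁻¹))⁻¹)) ?_ ?_
  · rw [normalize, star_smul, Matrix.smul_mul, Matrix.mul_smul, h1, smul_smul, ← Complex.mul_conj,
      RCLike.star_def, mul_comm]
  · rw [normalize, Matrix.det_smul, Fintype.card_fin, inv_pow,
      Complex.cpow_nat_inv_pow _ (NeZero.ne N), inv_mul_cancel₀ hd]

/-- Both matrices are unitary, so the scalar factor has modulus one and cancels in the conjugation.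
-/
lemma normalize_conj {U : Mat N} (h : U ∈ unitary (Mat N)) (A : Mat N) :
    normalize U * A * star (normalize U) = U * A * star U := by
  have h1 := (Unitary.mem_iff.1 (Matrix.mem_specialUnitaryGroup_iff.1 (normalize_mem h)).1).2
  have h2 : U * star U = 1 := (Unitary.mem_iff.1 h).2
  simp only [normalize, star_smul, Matrix.smul_mul, Matrix.mul_smul, smul_smul] at h1 ⊢
  rw [h2] at h1
  have h3 := congrFun (congrFun h1 0) 0
  rw [Matrix.smul_apply, Matrix.one_apply_eq, smul_eq_mul, mul_one] at h3
  rw [h3, one_smul]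

lemma contDiff_det : ContDiff ℝ ∞ (fun U : Mat N => U.det) := by
  simp only [Matrix.det_apply]
  refine ContDiff.sum fun σ _ => ?_
  exact (contDiff_prod fun i _ => contDiff_entry (σ i) i).const_smul _

/-- The principal branch of the root is analytic on the slit plane, which is why the determinant is
restricted to it in `liftDom`. -/
lemma contDiffAt_normalize {U : Mat N} (h : U.det ∈ Complex.slitPlane) :
    ContDiffAt ℝ ∞ (normalize (N := N)) U := by
  have h1 : ContDiffAt ℝ ∞ (fun z : ℂ => (z ^ ((N : ℂ)⁻¹))⁻¹) U.det := by
    have h2 : AnalyticAt ℂ (fun z : ℂ => z ^ ((N : ℂ)⁻¹)) U.det :=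
      analyticAt_id.cpow analyticAt_const h
    have h3 : U.det ^ ((N : ℂ)⁻¹) ≠ 0 := by
      rw [Ne, Complex.cpow_eq_zero_iff]
      exact fun h4 => Complex.slitPlane_ne_zero h h4.1
    exact (h2.inv h3).contDiffAt.restrict_scalars ℝ
  have h4 : ContDiffAt ℝ ∞ (fun U : Mat N => (U.det ^ ((N : ℂ)⁻¹))⁻¹) U :=
    ContDiffAt.comp U (g := fun z : ℂ => (z ^ ((N : ℂ)⁻¹))⁻¹) h1 contDiff_det.contDiffAt
  exact h4.smul contDiffAt_id

lemma gram_refl : gram (StarAlgEquiv.refl ℂ (Mat N) : Mat N ≃⋆ₐ[ℂ] Mat N) = 1 := by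
  ext a b
  change (Matrix.single b 0 1 : Mat N) a 0 = _
  simp [Matrix.single_apply, Matrix.one_apply, eq_comm]

lemma rescale_one : rescale (1 : Mat N) = 1 := by simp [rescale]

/-- A special unitary matrix which commutes with all matrices is determined by its upper left
entry, a root of unity. -/
lemma eq_one_of_commute {g : SU N} (h : ∀ A : Mat N, g.1 * A = A * g.1) :
    (g.1 0 0) ^ N = 1 ∧ (g.1 0 0 = 1 → g = 1) := by
  obtain ⟨c, hc⟩ := Matrix.mem_range_scalar_of_commute_single (M := g.1)
    (fun i j _ => (h (Matrix.single i j 1)).symm)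
  have h00 : g.1 0 0 = c := by rw [← hc]; simp
  have hdet := (Matrix.mem_specialUnitaryGroup_iff.1 g.2).2
  refine ⟨?_, fun h1 => Subtype.ext ?_⟩
  · rw [h00]
    rw [← hc] at hdet
    simpa using hdet
  · rw [← hc, ← h00, h1, map_one]; rfl

section Topology

/-- The group is closed, being given by equations, and the entries of a unitary matrix are bounded
by one. -/
lemma isCompact_specialUnitary : IsCompact (Matrix.specialUnitaryGroup (Fin N) ℂ : Set (Mat N)) := by
  have h1 : IsCompact ((Metric.closedBall (0 : ℂ) 1).matrix : Set (Mat N)) :=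
    (isCompact_closedBall (0 : ℂ) 1).matrix
  have hst : Continuous (fun X : Mat N => star X * X) :=
    (TrivBundle.contDiff_star.mul contDiff_id).continuous
  have hst' : Continuous (fun X : Mat N => X * star X) :=
    (contDiff_id.mul TrivBundle.contDiff_star).continuous
  have h2 : IsClosed (Matrix.specialUnitaryGroup (Fin N) ℂ : Set (Mat N)) := by
    have e : (Matrix.specialUnitaryGroup (Fin N) ℂ : Set (Mat N)) =
        {X | star X * X = 1} ∩ {X | X * star X = 1} ∩ {X | X.det = 1} := by
      ext X
      exact Matrix.mem_specialUnitaryGroup_iff.trans (and_congr_left fun _ => Unitary.mem_iff)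
    rw [e]
    exact ((isClosed_eq hst continuous_const).inter (isClosed_eq hst' continuous_const)).inter
      (isClosed_eq contDiff_det.continuous continuous_const)
  refine h1.of_isClosed_subset h2 fun X hX i j => ?_
  rw [mem_closedBall_zero_iff]
  exact entry_norm_bound_of_unitary (Matrix.mem_specialUnitaryGroup_iff.1 hX).1 i j

instance : CompactSpace (SU N) := isCompact_iff_compactSpace.1 isCompact_specialUnitary

end Topology

end

/-! ### Topology of the bundle of trivializations and local lifts to `SU(N)` -/

section

variable {N : ℕ} [NeZero N] {E : Type*} [NormedAddCommGroup E] [NormedSpace ℝ E]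
  {Z : Type*} [TopologicalSpace Z] [ChartedSpace E Z] {𝒜 : AzumayaBundle N E Z}
  [IsManifold 𝓘(ℝ, E) ∞ Z]

namespace TrivBundle

/-- The value of the local section through `p₀`, as a point of the bundle of trivializations. -/
def secPt (p₀ : TrivBundle 𝒜) (z : Z) : TrivBundle 𝒜 := ⟨z, p₀.sec z⟩

lemma secPt_self (p₀ : TrivBundle 𝒜) : p₀.secPt p₀.base = p₀ := by
  rw [secPt, sec_self]

lemma contMDiffAt_secPt (p₀ : TrivBundle 𝒜) {z : Z} (hz : z ∈ 𝒜.dom p₀.base) :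
    ContMDiffAt 𝓘(ℝ, E) 𝓘(ℝ, E × slice N) ∞ p₀.secPt z := by
  refine contMDiffWithinAt_of (s := Set.univ) (p₀ := p₀.secPt z) (mem_chart_source _)
    contMDiffWithinAt_id fun A => ?_
  exact ((contMDiffOn_sec (p₀.secPt z) p₀ A).contMDiffAt
    (((𝒜.isOpen_dom _).inter (𝒜.isOpen_dom _)).mem_nhds ⟨𝒜.mem_dom z, hz⟩))

lemma eq_smul_secPt {p₀ p : TrivBundle 𝒜} {g : SU N}
    (h : ∀ A, p₀.comp p A = g.1 * A * star g.1) : p = g • p₀.secPt p.base := by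
  cases p with | mk z φ =>
  change (⟨z, _⟩ : TrivBundle 𝒜) = ⟨z, _⟩
  congr 1
  ext1 a
  have := h (p₀.sec z a)
  rw [comp_apply] at this
  erw [StarAlgEquiv.symm_apply_apply] at this
  exact this

lemma exists_eq_smul_secPt (p₀ p : TrivBundle 𝒜) : ∃ g : SU N, p = g • p₀.secPt p.base := by
  obtain ⟨g, hg⟩ := exists_conj_of_starAlgEquiv (p₀.comp p)
  exact ⟨g, eq_smul_secPt hg⟩

/-- Smoothness is stated within a subset of all matrices; here it becomes continuity on the subtype
`SU N`. -/
lemma continuousWithinAt_matAct (g : SU N) (p : TrivBundle 𝒜) :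
    ContinuousAt (fun x : SU N × TrivBundle 𝒜 => x.1 • x.2) (g, p) := by
  have h1 := (contMDiffWithinAt_matAct g.2 p).continuousWithinAt
  have h2 : ContinuousAt (fun x : SU N × TrivBundle 𝒜 => ((x.1 : Mat N), x.2)) (g, p) :=
    (continuous_subtype_val.prodMap continuous_id).continuousAt
  have h3 : Filter.Tendsto (fun x : SU N × TrivBundle 𝒜 => ((x.1 : Mat N), x.2)) (𝓝 (g, p))
      (𝓝[{x | x.1 ∈ Matrix.specialUnitaryGroup (Fin N) ℂ}] ((g : Mat N), p)) :=
    tendsto_nhdsWithin_iff.2 ⟨h2, Filter.Eventually.of_forall fun x => x.1.2⟩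
  have h4 := h1.tendsto.comp h3
  rw [matAct_of_mem] at h4
  refine h4.congr fun x => ?_
  exact matAct_of_mem x.1 x.2

instance : ContinuousSMul (SU N) (TrivBundle 𝒜) :=
  ⟨continuous_iff_continuousAt.2 fun x => continuousWithinAt_matAct x.1 x.2⟩

/-- Points over different base points are separated by the projection, points `p` and `q` of one
fibre by a function `r ↦ p.comp r A`, continuous at both. -/
instance [T2Space Z] : T2Space (TrivBundle 𝒜) := by
  rw [t2Space_iff_disjoint_nhds]
  intro p q hpq
  by_cases hb : p.base = q.base
  · obtain ⟨A, hA⟩ : ∃ A, p.comp p A ≠ p.comp q A := by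
      by_contra! h
      apply hpq
      have h1 : ∀ A, p.comp q A = (1 : SU N).1 * A * star (1 : SU N).1 := by
        intro A
        rw [← h A, comp_self]
        change A = (1 : Mat N) * A * star (1 : Mat N)
        simp
      rw [eq_smul_secPt h1, one_smul, ← hb, secPt_self]
    have h1 := (p.contMDiffAt_comp A (𝒜.mem_dom p.base)).continuousAt
    have h2 := (p.contMDiffAt_comp A (p := q) (hb ▸ 𝒜.mem_dom p.base)).continuousAt
    exact h1.tendsto.disjoint (disjoint_nhds_nhds.2 hA) h2.tendsto
  · exact (contMDiff_base.continuous.continuousAt (x := p)).tendsto.disjoint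
      (disjoint_nhds_nhds.2 hb) (contMDiff_base.continuous.continuousAt (x := q)).tendsto

/-- A point over a given point of the base. -/
def basepoint (𝒜 : AzumayaBundle N E Z) (z : Z) : TrivBundle 𝒜 := ⟨z, 𝒜.frame z z⟩

/-- Over a compact neighbourhood `K` in the domain of a local section, the bundle is the image of
the compact set `SU(N) × K` under the action on this section. Finitely many such neighbourhoods
cover `Z`. -/
instance [T2Space Z] [CompactSpace Z] : CompactSpace (TrivBundle 𝒜) := by
  choose K hK hKs hKc using fun z => local_compact_nhds ((𝒜.isOpen_dom z).mem_nhds (𝒜.mem_dom z))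
  obtain ⟨t, -, ht⟩ := isCompact_univ.elim_nhds_subcover K fun z _ => hK z
  have hc : ∀ z, IsCompact ((fun x : SU N × Z => x.1 • (basepoint 𝒜 z).secPt x.2) ''
      (Set.univ ×ˢ K z)) := by
    intro z
    refine (isCompact_univ.prod (hKc z)).image_of_continuousOn ?_
    refine continuousOn_fst.smul ?_
    refine ContinuousOn.comp (t := K z) (g := (basepoint 𝒜 z).secPt) (fun y hy => ?_)
      continuousOn_snd fun x hx => hx.2
    exact ((basepoint 𝒜 z).contMDiffAt_secPt (hKs z hy)).continuousAt.continuousWithinAt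
  have h2 := t.isCompact_biUnion fun z _ => hc z
  refine ⟨h2.of_isClosed_subset isClosed_univ fun p _ => ?_⟩
  obtain ⟨z, hz, hpz⟩ := Set.mem_iUnion₂.1 (ht (Set.mem_univ p.base))
  obtain ⟨g, hg⟩ := exists_eq_smul_secPt (basepoint 𝒜 z) p
  exact Set.mem_iUnion₂.2 ⟨z, hz, (g, p.base), ⟨Set.mem_univ _, hpz⟩, hg.symm⟩

/-- The matrix giving the local lift to `SU(N)`. -/
def liftMat (p₀ p : TrivBundle 𝒜) : Mat N := normalize (rescale (gram (p₀.comp p)))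

/-- The domain of the local lift to `SU(N)`. -/
def liftDom (p₀ : TrivBundle 𝒜) : Set (TrivBundle 𝒜) :=
  {p | p.base ∈ 𝒜.dom p₀.base ∧ 0 < (gram (p₀.comp p) 0 0).re ∧
    (rescale (gram (p₀.comp p))).det ∈ Complex.slitPlane}

open Classical in
/-- A special unitary matrix which takes the local section through `p₀` to `p`. -/
def lift (p₀ p : TrivBundle 𝒜) : SU N :=
  if h : p ∈ p₀.liftDom then
    ⟨p₀.liftMat p, normalize_mem (rescale_mem_unitary h.2.1)⟩ else 1

lemma coe_lift {p₀ p : TrivBundle 𝒜} (h : p ∈ p₀.liftDom) : (p₀.lift p).1 = p₀.liftMat p := by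
  rw [lift, dif_pos h]

lemma mem_liftDom (p₀ : TrivBundle 𝒜) : p₀ ∈ p₀.liftDom := by
  refine ⟨𝒜.mem_dom _, ?_, ?_⟩
  · rw [comp_self, gram_refl]; simp
  · rw [comp_self, gram_refl, rescale_one, Matrix.det_one]; exact Complex.one_mem_slitPlane

lemma lift_self (p₀ : TrivBundle 𝒜) : p₀.lift p₀ = 1 := by
  refine Subtype.ext ?_
  rw [coe_lift (mem_liftDom p₀), liftMat, comp_self, gram_refl, rescale_one, normalize_one]
  rfl

lemma comp_eq_lift {p₀ p : TrivBundle 𝒜} (h : p ∈ p₀.liftDom) (A : Mat N) :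
    p₀.comp p A = (p₀.lift p).1 * A * star (p₀.lift p).1 := by
  rw [coe_lift h, liftMat, normalize_conj (rescale_mem_unitary h.2.1), conj_rescale h.2.1]

lemma eq_lift_smul {p₀ p : TrivBundle 𝒜} (h : p ∈ p₀.liftDom) :
    p = p₀.lift p • p₀.secPt p.base := eq_smul_secPt (comp_eq_lift h)

lemma contMDiffAt_rescale_gram {p₀ p : TrivBundle 𝒜} (h : p.base ∈ 𝒜.dom p₀.base)
    (h' : 0 < (gram (p₀.comp p) 0 0).re) :
    ContMDiffAt 𝓘(ℝ, E × slice N) 𝓘(ℝ, Mat N) ∞ (fun p => rescale (gram (p₀.comp p))) p :=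
  ContMDiffAt.comp p (g := rescale) (contDiffAt_rescale h').contMDiffAt
    (contMDiffWithinAt_gram (s := Set.univ) fun A => p₀.contMDiffAt_comp A h)

lemma isOpen_liftDom (p₀ : TrivBundle 𝒜) : IsOpen p₀.liftDom := by
  refine isOpen_iff_mem_nhds.2 fun p hp => ?_
  have hg : ContinuousAt (fun p => gram (p₀.comp p)) p :=
    ContMDiffWithinAt.continuousWithinAt (I := 𝓘(ℝ, E × slice N)) (I' := 𝓘(ℝ, Mat N)) (s := Set.univ)
      (contMDiffWithinAt_gram fun A => p₀.contMDiffAt_comp A hp.1) |>.continuousAt Filter.univ_mem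
  have h1 : ContinuousAt (fun p => (gram (p₀.comp p) 0 0).re) p :=
    (Complex.continuous_re.comp (contDiff_entry 0 0).continuous).continuousAt.comp hg
  have h2 : ContinuousAt (fun p => (rescale (gram (p₀.comp p))).det) p :=
    ContinuousAt.comp (g := fun U : Mat N => U.det) contDiff_det.continuous.continuousAt
      (contMDiffAt_rescale_gram hp.1 hp.2.1).continuousAt
  filter_upwards [contMDiff_base.continuous.continuousAt.eventually_mem
    ((𝒜.isOpen_dom p₀.base).mem_nhds hp.1), h1.eventually_mem (isOpen_Ioi.mem_nhds hp.2.1),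
    h2.eventually_mem (Complex.isOpen_slitPlane.mem_nhds hp.2.2)] with q a b c using ⟨a, b, c⟩

lemma contMDiffAt_lift {p₀ p : TrivBundle 𝒜} (h : p ∈ p₀.liftDom) :
    ContMDiffAt 𝓘(ℝ, E × slice N) 𝓘(ℝ, Mat N) ∞ (fun p => (p₀.lift p).1) p := by
  refine (ContMDiffAt.comp p (g := normalize) (contDiffAt_normalize h.2.2).contMDiffAt
    (contMDiffAt_rescale_gram h.1 h.2.1)).congr_of_eventuallyEq ?_
  filter_upwards [p₀.isOpen_liftDom.mem_nhds h] with q hq using coe_lift hq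

lemma continuousAt_lift {p₀ p : TrivBundle 𝒜} (h : p ∈ p₀.liftDom) : ContinuousAt p₀.lift p :=
  Topology.IsInducing.subtypeVal.continuousAt_iff.2 (contMDiffAt_lift h).continuousAt

lemma continuousAt_smul_right (p : TrivBundle 𝒜) (g : SU N) :
    ContinuousAt (fun g : SU N => g • p) g :=
  ContinuousAt.comp (f := fun g : SU N => (g, p)) (continuousWithinAt_matAct g p)
    (continuousAt_id.prodMk continuousAt_const)

/-- The local lift is equivariant for group elements close to the identity. -/
lemma eventually_lift_smul {p₀ p : TrivBundle 𝒜} (h : p ∈ p₀.liftDom) :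
    ∀ᶠ g : SU N in 𝓝 1, g • p ∈ p₀.liftDom ∧ p₀.lift (g • p) = g * p₀.lift p := by
  have hc := continuousAt_smul_right p 1
  have h1p : (1 : SU N) • p ∈ p₀.liftDom := by rwa [one_smul]
  have ev1 := hc.eventually_mem (p₀.isOpen_liftDom.mem_nhds h1p)
  have hl : ContinuousAt (fun g : SU N => (p₀.lift (g • p)).1) 1 :=
    continuous_subtype_val.continuousAt.comp
      (ContinuousAt.comp (g := p₀.lift) (continuousAt_lift h1p) hc)
  have hst : Continuous (fun X : Mat N => star X) := contDiff_star.continuous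
  -- Both `lift (g • p)` and `g * lift p` lift the same automorphism, so they differ by a scalar `ζ`
  -- with `ζ ^ N = 1`, read off as an upper left entry. It depends continuously on `g` and equals
  -- `1` at `g = 1`. The other roots of unity form a finite, hence closed, set, so `ζ = 1` for `g`
  -- close to `1`.
  have hζ : ContinuousAt (fun g : SU N =>
      (star (p₀.lift (g • p)).1 * (g.1 * (p₀.lift p).1)) 0 0) 1 :=
    (contDiff_entry 0 0).continuous.continuousAt.comp ((hst.continuousAt.comp hl).mul
      (continuous_subtype_val.continuousAt.mul continuousAt_const))
  have hfin : {z : ℂ | z ^ N = 1 ∧ z ≠ 1}.Finite := by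
    refine (Polynomial.nthRootsFinset N (1 : ℂ)).finite_toSet.subset fun z hz => ?_
    exact (Polynomial.mem_nthRootsFinset (Nat.pos_of_ne_zero (NeZero.ne N)) 1).2 hz.1
  have hz0 : (star (p₀.lift ((1 : SU N) • p)).1 * ((1 : SU N).1 * (p₀.lift p).1)) 0 0 = 1 := by
    rw [one_smul]
    change (star (p₀.lift p).1 * ((1 : Mat N) * (p₀.lift p).1)) 0 0 = 1
    rw [one_mul, (Unitary.mem_iff.1 (p₀.lift p).2.1).1, Matrix.one_apply_eq]
  have ev2 := hζ.eventually_mem (hfin.isClosed.isOpen_compl.mem_nhds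
    (show _ ∈ {z : ℂ | z ^ N = 1 ∧ z ≠ 1}ᶜ from fun hz => hz.2 hz0))
  filter_upwards [ev1, ev2] with g hg1 hg2
  refine ⟨hg1, ?_⟩
  set k := p₀.lift p with hk
  set k' := p₀.lift (g • p) with hk'
  -- Conjugation by `k'` and by `g k` both give `p₀.comp (g • p)`, so their quotient is central.
  have hcomm : ∀ A : Mat N, (k'⁻¹ * (g * k)).1 * A = A * (k'⁻¹ * (g * k)).1 := by
    intro A
    have e1 : k'.1 * A * star k'.1 = g.1 * (k.1 * A * star k.1) * star g.1 := by
      rw [← comp_eq_lift hg1, comp_smul, comp_eq_lift h]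
    have u1 : star k'.1 * k'.1 = 1 := (Unitary.mem_iff.1 k'.2.1).1
    have u2 : star k.1 * k.1 = 1 := (Unitary.mem_iff.1 k.2.1).1
    have u3 : star g.1 * g.1 = 1 := (Unitary.mem_iff.1 g.2.1).1
    change star k'.1 * (g.1 * k.1) * A = A * (star k'.1 * (g.1 * k.1))
    calc star k'.1 * (g.1 * k.1) * A
        = star k'.1 * (g.1 * (k.1 * A * (star k.1 * ((star g.1 * g.1) * k.1)))) := by
          rw [u3, one_mul, u2, mul_one]; simp only [mul_assoc]
      _ = star k'.1 * (g.1 * (k.1 * A * star k.1) * star g.1) * (g.1 * k.1) := by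
          simp only [mul_assoc]
      _ = (star k'.1 * k'.1) * A * (star k'.1 * (g.1 * k.1)) := by
          rw [← e1]; simp only [mul_assoc]
      _ = _ := by rw [u1, one_mul]
  obtain ⟨r1, r2⟩ := eq_one_of_commute hcomm
  have h3 : (k'⁻¹ * (g * k)).1 0 0 = 1 := by
    by_contra hne
    exact hg2 ⟨r1, hne⟩
  have h4 := r2 h3
  rwa [inv_mul_eq_one] at h4

/-- Points of a fibre close to `q` are images of `q` under group elements close to the identity. -/
lemma eventually_exists_smul (q : TrivBundle 𝒜) {U : Set (SU N)} (hU : U ∈ 𝓝 1) :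
    ∀ᶠ q' in 𝓝 q, q'.base = q.base → ∃ g ∈ U, q' = g • q := by
  have h := (continuousAt_lift q.mem_liftDom)
  rw [ContinuousAt, lift_self] at h
  filter_upwards [h hU, q.isOpen_liftDom.mem_nhds q.mem_liftDom] with q' h1 h2 hb
  -- The lift centred at `q` is continuous with value `1` at `q`, and the local section through `q`
  -- takes the value `q` over the base point of `q`.
  refine ⟨q.lift q', h1, ?_⟩
  have h3 := eq_lift_smul h2
  rwa [hb, secPt_self] at h3

end TrivBundle

end

/-! ### Invariant local frames of an equivariant bundle -/

section

variable {N : ℕ} [NeZero N] {E : Type*} [NormedAddCommGroup E] [NormedSpace ℝ E]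
  {Z : Type*} [TopologicalSpace Z] [ChartedSpace E Z] {𝒜 : AzumayaBundle N E Z}
  [IsManifold 𝓘(ℝ, E) ∞ Z]

namespace EquivariantBundle

variable {F : Type*} [NormedAddCommGroup F] [NormedSpace ℂ F] [NormedSpace ℝ F]
  [IsScalarTower ℝ ℂ F] (L : EquivariantBundle F 𝒜)

/-- The action on the total space. -/
def smulTotal (g : SU N) (x : TotalSpace F L.Fiber) : TotalSpace F L.Fiber :=
  ⟨g • x.proj, L.act g x.proj x.2⟩

lemma smulTotal_one (x : TotalSpace F L.Fiber) : L.smulTotal 1 x = x := L.act_one x.proj x.2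

lemma smulTotal_mul (g h : SU N) (x : TotalSpace F L.Fiber) :
    L.smulTotal (g * h) x = L.smulTotal g (L.smulTotal h x) := L.act_mul g h x.proj x.2

lemma totalAct_coe (g : SU N) (x : TotalSpace F L.Fiber) : L.totalAct (g.1, x) = L.smulTotal g x :=
  L.totalAct_of_mem (g.1, x) g.2

lemma act_injective (g : SU N) (p : TrivBundle 𝒜) : Function.Injective (L.act g p) := by
  intro v w h
  have h1 : L.smulTotal g ⟨p, v⟩ = L.smulTotal g ⟨p, w⟩ := congrArg (TotalSpace.mk (g • p)) h
  have h2 := congrArg (L.smulTotal g⁻¹) h1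
  rw [← smulTotal_mul, ← smulTotal_mul, inv_mul_cancel, smulTotal_one, smulTotal_one] at h2
  exact TotalSpace.mk_inj.1 h2

lemma contMDiffAt_totalAct_comp {EM : Type*} [NormedAddCommGroup EM] [NormedSpace ℝ EM]
    {HM : Type*} [TopologicalSpace HM] {I : ModelWithCorners ℝ EM HM} {M : Type*}
    [TopologicalSpace M] [ChartedSpace HM M] {g : M → Mat N} {x : M → TotalSpace F L.Fiber} {m : M}
    (hg : ContMDiffAt I 𝓘(ℝ, Mat N) ∞ g m)
    (hx : ContMDiffAt I (𝓘(ℝ, E × slice N).prod 𝓘(ℝ, F)) ∞ x m)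
    (hm : ∀ m, g m ∈ Matrix.specialUnitaryGroup (Fin N) ℂ) :
    ContMDiffAt I (𝓘(ℝ, E × slice N).prod 𝓘(ℝ, F)) ∞ (fun m => L.totalAct (g m, x m)) m := by
  have h := (L.contMDiffOn_totalAct (g m, x m) (hm m)).comp m (hg.prodMk hx)
    (s := Set.univ) fun q _ => hm q
  exact h

variable {L} in
/-- Transport between the fibres over equal points. -/
def transport {p q : TrivBundle 𝒜} (h : p = q) (l : L.Fiber p) : L.Fiber q := h ▸ l

lemma mk_transport {p q : TrivBundle 𝒜} (h : p = q) (l : L.Fiber p) :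
    (⟨q, transport h l⟩ : TotalSpace F L.Fiber) = ⟨p, l⟩ := by
  subst h; rfl

variable {L} in
lemma transport_eq_zero {p q : TrivBundle 𝒜} (h : p = q) {l : L.Fiber p}
    (hl : transport h l = 0) : l = 0 := by
  subst h; exact hl

/-- A smooth section without zeros on an open set, which is invariant under group elements close to
the identity. -/
structure IsFibreFrame (O : Set (TrivBundle 𝒜)) (s : ∀ p, L.Fiber p) : Prop where
  isOpen : IsOpen O
  ne_zero : ∀ p ∈ O, s p ≠ 0
  contMDiffAt : ∀ p ∈ O, ContMDiffAt 𝓘(ℝ, E × slice N) (𝓘(ℝ, E × slice N).prod 𝓘(ℝ, F)) ∞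
    (fun p => (⟨p, s p⟩ : TotalSpace F L.Fiber)) p
  -- Invariance under the whole group cannot be required: the centre fixes `p` but may act on the
  -- fibre there by nontrivial scalars.
  eventually_act : ∀ p ∈ O, ∀ᶠ g : SU N in 𝓝 1, s (g • p) = L.act g p (s p)

section Frame

variable (p₀ : TrivBundle 𝒜) (w : F)

/-- The domain of the invariant local section. -/
def frameDom : Set (TrivBundle 𝒜) :=
  p₀.liftDom ∩ {p | p₀.secPt p.base ∈ (trivializationAt F L.Fiber p₀).baseSet}

/-- The invariant local section with a given value at `p₀` in the trivialization around `p₀`. -/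
def invariantSec (p : TrivBundle 𝒜) : L.Fiber p :=
  transport (smul_inv_smul (p₀.lift p) p) (L.act (p₀.lift p) ((p₀.lift p)⁻¹ • p)
    ((trivializationAt F L.Fiber p₀).symm ((p₀.lift p)⁻¹ • p) w))

/-- In the total space the transport between fibres disappears, so that group laws can be used. -/
lemma mk_invariantSec (p : TrivBundle 𝒜) :
    (⟨p, L.invariantSec p₀ w p⟩ : TotalSpace F L.Fiber) = L.smulTotal (p₀.lift p)
      ⟨(p₀.lift p)⁻¹ • p, (trivializationAt F L.Fiber p₀).symm ((p₀.lift p)⁻¹ • p) w⟩ :=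
  L.mk_transport _ _

variable {p₀} in
lemma inv_lift_smul {p : TrivBundle 𝒜} (h : p ∈ p₀.liftDom) :
    (p₀.lift p)⁻¹ • p = p₀.secPt p.base := by
  rw [inv_smul_eq_iff]; exact TrivBundle.eq_lift_smul h

/-- On the domain of the lift, `(lift p)⁻¹ • p` is the point of the local section over the base
point of `p`. So the section is the smooth lift acting on a vector with constant coordinates over
that local section. -/
lemma contMDiffAt_invariantSec {p : TrivBundle 𝒜} (h : p ∈ L.frameDom p₀) :
    ContMDiffAt 𝓘(ℝ, E × slice N) (𝓘(ℝ, E × slice N).prod 𝓘(ℝ, F)) ∞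
      (fun p => (⟨p, L.invariantSec p₀ w p⟩ : TotalSpace F L.Fiber)) p := by
  have h1 : ContMDiffAt 𝓘(ℝ, E × slice N) 𝓘(ℝ, E × slice N) ∞
      (fun p : TrivBundle 𝒜 => p₀.secPt p.base) p :=
    ContMDiffAt.comp p (p₀.contMDiffAt_secPt h.1.1) TrivBundle.contMDiff_base.contMDiffAt
  have h2 := L.toComplexVectorBundle.contMDiffWithinAt_symm (s := Set.univ)
    (f := fun p : TrivBundle 𝒜 => p₀.secPt p.base) (x₀ := p) p₀ h.2 h1
    (contMDiffWithinAt_const (c := w))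
  have h3 := TrivBundle.contMDiffAt_lift h.1
  have h4 := L.contMDiffAt_totalAct_comp h3 h2 fun q => (p₀.lift q).2
  refine ContMDiffAt.congr_of_eventuallyEq h4 ?_
  filter_upwards [p₀.isOpen_liftDom.mem_nhds h.1] with q hq
  rw [mk_invariantSec, inv_lift_smul hq, totalAct_coe]

lemma isOpen_frameDom : IsOpen (L.frameDom p₀) := by
  refine isOpen_iff_mem_nhds.2 fun p hp => ?_
  have h1 : ContinuousAt (fun p : TrivBundle 𝒜 => p₀.secPt p.base) p :=
    ContinuousAt.comp (g := p₀.secPt) (p₀.contMDiffAt_secPt hp.1.1).continuousAt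
      TrivBundle.contMDiff_base.continuous.continuousAt
  filter_upwards [p₀.isOpen_liftDom.mem_nhds hp.1, h1.eventually_mem
    ((trivializationAt F L.Fiber p₀).open_baseSet.mem_nhds hp.2)] with q a b using ⟨a, b⟩

lemma mem_frameDom : p₀ ∈ L.frameDom p₀ := by
  refine ⟨p₀.mem_liftDom, ?_⟩
  change p₀.secPt p₀.base ∈ (trivializationAt F L.Fiber p₀).baseSet
  rw [TrivBundle.secPt_self]
  exact mem_baseSet_trivializationAt _ _ _

/-- For `g` close to `1` the lift satisfies `lift (g • p) = g * lift p`, and `g • p` lies over the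
same base point as `p`. So both sides of the invariance are translates of the same vector over the
local section. -/
lemma isFibreFrame_invariantSec {w : F} (hw : w ≠ 0) :
    L.IsFibreFrame (L.frameDom p₀) (L.invariantSec p₀ w) where
  isOpen := L.isOpen_frameDom p₀
  ne_zero p hp h := by
    have h1 := transport_eq_zero _ h
    rw [← map_zero (L.act (p₀.lift p) ((p₀.lift p)⁻¹ • p))] at h1
    have h2 := L.act_injective _ _ h1
    have hm : (p₀.lift p)⁻¹ • p ∈ (trivializationAt F L.Fiber p₀).baseSet := by
      rw [inv_lift_smul hp.1]; exact hp.2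
    have h3 := LinearEquiv.map_eq_zero_iff
      (ComplexVectorBundle.triv (V := L.toComplexVectorBundle) p₀ _ hm).symm (x := w)
    exact hw (h3.1 h2)
  contMDiffAt p hp := L.contMDiffAt_invariantSec p₀ w hp
  eventually_act p hp := by
    filter_upwards [TrivBundle.eventually_lift_smul hp.1] with g hg
    apply TotalSpace.mk_injective (F := F) (g • p)
    change _ = L.smulTotal g ⟨p, L.invariantSec p₀ w p⟩
    have h1 : (g * p₀.lift p)⁻¹ • g • p = (p₀.lift p)⁻¹ • p := by
      rw [smul_smul]; congr 1; group
    refine (L.mk_invariantSec p₀ w (g • p)).trans ?_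
    rw [mk_invariantSec, hg.2, h1, smulTotal_mul]

end Frame

end EquivariantBundle

end

/-! ### Ratios of sections of a line bundle, and the connection defined by a frame -/

section

namespace ComplexVectorBundle

variable {B : Type*} [NormedAddCommGroup B] [NormedSpace ℝ B] {M : Type*} [TopologicalSpace M]
  [ChartedSpace B M] (L : ComplexVectorBundle ℂ B M)

variable {L} in
/-- The ratio of two elements of a fibre of a line bundle. -/
def ratio {p : M} (l s : L.Fiber p) : ℂ :=
  triv p p (mem_baseSet_trivializationAt ℂ L.Fiber p) l /
    triv p p (mem_baseSet_trivializationAt ℂ L.Fiber p) s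

variable {L} in
lemma ratio_smul {p : M} (l : L.Fiber p) {s : L.Fiber p} (hs : s ≠ 0) : ratio l s • s = l := by
  apply (triv p p (mem_baseSet_trivializationAt ℂ L.Fiber p)).injective
  rw [map_smul, smul_eq_mul, ratio, div_mul_cancel₀]
  simpa using hs

variable {L} in
lemma ratio_eq {p : M} {l s : L.Fiber p} (hs : s ≠ 0) {c : ℂ} (h : l = c • s) : ratio l s = c := by
  have h1 := (ratio_smul l hs).trans h
  exact smul_left_injective ℂ hs h1

variable {L} in
lemma ratio_self {p : M} {s : L.Fiber p} (hs : s ≠ 0) : ratio s s = 1 :=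
  ratio_eq hs (one_smul _ _).symm

variable {L} in
lemma add_ratio {p : M} (l l' s : L.Fiber p) : ratio (l + l') s = ratio l s + ratio l' s := by
  simp only [ratio, map_add, add_div]

variable {L} in
lemma smul_ratio {p : M} (c : ℂ) (l s : L.Fiber p) : ratio (c • l) s = c * ratio l s := by
  simp only [ratio, map_smul, smul_eq_mul, mul_div_assoc]

variable {L} in
lemma real_smul_ratio {p : M} (c : ℝ) (l s : L.Fiber p) : ratio (c • l) s = c • ratio l s := by
  rw [← Complex.coe_smul, smul_ratio, Complex.real_smul]

variable {L} in
-- The definition of `ratio` uses a different trivialization at every point. The quotient does not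
-- depend on it, so near a point a fixed trivialization can be used, in which smoothness is visible.
lemma ratio_eq_triv {p₀ p : M} (h : p ∈ (trivializationAt ℂ L.Fiber p₀).baseSet)
    (l : L.Fiber p) {s : L.Fiber p} (hs : s ≠ 0) :
    ratio l s = triv p₀ p h l / triv p₀ p h s := by
  have h1 := congrArg (triv p₀ p h) (ratio_smul l hs)
  rw [map_smul, smul_eq_mul] at h1
  rw [← h1, mul_div_cancel_right₀]
  simpa using hs

variable [IsManifold 𝓘(ℝ, B) ∞ M] {L} {σ s : ∀ p, L.Fiber p} {p : M}

lemma ratio_eventuallyEq (hs : ContinuousAt (fun p => (⟨p, s p⟩ : TotalSpace ℂ L.Fiber)) p)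
    (h0 : s p ≠ 0) :
    (fun q => ratio (σ q) (s q)) =ᶠ[𝓝 p] fun q =>
      (trivializationAt ℂ L.Fiber p ⟨q, σ q⟩).2 / (trivializationAt ℂ L.Fiber p ⟨q, s q⟩).2 := by
  have hp := mem_baseSet_trivializationAt ℂ L.Fiber p
  have h1 : ContinuousAt (fun q => (trivializationAt ℂ L.Fiber p ⟨q, s q⟩).2) p :=
    continuous_snd.continuousAt.comp
      (((trivializationAt ℂ L.Fiber p).continuousAt
        ((trivializationAt ℂ L.Fiber p).mem_source.2 hp)).comp (f := fun q =>
          (⟨q, s q⟩ : TotalSpace ℂ L.Fiber)) hs)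
  have h2 : (trivializationAt ℂ L.Fiber p ⟨p, s p⟩).2 ≠ 0 := by
    have := (LinearEquiv.map_eq_zero_iff (triv p p hp)).not.2 h0
    exact this
  filter_upwards [h1.eventually_ne h2, (trivializationAt ℂ L.Fiber p).open_baseSet.mem_nhds hp]
    with q hq hb
  have h3 : s q ≠ 0 := by
    intro h
    refine hq ?_
    have := (LinearEquiv.map_eq_zero_iff (triv p q hb)).2 h
    exact this
  exact ratio_eq_triv hb _ h3

lemma contDiffAt_div_complex {z : ℂ × ℂ} (hz : z.2 ≠ 0) :
    ContDiffAt ℝ ∞ (fun z : ℂ × ℂ => z.1 / z.2) z :=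
  (contDiffAt_fst.mul ((contDiffAt_snd (p := z)).inv hz)).congr_of_eventuallyEq
    (Filter.Eventually.of_forall fun _ => div_eq_mul_inv _ _)

lemma mdifferentiableAt_ratio
    (hσ : MDifferentiableAt 𝓘(ℝ, B) (𝓘(ℝ, B).prod 𝓘(ℝ, ℂ))
      (fun p => (⟨p, σ p⟩ : TotalSpace ℂ L.Fiber)) p)
    (hs : MDifferentiableAt 𝓘(ℝ, B) (𝓘(ℝ, B).prod 𝓘(ℝ, ℂ))
      (fun p => (⟨p, s p⟩ : TotalSpace ℂ L.Fiber)) p) (h0 : s p ≠ 0) :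
    MDifferentiableAt 𝓘(ℝ, B) 𝓘(ℝ, ℂ) (fun q => ratio (σ q) (s q)) p := by
  have hp := mem_baseSet_trivializationAt ℂ L.Fiber p
  have h1 := ((trivializationAt ℂ L.Fiber p).mdifferentiableAt_section_iff 𝓘(ℝ, B) σ hp).1 hσ
  have h2 := ((trivializationAt ℂ L.Fiber p).mdifferentiableAt_section_iff 𝓘(ℝ, B) s hp).1 hs
  have h3 : (trivializationAt ℂ L.Fiber p ⟨p, s p⟩).2 ≠ 0 :=
    (LinearEquiv.map_eq_zero_iff (triv p p hp)).not.2 h0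
  refine MDifferentiableAt.congr_of_eventuallyEq ?_ (ratio_eventuallyEq hs.continuousAt h0)
  have h4 := (contDiffAt_div_complex
    (z := ((trivializationAt ℂ L.Fiber p ⟨p, σ p⟩).2, (trivializationAt ℂ L.Fiber p ⟨p, s p⟩).2))
    h3).differentiableAt (by simp)
  exact h4.mdifferentiableAt.comp p (h1.prodMk_space h2)

lemma contMDiffAt_ratio {n : WithTop ℕ∞} (hn : n ≤ ∞)
    (hσ : ContMDiffAt 𝓘(ℝ, B) (𝓘(ℝ, B).prod 𝓘(ℝ, ℂ)) n
      (fun p => (⟨p, σ p⟩ : TotalSpace ℂ L.Fiber)) p)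
    (hs : ContMDiffAt 𝓘(ℝ, B) (𝓘(ℝ, B).prod 𝓘(ℝ, ℂ)) n
      (fun p => (⟨p, s p⟩ : TotalSpace ℂ L.Fiber)) p) (h0 : s p ≠ 0) :
    ContMDiffAt 𝓘(ℝ, B) 𝓘(ℝ, ℂ) n (fun q => ratio (σ q) (s q)) p := by
  have hp := mem_baseSet_trivializationAt ℂ L.Fiber p
  have h1 := ((contMDiffAt_section (E := L.Fiber) p).1 hσ)
  have h2 := ((contMDiffAt_section (E := L.Fiber) p).1 hs)
  have h3 : (trivializationAt ℂ L.Fiber p ⟨p, s p⟩).2 ≠ 0 :=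
    (LinearEquiv.map_eq_zero_iff (triv p p hp)).not.2 h0
  refine ContMDiffAt.congr_of_eventuallyEq ?_ (ratio_eventuallyEq hs.continuousAt h0)
  have h4 := (contDiffAt_div_complex
    (z := ((trivializationAt ℂ L.Fiber p ⟨p, σ p⟩).2, (trivializationAt ℂ L.Fiber p ⟨p, s p⟩).2))
    h3).of_le hn
  exact h4.contMDiffAt.comp p (h1.prodMk_space h2)

/-- The multiples of an element of a fibre. -/
def spanMap {p : M} (s : L.Fiber p) : ℂ →L[ℝ] L.Fiber p :=
  LinearMap.toContinuousLinearMap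
    { toFun := fun z => z • s
      map_add' := fun _ _ => add_smul _ _ _
      map_smul' := fun c z => by simp [mul_smul] }

/-- The derivative of a section with respect to the connection for which the frame `s` is
parallel. -/
def frameDeriv (s σ : ∀ p, L.Fiber p) (p : M) : TangentSpace 𝓘(ℝ, B) p →L[ℝ] L.Fiber p :=
  (spanMap (s p)).comp (mvfderiv 𝓘(ℝ, B) (fun q => ratio (σ q) (s q)) p)

lemma frameDeriv_apply (s σ : ∀ p, L.Fiber p) (p : M) (X : TangentSpace 𝓘(ℝ, B) p) :
    frameDeriv s σ p X = mvfderiv 𝓘(ℝ, B) (fun q => ratio (σ q) (s q)) p X • s p := rfl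

lemma frameDeriv_add {τ : ∀ p, L.Fiber p}
    (hσ : MDifferentiableAt 𝓘(ℝ, B) (𝓘(ℝ, B).prod 𝓘(ℝ, ℂ))
      (fun p => (⟨p, σ p⟩ : TotalSpace ℂ L.Fiber)) p)
    (hs : MDifferentiableAt 𝓘(ℝ, B) (𝓘(ℝ, B).prod 𝓘(ℝ, ℂ))
      (fun p => (⟨p, s p⟩ : TotalSpace ℂ L.Fiber)) p) (h0 : s p ≠ 0)
    (hτ : MDifferentiableAt 𝓘(ℝ, B) (𝓘(ℝ, B).prod 𝓘(ℝ, ℂ))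
      (fun p => (⟨p, τ p⟩ : TotalSpace ℂ L.Fiber)) p) :
    frameDeriv s (σ + τ) p = frameDeriv s σ p + frameDeriv s τ p := by
  ext X
  have h1 : (fun q => ratio ((σ + τ) q) (s q)) =
      (fun q => ratio (σ q) (s q)) + fun q => ratio (τ q) (s q) :=
    funext fun q => add_ratio _ _ _
  rw [_root_.add_apply, frameDeriv_apply, frameDeriv_apply, frameDeriv_apply, h1,
    mvfderiv_add (mdifferentiableAt_ratio hσ hs h0) (mdifferentiableAt_ratio hτ hs h0),
    _root_.add_apply, add_smul]

/-- The Leibniz rule for `g • ratio σ s`; its extra term `dg • ratio σ s • s` is `dg • σ`. -/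
lemma frameDeriv_smul
    (hσ : MDifferentiableAt 𝓘(ℝ, B) (𝓘(ℝ, B).prod 𝓘(ℝ, ℂ))
      (fun p => (⟨p, σ p⟩ : TotalSpace ℂ L.Fiber)) p)
    (hs : MDifferentiableAt 𝓘(ℝ, B) (𝓘(ℝ, B).prod 𝓘(ℝ, ℂ))
      (fun p => (⟨p, s p⟩ : TotalSpace ℂ L.Fiber)) p) (h0 : s p ≠ 0)
    {g : M → ℝ} (hg : MDifferentiableAt 𝓘(ℝ, B) 𝓘(ℝ, ℝ) g p) :
    frameDeriv s (g • σ) p = g p • frameDeriv s σ p +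
      (mvfderiv 𝓘(ℝ, B) g p).smulRight (σ p) := by
  ext X
  have h1 : (fun q => ratio ((g • σ) q) (s q)) = g • fun q => ratio (σ q) (s q) :=
    funext fun q => real_smul_ratio _ _ _
  rw [_root_.add_apply, _root_.smul_apply, frameDeriv_apply,
    frameDeriv_apply, h1, mvfderiv_smul hg (mdifferentiableAt_ratio hσ hs h0)]
  simp only [_root_.add_apply, _root_.smul_apply,
    ContinuousLinearMap.smulRight_apply, add_smul]
  rw [smul_assoc, smul_assoc, ratio_smul _ h0]

/-- Multiplication by `c` is a real linear map of `ℂ`, so it commutes with the real derivative. -/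
lemma frameDeriv_const_smul
    (hσ : MDifferentiableAt 𝓘(ℝ, B) (𝓘(ℝ, B).prod 𝓘(ℝ, ℂ))
      (fun p => (⟨p, σ p⟩ : TotalSpace ℂ L.Fiber)) p)
    (hs : MDifferentiableAt 𝓘(ℝ, B) (𝓘(ℝ, B).prod 𝓘(ℝ, ℂ))
      (fun p => (⟨p, s p⟩ : TotalSpace ℂ L.Fiber)) p) (h0 : s p ≠ 0)
    (c : ℂ) (X : TangentSpace 𝓘(ℝ, B) p) :
    frameDeriv s (fun q => c • σ q) p X = c • frameDeriv s σ p X := by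
  have h1 : (fun q => ratio (c • σ q) (s q)) =
      ContinuousLinearMap.mul ℝ ℂ c ∘ fun q => ratio (σ q) (s q) :=
    funext fun q => smul_ratio _ _ _
  rw [frameDeriv_apply, frameDeriv_apply, h1, smul_smul]
  congr 1
  have hm : MDifferentiableAt 𝓘(ℝ, ℂ) 𝓘(ℝ, ℂ) (ContinuousLinearMap.mul ℝ ℂ c)
      (ratio (σ p) (s p)) := (ContinuousLinearMap.mul ℝ ℂ c).mdifferentiableAt
  have h2 := mfderiv_comp_apply (I := 𝓘(ℝ, B)) (I' := 𝓘(ℝ, ℂ)) (I'' := 𝓘(ℝ, ℂ))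
    (f := fun q => ratio (σ q) (s q)) p hm (mdifferentiableAt_ratio hσ hs h0) X
  rw [ContinuousLinearMap.mfderiv_eq] at h2
  exact h2

end ComplexVectorBundle

end

/-! ### Gluing the connections of local frames -/

section

namespace ComplexVectorBundle

variable {B : Type*} [NormedAddCommGroup B] [NormedSpace ℝ B] {M : Type*} [TopologicalSpace M]
  [ChartedSpace B M] {L : ComplexVectorBundle ℂ B M} [IsManifold 𝓘(ℝ, B) ∞ M]

lemma contMDiffAt_frameDeriv {σ s : ∀ p, L.Fiber p} {p : M}
    (hσ : ContMDiffAt 𝓘(ℝ, B) (𝓘(ℝ, B).prod 𝓘(ℝ, ℂ)) ∞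
      (fun p => (⟨p, σ p⟩ : TotalSpace ℂ L.Fiber)) p)
    (hs : ContMDiffAt 𝓘(ℝ, B) (𝓘(ℝ, B).prod 𝓘(ℝ, ℂ)) ∞
      (fun p => (⟨p, s p⟩ : TotalSpace ℂ L.Fiber)) p) (h0 : s p ≠ 0) :
    ContMDiffAt 𝓘(ℝ, B) (𝓘(ℝ, B).prod 𝓘(ℝ, B →L[ℝ] ℂ)) ∞
      (fun q => (⟨q, frameDeriv s σ q⟩ : TotalSpace (B →L[ℝ] ℂ)
        (fun q => TangentSpace 𝓘(ℝ, B) q →L[ℝ] L.Fiber q))) p := by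
  have h1 := (contMDiffAt_ratio le_rfl hσ hs h0).mfderiv_const (m := ∞) (by simp)
  rw [contMDiffAt_hom_bundle]
  refine ⟨contMDiffAt_id, ?_⟩
  have hp := mem_baseSet_trivializationAt ℂ L.Fiber p
  have h2 := (contMDiffAt_section (E := L.Fiber) p).1 hs
  have h3 : ContDiff ℝ ∞ (fun x : ℂ × (B →L[ℝ] ℂ) => x.1 • x.2) :=
    (isBoundedBilinearMap_smul (𝕜 := ℝ) (A := ℂ) (E := B →L[ℝ] ℂ)).contDiff
  -- In coordinates around `p` the derivative is the coordinate of the frame times the differential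
  -- of the ratio, both smooth.
  refine (h3.contMDiff.contMDiffAt.comp p (h2.prodMk_space h1)).congr_of_eventuallyEq ?_
  have hp' := mem_baseSet_trivializationAt B (TangentSpace 𝓘(ℝ, B) (M := M)) p
  filter_upwards [(trivializationAt ℂ L.Fiber p).open_baseSet.mem_nhds hp,
    (trivializationAt B (TangentSpace 𝓘(ℝ, B) (M := M)) p).open_baseSet.mem_nhds hp'] with q hq hq'
  rw [ContinuousLinearMap.inCoordinates_eq hq' hq]
  ext X
  have e1 : inTangentCoordinates 𝓘(ℝ, B) 𝓘(ℝ, ℂ) id (fun q => ratio (σ q) (s q))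
      (mfderiv 𝓘(ℝ, B) 𝓘(ℝ, ℂ) fun q => ratio (σ q) (s q)) p q X =
      mvfderiv 𝓘(ℝ, B) (fun q => ratio (σ q) (s q)) q
        ((trivializationAt B (TangentSpace 𝓘(ℝ, B) (M := M)) p).symm q X) := by
    change ((trivializationAt ℂ (TangentSpace 𝓘(ℝ, ℂ)) (ratio (σ p) (s p))).continuousLinearMapAt ℝ
      (ratio (σ q) (s q))) _ = _
    rw [TangentBundle.continuousLinearMapAt_model_space]
    exact congrArg (mvfderiv 𝓘(ℝ, B) (fun q => ratio (σ q) (s q)) q)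
      (Trivialization.symmL_apply (R := ℝ) (trivializationAt B (TangentSpace 𝓘(ℝ, B) (M := M)) p) hq' X)
  have e2 := (triv p q hq).map_smul (mvfderiv 𝓘(ℝ, B) (fun q => ratio (σ q) (s q)) q
        ((trivializationAt B (TangentSpace 𝓘(ℝ, B) (M := M)) p).symm q X)) (s q)
  refine e2.trans ?_
  change _ = (trivializationAt ℂ L.Fiber p ⟨q, s q⟩).2 • inTangentCoordinates 𝓘(ℝ, B) 𝓘(ℝ, ℂ) id
    (fun q => ratio (σ q) (s q)) _ p q X
  rw [e1, smul_eq_mul, smul_eq_mul, mul_comm]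
  rfl

/-- Local frames of a line bundle with a smooth partition of unity subordinate to their domains. -/
structure IsFramePartition {ι : Type*} [Fintype ι] (ρ : ι → M → ℝ) (s : ι → ∀ p, L.Fiber p) :
    Prop where
  contMDiff_weight : ∀ i, ContMDiff 𝓘(ℝ, B) 𝓘(ℝ, ℝ) ∞ (ρ i)
  sum_weight : ∀ p, ∑ i, ρ i p = 1
  ne_zero : ∀ i, ∀ p ∈ tsupport (ρ i), s i p ≠ 0
  contMDiffAt : ∀ i, ∀ p ∈ tsupport (ρ i), ContMDiffAt 𝓘(ℝ, B) (𝓘(ℝ, B).prod 𝓘(ℝ, ℂ)) ∞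
    (fun p => (⟨p, s i p⟩ : TotalSpace ℂ L.Fiber)) p

variable {ι : Type*} [Fintype ι] {ρ : ι → M → ℝ} {s : ι → ∀ p, L.Fiber p}

/-- The weighted mean of the connections for which the given frames are parallel. -/
def gluedDeriv (ρ : ι → M → ℝ) (s : ι → ∀ p, L.Fiber p) (σ : ∀ p, L.Fiber p) (p : M) :
    TangentSpace 𝓘(ℝ, B) p →L[ℝ] L.Fiber p :=
  ∑ i, ρ i p • frameDeriv (s i) σ p

lemma gluedDeriv_apply (ρ : ι → M → ℝ) (s : ι → ∀ p, L.Fiber p) (σ : ∀ p, L.Fiber p) (p : M)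
    (X : TangentSpace 𝓘(ℝ, B) p) :
    gluedDeriv ρ s σ p X = ∑ i, ρ i p • frameDeriv (s i) σ p X := by
  rw [gluedDeriv, _root_.sum_apply]; rfl

lemma IsFramePartition.ne_zero_of_weight (h : IsFramePartition ρ s) {i : ι} {p : M}
    (hp : ρ i p ≠ 0) : s i p ≠ 0 := h.ne_zero i p (subset_tsupport _ hp)

lemma IsFramePartition.mdifferentiableAt_of_weight (h : IsFramePartition ρ s) {i : ι} {p : M}
    (hp : ρ i p ≠ 0) : MDifferentiableAt 𝓘(ℝ, B) (𝓘(ℝ, B).prod 𝓘(ℝ, ℂ))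
      (fun p => (⟨p, s i p⟩ : TotalSpace ℂ L.Fiber)) p :=
  (h.contMDiffAt i p (subset_tsupport _ hp)).mdifferentiableAt (by simp)

/-- The weights sum to one, so the term `dg • σ` of the Leibniz rule occurs exactly once. Where a
weight vanishes its frame may be zero or not differentiable, but the summand is zero there. -/
lemma IsFramePartition.isCovariantDerivativeOn (h : IsFramePartition ρ s) :
    IsCovariantDerivativeOn ℂ (I := 𝓘(ℝ, B)) (gluedDeriv ρ s) Set.univ where
  add {σ τ p} hσ hτ _ := by
    simp only [gluedDeriv]
    rw [← Finset.sum_add_distrib]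
    refine Finset.sum_congr rfl fun i _ => ?_
    by_cases hp : ρ i p = 0
    · rw [hp, zero_smul, zero_smul, zero_smul, add_zero]
    · rw [frameDeriv_add hσ (h.mdifferentiableAt_of_weight hp) (h.ne_zero_of_weight hp) hτ,
        smul_add]
  leibniz {σ g p} hσ hg _ := by
    have h1 : ∀ i, ρ i p • frameDeriv (s i) (g • σ) p = g p • ρ i p • frameDeriv (s i) σ p +
        ρ i p • (mvfderiv 𝓘(ℝ, B) g p).smulRight (σ p) := by
      intro i
      by_cases hp : ρ i p = 0
      · rw [hp, zero_smul, zero_smul, zero_smul, smul_zero, add_zero]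
      · rw [frameDeriv_smul hσ (h.mdifferentiableAt_of_weight hp) (h.ne_zero_of_weight hp) hg,
          smul_add, smul_comm]
    simp only [gluedDeriv]
    rw [Finset.sum_congr rfl fun i _ => h1 i, Finset.sum_add_distrib, ← Finset.smul_sum,
      ← Finset.sum_smul, h.sum_weight, one_smul]

/-- The weighted mean of the connections for which the given frames are parallel. -/
def IsFramePartition.cov (h : IsFramePartition ρ s) : CovariantDerivative 𝓘(ℝ, B) ℂ L.Fiber :=
  ⟨gluedDeriv ρ s, h.isCovariantDerivativeOn⟩

lemma IsFramePartition.contMDiffCovariantDerivative (h : IsFramePartition ρ s) :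
    CovariantDerivative.ContMDiffCovariantDerivative h.cov ∞ := by
  refine ⟨⟨fun {σ} hσ => ?_⟩⟩
  rw [show (∞ + 1 : WithTop ℕ∞) = ∞ from by simp] at hσ
  refine ContMDiffOn.sum_section fun i _ => ?_
  intro p _
  refine ContMDiffAt.contMDiffWithinAt ?_
  -- On the closed support of the weight the frame is smooth and nonzero; off it the summand
  -- vanishes on a whole neighbourhood.
  by_cases hp : p ∈ tsupport (ρ i)
  · exact (h.contMDiff_weight i p).smul_section
      (contMDiffAt_frameDeriv (hσ.contMDiffAt Filter.univ_mem) (h.contMDiffAt i p hp)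
        (h.ne_zero i p hp))
  · have h1 : ContMDiff 𝓘(ℝ, B) (𝓘(ℝ, B).prod 𝓘(ℝ, B →L[ℝ] ℂ)) ∞
        (zeroSection (B →L[ℝ] ℂ) fun q => TangentSpace 𝓘(ℝ, B) q →L[ℝ] L.Fiber q) :=
      contMDiff_zeroSection _ _
    refine (h1 p).congr_of_eventuallyEq ?_
    filter_upwards [(isClosed_tsupport (ρ i)).isOpen_compl.mem_nhds hp] with q hq
    refine congrArg (TotalSpace.mk q) ?_
    change ρ i q • frameDeriv (s i) σ q = 0
    rw [image_eq_zero_of_notMem_tsupport hq, zero_smul]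

lemma IsFramePartition.cov_const_smul (h : IsFramePartition ρ s) (c : ℂ) (σ : ∀ p, L.Fiber p)
    (p : M) (hσ : MDifferentiableAt 𝓘(ℝ, B) (𝓘(ℝ, B).prod 𝓘(ℝ, ℂ))
      (fun p => (⟨p, σ p⟩ : TotalSpace ℂ L.Fiber)) p) (X : TangentSpace 𝓘(ℝ, B) p) :
    h.cov (fun q => c • σ q) p X = c • h.cov σ p X := by
  refine (gluedDeriv_apply _ _ _ _ _).trans (Eq.trans ?_
    (congrArg (c • ·) (gluedDeriv_apply _ _ _ _ _).symm))
  rw [Finset.smul_sum]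
  refine Finset.sum_congr rfl fun i _ => ?_
  by_cases hp : ρ i p = 0
  · rw [hp, zero_smul, zero_smul, smul_zero]
  · rw [frameDeriv_const_smul hσ (h.mdifferentiableAt_of_weight hp) (h.ne_zero_of_weight hp),
      smul_comm]

/-- Along a direction in which the frames are constant multiples of the frame `r`, the glued
connection is the one for which `r` is parallel. -/
lemma IsFramePartition.cov_eq_frameDeriv (h : IsFramePartition ρ s) {r σ : ∀ p, L.Fiber p}
    {p : M} {X : TangentSpace 𝓘(ℝ, B) p}
    (hσ : MDifferentiableAt 𝓘(ℝ, B) (𝓘(ℝ, B).prod 𝓘(ℝ, ℂ))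
      (fun p => (⟨p, σ p⟩ : TotalSpace ℂ L.Fiber)) p)
    (hr : MDifferentiableAt 𝓘(ℝ, B) (𝓘(ℝ, B).prod 𝓘(ℝ, ℂ))
      (fun p => (⟨p, r p⟩ : TotalSpace ℂ L.Fiber)) p)
    (h0 : ∀ᶠ q in 𝓝 p, r q ≠ 0)
    (hX : ∀ i, ρ i p ≠ 0 → mvfderiv 𝓘(ℝ, B) (fun q => ratio (r q) (s i q)) p X = 0) :
    h.cov σ p X = frameDeriv r σ p X := by
  refine (gluedDeriv_apply _ _ _ _ _).trans ?_
  have h1 : ∀ i, ρ i p • frameDeriv (s i) σ p X = ρ i p • frameDeriv r σ p X := by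
    intro i
    by_cases hp : ρ i p = 0
    · rw [hp, zero_smul, zero_smul]
    congr 1
    have hs := h.ne_zero_of_weight hp
    -- Write `σ/s = (σ/r)(r/s)`. As the derivative of `r/s` along `X` vanishes, the derivative of
    -- `σ/s` is `(r/s) d(σ/r)(X)`, and `(r/s) s = r`.
    have e1 : (fun q => ratio (σ q) (s i q)) =ᶠ[𝓝 p]
        fun q => ratio (σ q) (r q) * ratio (r q) (s i q) := by
      filter_upwards [h0] with q hq
      rw [← smul_ratio, ratio_smul _ hq]
    have e2 := (mdifferentiableAt_ratio hσ hr h0.self_of_nhds).hasMFDerivAt.mul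
      (mdifferentiableAt_ratio hr (h.mdifferentiableAt_of_weight hp) hs).hasMFDerivAt
    have e3 : mvfderiv 𝓘(ℝ, B) (fun q => ratio (σ q) (s i q)) p X =
        ratio (σ p) (r p) * mvfderiv 𝓘(ℝ, B) (fun q => ratio (r q) (s i q)) p X +
        ratio (r p) (s i p) * mvfderiv 𝓘(ℝ, B) (fun q => ratio (σ q) (r q)) p X :=
      congrArg (fun T : TangentSpace 𝓘(ℝ, B) p →L[ℝ] ℂ => T X) (e1.mfderiv_eq.trans e2.mfderiv)
    rw [frameDeriv_apply, frameDeriv_apply, e3, hX i hp, mul_zero, zero_add, mul_comm, mul_smul,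
      ratio_smul _ hs]
  rw [Finset.sum_congr rfl fun i _ => h1 i, ← Finset.sum_smul, h.sum_weight, one_smul]

end ComplexVectorBundle

end

/-! ### The Lie bracket as a commutator of derivatives -/

section

section LieBracket

variable {B : Type*} [NormedAddCommGroup B] [NormedSpace ℝ B] {M : Type*}
  [TopologicalSpace M] [ChartedSpace B M] [IsManifold 𝓘(ℝ, B) ∞ M]
  {F : Type*} [NormedAddCommGroup F] [NormedSpace ℝ F] {f : M → F} {p : M}
  {X Y : ∀ q : M, TangentSpace 𝓘(ℝ, B) q}

/-- A vector field in the chart around `p`. -/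
def chartField (p : M) (X : ∀ q : M, TangentSpace 𝓘(ℝ, B) q) : B → B :=
  VectorField.mpullbackWithin 𝓘(ℝ, B) 𝓘(ℝ, B) (extChartAt 𝓘(ℝ, B) p).symm X
    (Set.range 𝓘(ℝ, B))

/-- The chain rule, as the derivative of the inverse chart takes the field in the chart back to `X`.
-/
lemma fderiv_chartField {y : B} (hy : y ∈ (extChartAt 𝓘(ℝ, B) p).target)
    (hf : MDifferentiableAt 𝓘(ℝ, B) 𝓘(ℝ, F) f ((extChartAt 𝓘(ℝ, B) p).symm y)) :
    fderiv ℝ (f ∘ (extChartAt 𝓘(ℝ, B) p).symm) y (chartField p X y) =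
      mvfderiv 𝓘(ℝ, B) f ((extChartAt 𝓘(ℝ, B) p).symm y) (X ((extChartAt 𝓘(ℝ, B) p).symm y)) := by
  have h1 := isInvertible_mfderivWithin_extChartAt_symm (I := 𝓘(ℝ, B)) hy
  have h2 := mdifferentiableWithinAt_extChartAt_symm (I := 𝓘(ℝ, B)) hy
  have h3 := (hf.hasMFDerivAt.comp_hasMFDerivWithinAt y h2.hasMFDerivWithinAt
    (I' := 𝓘(ℝ, B))).hasFDerivWithinAt
  have h4 : ∀ T : B →L[ℝ] F,
      HasFDerivWithinAt (f ∘ (extChartAt 𝓘(ℝ, B) p).symm) T (Set.range 𝓘(ℝ, B)) y →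
      fderiv ℝ (f ∘ (extChartAt 𝓘(ℝ, B) p).symm) y = T := fun T h => by
    rw [modelWithCornersSelf_coe, Set.range_id, hasFDerivWithinAt_univ] at h
    exact h.fderiv
  refine (congrArg (fun T : B →L[ℝ] F => T (chartField p X y))
    (h4 _ h3)).trans ?_
  exact congrArg (mvfderiv 𝓘(ℝ, B) f ((extChartAt 𝓘(ℝ, B) p).symm y)) (h1.self_apply_inverse _)

lemma chartField_self : chartField p X (extChartAt 𝓘(ℝ, B) p p) = X p := by
  refine (mfderivWithin_extChartAt_symm_inverse_apply (I := 𝓘(ℝ, B)) (x := p) _).trans ?_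
  exact congrArg (fun q => (X q : B)) (extChartAt_to_inv p)

lemma mvfderiv_eq_fderiv_chart (hf : MDifferentiableAt 𝓘(ℝ, B) 𝓘(ℝ, F) f p)
    (v : TangentSpace 𝓘(ℝ, B) p) : mvfderiv 𝓘(ℝ, B) f p v =
      fderiv ℝ (f ∘ (extChartAt 𝓘(ℝ, B) p).symm) (extChartAt 𝓘(ℝ, B) p p) v := by
  have h := hf.hasMFDerivAt.2
  rw [modelWithCornersSelf_coe, Set.range_id] at h
  have h' : ∀ T : B →L[ℝ] F,
      HasFDerivAt (f ∘ (extChartAt 𝓘(ℝ, B) p).symm) T (extChartAt 𝓘(ℝ, B) p p) →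
      fderiv ℝ (f ∘ (extChartAt 𝓘(ℝ, B) p).symm) (extChartAt 𝓘(ℝ, B) p p) = T :=
    fun T h => h.fderiv
  exact (congrArg (fun T : B →L[ℝ] F => T v) (h' _ (hasFDerivWithinAt_univ.1 h))).symm

/-- At the centre of the chart the derivative of the chart is the identity, so the pullback in the
definition of the bracket has no effect there. -/
lemma mlieBracket_eq_chart : VectorField.mlieBracket 𝓘(ℝ, B) X Y p =
    VectorField.lieBracket ℝ (chartField p X) (chartField p Y) (extChartAt 𝓘(ℝ, B) p p) := by
  have h1 : VectorField.lieBracketWithin ℝ (chartField p X) (chartField p Y)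
      ((extChartAt 𝓘(ℝ, B) p).symm ⁻¹' Set.univ ∩ Set.range 𝓘(ℝ, B)) =
      VectorField.lieBracket ℝ (chartField p X) (chartField p Y) := by
    rw [Set.preimage_univ, Set.univ_inter, modelWithCornersSelf_coe, Set.range_id,
      VectorField.lieBracketWithin_univ]
  have h2 : (mfderiv 𝓘(ℝ, B) 𝓘(ℝ, B) (extChartAt 𝓘(ℝ, B) p) p).inverse =
      ContinuousLinearMap.id ℝ B := by
    rw [mfderiv_extChartAt_self]; exact ContinuousLinearMap.inverse_id
  refine (congrArg (fun T : B →L[ℝ] B => T _) h2).trans ?_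
  exact congrFun h1 _

lemma differentiableAt_chartField [CompleteSpace B] (hX : MDifferentiableAt 𝓘(ℝ, B) 𝓘(ℝ, B).tangent
      (fun p => (⟨p, X p⟩ : TangentBundle 𝓘(ℝ, B) M)) p) :
    DifferentiableAt ℝ (chartField p X) (extChartAt 𝓘(ℝ, B) p p) := by
  have h := (hX.mdifferentiableWithinAt (s := Set.univ)).differentiableWithinAt_mpullbackWithin_vectorField
  rw [Set.preimage_univ, Set.univ_inter] at h
  exact (show DifferentiableWithinAt ℝ (chartField p X) (Set.range 𝓘(ℝ, B)) _ from h).differentiableAt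
    (by rw [modelWithCornersSelf_coe, Set.range_id]; exact Filter.univ_mem)

/-- The equality holds on a neighbourhood, so both sides can be differentiated once more. -/
lemma comp_extChartAt_symm_eventuallyEq
    (hf : ∀ᶠ q in 𝓝 p, MDifferentiableAt 𝓘(ℝ, B) 𝓘(ℝ, F) f q) :
    (fun q => mvfderiv 𝓘(ℝ, B) f q (X q)) ∘ (extChartAt 𝓘(ℝ, B) p).symm
      =ᶠ[𝓝 (extChartAt 𝓘(ℝ, B) p p)]
    fun y => fderiv ℝ (f ∘ (extChartAt 𝓘(ℝ, B) p).symm) y (chartField p X y) := by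
  have h1 : Filter.Tendsto (extChartAt 𝓘(ℝ, B) p).symm (𝓝 (extChartAt 𝓘(ℝ, B) p p)) (𝓝 p) := by
    have := continuousAt_extChartAt_symm (I := 𝓘(ℝ, B)) p
    rwa [ContinuousAt, extChartAt_to_inv] at this
  filter_upwards [h1.eventually hf, extChartAt_target_mem_nhds (I := 𝓘(ℝ, B)) p] with y hy ht
  exact (fderiv_chartField ht hy).symm

lemma contDiffAt_comp_extChartAt_symm (hf : ContMDiffAt 𝓘(ℝ, B) 𝓘(ℝ, F) ∞ f p) :
    ContDiffAt ℝ ∞ (f ∘ (extChartAt 𝓘(ℝ, B) p).symm) (extChartAt 𝓘(ℝ, B) p p) := by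
  have h := (contMDiffAt_iff.1 hf).2
  rw [modelWithCornersSelf_coe, Set.range_id, contDiffWithinAt_univ] at h
  exact h

lemma two_le_infty : (2 : WithTop ℕ∞) ≤ ∞ := WithTop.coe_le_coe.2 le_top

lemma eventually_mdifferentiableAt (hf : ContMDiffAt 𝓘(ℝ, B) 𝓘(ℝ, F) ∞ f p) :
    ∀ᶠ q in 𝓝 p, MDifferentiableAt 𝓘(ℝ, B) 𝓘(ℝ, F) f q := by
  filter_upwards [(contMDiffAt_iff_contMDiffAt_nhds (n := 1) (by simp)).1 (hf.of_le (by simp))]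
    with q hq using hq.mdifferentiableAt one_ne_zero

/-- Needed to compute the second derivative in the chart, since a derivative on the manifold is zero
by definition at points of nondifferentiability. -/
lemma mdifferentiableAt_mvfderiv_apply [CompleteSpace B] (hf : ContMDiffAt 𝓘(ℝ, B) 𝓘(ℝ, F) ∞ f p)
    (hX : MDifferentiableAt 𝓘(ℝ, B) 𝓘(ℝ, B).tangent
      (fun p => (⟨p, X p⟩ : TangentBundle 𝓘(ℝ, B) M)) p) :
    MDifferentiableAt 𝓘(ℝ, B) 𝓘(ℝ, F) (fun q => mvfderiv 𝓘(ℝ, B) f q (X q)) p := by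
  have h1 := eventually_mdifferentiableAt hf
  have h2 : DifferentiableAt ℝ (fun y => fderiv ℝ (f ∘ (extChartAt 𝓘(ℝ, B) p).symm) y
      (chartField p X y)) (extChartAt 𝓘(ℝ, B) p p) :=
    (((contDiffAt_comp_extChartAt_symm hf).fderiv_right (m := 1) (by rw [one_add_one_eq_two]; exact two_le_infty)).differentiableAt
      one_ne_zero).clm_apply (differentiableAt_chartField hX)
  have h3 := (h2.congr_of_eventuallyEq (comp_extChartAt_symm_eventuallyEq h1)).mdifferentiableAt.comp
    p (mdifferentiableAt_extChartAt (I := 𝓘(ℝ, B)) (_root_.mem_chart_source B p))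
  refine h3.congr_of_eventuallyEq ?_
  filter_upwards [extChartAt_source_mem_nhds (I := 𝓘(ℝ, B)) p] with q hq
  rw [Function.comp_apply, Function.comp_apply, (extChartAt 𝓘(ℝ, B) p).left_inv hq]

lemma mvfderiv_mvfderiv [CompleteSpace B] (hf : ContMDiffAt 𝓘(ℝ, B) 𝓘(ℝ, F) ∞ f p)
    (hX : MDifferentiableAt 𝓘(ℝ, B) 𝓘(ℝ, B).tangent
      (fun p => (⟨p, X p⟩ : TangentBundle 𝓘(ℝ, B) M)) p) (v : TangentSpace 𝓘(ℝ, B) p) :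
    mvfderiv 𝓘(ℝ, B) (fun q => mvfderiv 𝓘(ℝ, B) f q (X q)) p v =
      fderiv ℝ (fun y => fderiv ℝ (f ∘ (extChartAt 𝓘(ℝ, B) p).symm) y (chartField p X y))
        (extChartAt 𝓘(ℝ, B) p p) v := by
  have h1 := eventually_mdifferentiableAt hf
  rw [mvfderiv_eq_fderiv_chart (mdifferentiableAt_mvfderiv_apply hf hX),
    (comp_extChartAt_symm_eventuallyEq h1).fderiv_eq]

/-- The derivative along the Lie bracket is the commutator of the derivatives. -/
lemma mvfderiv_mlieBracket [CompleteSpace B] (hf : ContMDiffAt 𝓘(ℝ, B) 𝓘(ℝ, F) ∞ f p)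
    (hX : MDifferentiableAt 𝓘(ℝ, B) 𝓘(ℝ, B).tangent
      (fun p => (⟨p, X p⟩ : TangentBundle 𝓘(ℝ, B) M)) p)
    (hY : MDifferentiableAt 𝓘(ℝ, B) 𝓘(ℝ, B).tangent
      (fun p => (⟨p, Y p⟩ : TangentBundle 𝓘(ℝ, B) M)) p) :
    mvfderiv 𝓘(ℝ, B) f p (VectorField.mlieBracket 𝓘(ℝ, B) X Y p) =
      mvfderiv 𝓘(ℝ, B) (fun q => mvfderiv 𝓘(ℝ, B) f q (Y q)) p (X p) -
        mvfderiv 𝓘(ℝ, B) (fun q => mvfderiv 𝓘(ℝ, B) f q (X q)) p (Y p) := by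
  -- In the chart all three terms are derivatives in a vector space, where the second derivatives of
  -- the function cancel by symmetry.
  rw [mvfderiv_mvfderiv hf hY, mvfderiv_mvfderiv hf hX,
    mvfderiv_eq_fderiv_chart (hf.mdifferentiableAt (by simp)), mlieBracket_eq_chart,
    VectorField.fderiv_apply_lieBracket (contDiffAt_comp_extChartAt_symm hf)
      (by simpa using two_le_infty) (differentiableAt_chartField hY) (differentiableAt_chartField hX),
    chartField_self, chartField_self]

end LieBracket

end

/-! ### Vertical directions -/

section

variable {N : ℕ} [NeZero N] {E : Type*} [NormedAddCommGroup E] [NormedSpace ℝ E]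
  {Z : Type*} [TopologicalSpace Z] [ChartedSpace E Z] {𝒜 : AzumayaBundle N E Z}
  [IsManifold 𝓘(ℝ, E) ∞ Z]

namespace TrivBundle

/-- In the chart around a point, the derivative of the projection to the base at this point is the
first projection. -/
lemma mfderiv_base_apply (q : TrivBundle 𝒜) (X : TangentSpace 𝓘(ℝ, E × slice N) q) :
    mfderiv 𝓘(ℝ, E × slice N) 𝓘(ℝ, E) (base : TrivBundle 𝒜 → Z) q X =
      Prod.fst (α := E) (β := slice N) X := by
  have h : HasMFDerivAt 𝓘(ℝ, E × slice N) 𝓘(ℝ, E) (base : TrivBundle 𝒜 → Z) q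
      (ContinuousLinearMap.fst ℝ E (slice N)) := by
    refine ⟨contMDiff_base.continuous.continuousAt, ?_⟩
    refine ((ContinuousLinearMap.fst ℝ E (slice N)).hasFDerivAt.congr_of_eventuallyEq
      ?_).hasFDerivWithinAt
    filter_upwards [extChartAt_target_mem_nhds (I := 𝓘(ℝ, E × slice N)) q] with x hx
    have hx' : x ∈ q.chart.target := by
      rw [extChartAt_target, modelWithCornersSelf_coe, modelWithCornersSelf_coe_symm] at hx
      exact hx.1
    exact (chartAt E q.base).right_inv hx'.1
  exact congrArg (fun T : E × slice N →L[ℝ] E => T X) h.mfderiv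

/-- The derivative in a vertical direction of a function which is constant on the fibres vanishes. -/
lemma mvfderiv_eq_zero_of_vertical {q : TrivBundle 𝒜} {h : TrivBundle 𝒜 → ℂ}
    (hd : MDifferentiableAt 𝓘(ℝ, E × slice N) 𝓘(ℝ, ℂ) h q)
    (hc : ∀ᶠ q' in 𝓝 q, q'.base = q.base → h q' = h q) {X : TangentSpace 𝓘(ℝ, E × slice N) q}
    (hX : mfderiv 𝓘(ℝ, E × slice N) 𝓘(ℝ, E) (base : TrivBundle 𝒜 → Z) q X = 0) :
    mvfderiv 𝓘(ℝ, E × slice N) h q X = 0 := by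
  rw [mfderiv_base_apply] at hX
  rw [mvfderiv_eq_fderiv_chart hd]
  set φ := extChartAt 𝓘(ℝ, E × slice N) q with hφ
  let x : E × slice N := X
  have hX' : x.1 = 0 := hX
  have h1 : DifferentiableAt ℝ (h ∘ φ.symm) (φ q) := by
    have := hd.differentiableWithinAt_writtenInExtChartAt
    rw [modelWithCornersSelf_coe, Set.range_id, differentiableWithinAt_univ] at this
    exact this
  -- A straight line in the chart in a vertical direction keeps its base coordinate, so for small
  -- `t` it stays in the fibre of `q`, where `h` is constant near `q`.
  have h2 : HasDerivAt (fun t : ℝ => φ q + t • x) x 0 := by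
    simpa using ((hasDerivAt_id (0 : ℝ)).smul_const x).const_add (φ q)
  have h3 : HasDerivAt (fun t : ℝ => (h ∘ φ.symm) (φ q + t • x)) (fderiv ℝ (h ∘ φ.symm) (φ q) x) 0 := by
    have h1' := h1.hasFDerivAt
    rw [show φ q = φ q + (0 : ℝ) • x by rw [zero_smul, add_zero]] at h1'
    have := h1'.comp_hasDerivAt (0 : ℝ) h2
    rwa [zero_smul, add_zero] at this
  have h4 : Filter.Tendsto (fun t : ℝ => φ q + t • x) (𝓝 0) (𝓝 (φ q)) := by
    have := h2.continuousAt.tendsto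
    simpa using this
  have h5 : Filter.Tendsto φ.symm (𝓝 (φ q)) (𝓝 q) := by
    have := continuousAt_extChartAt_symm (I := 𝓘(ℝ, E × slice N)) q
    rwa [ContinuousAt, extChartAt_to_inv] at this
  have h6 : (fun t : ℝ => (h ∘ φ.symm) (φ q + t • x)) =ᶠ[𝓝 0] fun _ => h q := by
    filter_upwards [(h5.comp h4).eventually hc] with t ht
    refine ht ?_
    change (chartAt E q.base).symm (chartAt E q.base q.base + t • x.1) = q.base
    rw [hX', smul_zero, add_zero]
    exact (chartAt E q.base).left_inv (_root_.mem_chart_source E _)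
  exact (h3.congr_of_eventuallyEq h6.symm).unique (hasDerivAt_const (0 : ℝ) (h q))

/-- Let `f` be the projection followed by a chart of `Z`. Near `p` the derivatives of `f` along `X`
and `Y` vanish identically, so `[X, Y] f = X(Y f) - Y(X f) = 0`. -/
lemma mlieBracket_vertical [CompleteSpace E] {X Y : ∀ q : TrivBundle 𝒜, TangentSpace 𝓘(ℝ, E × slice N) q}
    {p : TrivBundle 𝒜}
    (hX : MDifferentiableAt 𝓘(ℝ, E × slice N) 𝓘(ℝ, E × slice N).tangent
      (fun p => (⟨p, X p⟩ : TangentBundle 𝓘(ℝ, E × slice N) (TrivBundle 𝒜))) p)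
    (hY : MDifferentiableAt 𝓘(ℝ, E × slice N) 𝓘(ℝ, E × slice N).tangent
      (fun p => (⟨p, Y p⟩ : TangentBundle 𝓘(ℝ, E × slice N) (TrivBundle 𝒜))) p)
    (vX : ∀ p, mfderiv 𝓘(ℝ, E × slice N) 𝓘(ℝ, E) (TrivBundle.base (𝒜 := 𝒜)) p (X p) = 0)
    (vY : ∀ p, mfderiv 𝓘(ℝ, E × slice N) 𝓘(ℝ, E) (TrivBundle.base (𝒜 := 𝒜)) p (Y p) = 0) :
    mfderiv 𝓘(ℝ, E × slice N) 𝓘(ℝ, E) (TrivBundle.base (𝒜 := 𝒜)) p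
      (VectorField.mlieBracket 𝓘(ℝ, E × slice N) X Y p) = 0 := by
  have hc : ∀ q : TrivBundle 𝒜, q.base ∈ (chartAt E p.base).source → ∀ v,
      mvfderiv 𝓘(ℝ, E × slice N) (extChartAt 𝓘(ℝ, E) p.base ∘ TrivBundle.base (𝒜 := 𝒜)) q v =
      mfderiv 𝓘(ℝ, E) 𝓘(ℝ, E) (extChartAt 𝓘(ℝ, E) p.base) q.base
        (mfderiv 𝓘(ℝ, E × slice N) 𝓘(ℝ, E) (TrivBundle.base (𝒜 := 𝒜)) q v) := fun q hq v =>
    mfderiv_comp_apply q (mdifferentiableAt_extChartAt hq)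
      (contMDiff_base.mdifferentiableAt (by simp)) v
  have hev : ∀ᶠ q : TrivBundle 𝒜 in 𝓝 p, q.base ∈ (chartAt E p.base).source :=
    contMDiff_base.continuous.continuousAt.eventually_mem
      ((chartAt E p.base).open_source.mem_nhds (_root_.mem_chart_source E p.base))
  have hf : ContMDiffAt 𝓘(ℝ, E × slice N) 𝓘(ℝ, E) ∞
      (extChartAt 𝓘(ℝ, E) p.base ∘ TrivBundle.base (𝒜 := 𝒜)) p :=
    ContMDiffAt.comp p (contMDiffAt_extChartAt) contMDiff_base.contMDiffAt
  have hz : ∀ W : ∀ q : TrivBundle 𝒜, TangentSpace 𝓘(ℝ, E × slice N) q,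
      (∀ p, mfderiv 𝓘(ℝ, E × slice N) 𝓘(ℝ, E) (TrivBundle.base (𝒜 := 𝒜)) p (W p) = 0) →
      (fun q => mvfderiv 𝓘(ℝ, E × slice N)
        (extChartAt 𝓘(ℝ, E) p.base ∘ TrivBundle.base (𝒜 := 𝒜)) q (W q)) =ᶠ[𝓝 p] fun _ => 0 := by
    intro W hW
    filter_upwards [hev] with q hq
    rw [hc q hq, hW, map_zero]
    rfl
  have hb := mvfderiv_mlieBracket hf hX hY
  have e0 : ∀ W : ∀ q : TrivBundle 𝒜, TangentSpace 𝓘(ℝ, E × slice N) q,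
      (∀ p, mfderiv 𝓘(ℝ, E × slice N) 𝓘(ℝ, E) (TrivBundle.base (𝒜 := 𝒜)) p (W p) = 0) → ∀ v,
      mvfderiv 𝓘(ℝ, E × slice N) (fun q => mvfderiv 𝓘(ℝ, E × slice N)
        (extChartAt 𝓘(ℝ, E) p.base ∘ TrivBundle.base (𝒜 := 𝒜)) q (W q)) p v = 0 := by
    intro W hW v
    have := (hz W hW).mfderiv_eq (I := 𝓘(ℝ, E × slice N)) (I' := 𝓘(ℝ, E))
    rw [mfderiv_const] at this
    exact congrArg (fun T : E × slice N →L[ℝ] E => T v) this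
  -- The derivative of the chart of `Z` at its centre is the identity, so vanishing of the
  -- derivative of `f` is vanishing of that of the projection.
  rw [e0 Y vY, e0 X vX, sub_zero, hc p (_root_.mem_chart_source E p.base),
    mfderiv_extChartAt_self] at hb
  exact hb

end TrivBundle

end

/-! ### Every action on a line bundle is a fibre-holonomy action -/

section

variable {N : ℕ} [NeZero N] {E : Type*} [NormedAddCommGroup E] [NormedSpace ℝ E]
  {Z : Type*} [TopologicalSpace Z] [ChartedSpace E Z] {𝒜 : AzumayaBundle N E Z}
  [IsManifold 𝓘(ℝ, E) ∞ Z]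

namespace EquivariantBundle

open ComplexVectorBundle

variable {L : EquivariantBundle ℂ 𝒜}

lemma IsFibreFrame.mdifferentiableAt {O : Set (TrivBundle 𝒜)} {s : ∀ p, L.Fiber p}
    (h : L.IsFibreFrame O s) {p : TrivBundle 𝒜} (hp : p ∈ O) :
    MDifferentiableAt 𝓘(ℝ, E × slice N) (𝓘(ℝ, E × slice N).prod 𝓘(ℝ, ℂ))
      (fun p => (⟨p, s p⟩ : TotalSpace ℂ L.Fiber)) p :=
  (h.contMDiffAt p hp).mdifferentiableAt (by simp)

lemma IsFibreFrame.eventually_ne_zero {O : Set (TrivBundle 𝒜)} {s : ∀ p, L.Fiber p}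
    (h : L.IsFibreFrame O s) {p : TrivBundle 𝒜} (hp : p ∈ O) : ∀ᶠ q in 𝓝 p, s q ≠ 0 := by
  filter_upwards [h.isOpen.mem_nhds hp] with q hq using h.ne_zero q hq

/-- The ratio of two fibre frames is locally constant on the fibres. -/
lemma IsFibreFrame.mvfderiv_ratio {O O' : Set (TrivBundle 𝒜)} {r s : ∀ p, L.Fiber p}
    (hr : L.IsFibreFrame O r) (hs : L.IsFibreFrame O' s) {p : TrivBundle 𝒜} (hp : p ∈ O)
    (hp' : p ∈ O') {X : TangentSpace 𝓘(ℝ, E × slice N) p}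
    (hX : mfderiv 𝓘(ℝ, E × slice N) 𝓘(ℝ, E) (TrivBundle.base (𝒜 := 𝒜)) p X = 0) :
    mvfderiv 𝓘(ℝ, E × slice N) (fun q => ratio (r q) (s q)) p X = 0 := by
  refine TrivBundle.mvfderiv_eq_zero_of_vertical (mdifferentiableAt_ratio
    (hr.mdifferentiableAt hp) (hs.mdifferentiableAt hp') (hs.ne_zero p hp')) ?_ hX
  -- Nearby points of the fibre are `g • p` with `g` close to `1`. There both frames are the images
  -- under `g` of their values at `p`, so the ratio is unchanged.
  filter_upwards [p.eventually_exists_smul ((hr.eventually_act p hp).and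
    (hs.eventually_act p hp'))] with q hq hb
  obtain ⟨g, ⟨h1, h2⟩, rfl⟩ := hq hb
  have h0 : s (g • p) ≠ 0 := by
    rw [h2]
    intro h
    exact hs.ne_zero p hp' (L.act_injective g p (h.trans (map_zero _).symm))
  refine ratio_eq h0 ?_
  rw [h1, h2, ← map_smul, ratio_smul _ (hs.ne_zero p hp')]

variable (L) in
/-- There are finitely many fibre frames with a subordinate smooth partition of unity. -/
lemma exists_isFramePartition [FiniteDimensional ℝ E] [T2Space Z] [CompactSpace Z] :
    ∃ (t : Finset (TrivBundle 𝒜)) (ρ : t → TrivBundle 𝒜 → ℝ) (s : t → ∀ p, L.Fiber p)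
      (O : t → Set (TrivBundle 𝒜)), IsFramePartition (L := L.toComplexVectorBundle) ρ s ∧
      (∀ i, L.IsFibreFrame (O i) (s i)) ∧ ∀ i, tsupport (ρ i) ⊆ O i := by
  -- Compactness of the bundle of trivializations makes the family finite, so the glued connection
  -- is a finite sum.
  obtain ⟨t, ht⟩ := isCompact_univ.elim_finite_subcover (fun p₀ => L.frameDom p₀)
    (fun p₀ => L.isOpen_frameDom p₀) fun p₀ _ => Set.mem_iUnion.2 ⟨p₀, L.mem_frameDom p₀⟩
  obtain ⟨f, hf⟩ := SmoothPartitionOfUnity.exists_isSubordinate 𝓘(ℝ, E × slice N) isClosed_univ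
    (fun p₀ : t => L.frameDom p₀.1) (fun p₀ => L.isOpen_frameDom p₀.1) (fun p hp => by
      obtain ⟨p₀, hp₀, h⟩ := Set.mem_iUnion₂.1 (ht hp)
      exact Set.mem_iUnion.2 ⟨⟨p₀, hp₀⟩, h⟩)
  have hs : ∀ p₀ : t, L.IsFibreFrame (L.frameDom p₀.1) (L.invariantSec p₀.1 1) :=
    fun p₀ => L.isFibreFrame_invariantSec p₀.1 one_ne_zero
  refine ⟨t, fun i => f i, fun i => L.invariantSec i.1 1,
    fun i => L.frameDom i.1, ⟨fun i => (f i).contMDiff, fun p => ?_, fun i p hp =>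
    (hs i).ne_zero p (hf i hp), fun i p hp => (hs i).contMDiffAt p (hf i hp)⟩, hs, hf⟩
  have := f.sum_eq_one (Set.mem_univ p)
  rwa [finsum_eq_sum_of_fintype] at this

section Partition

variable {ι : Type*} [Fintype ι] {ρ : ι → TrivBundle 𝒜 → ℝ} {s : ι → ∀ p, L.Fiber p}
  {O : ι → Set (TrivBundle 𝒜)} (h : IsFramePartition (L := L.toComplexVectorBundle) ρ s)
  (hO : ∀ i, L.IsFibreFrame (O i) (s i)) (hρ : ∀ i, tsupport (ρ i) ⊆ O i)

/-- In vertical directions the glued connection is the one for which any fibre frame is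
parallel. -/
lemma cov_apply_of_vertical (hO : ∀ i, L.IsFibreFrame (O i) (s i))
    (hρ : ∀ i, tsupport (ρ i) ⊆ O i) {U : Set (TrivBundle 𝒜)} {r σ : ∀ p, L.Fiber p}
    (hr : L.IsFibreFrame U r) {p : TrivBundle 𝒜} (hp : p ∈ U)
    (hσ : MDifferentiableAt 𝓘(ℝ, E × slice N) (𝓘(ℝ, E × slice N).prod 𝓘(ℝ, ℂ))
      (fun p => (⟨p, σ p⟩ : TotalSpace ℂ L.Fiber)) p) {X : TangentSpace 𝓘(ℝ, E × slice N) p}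
    (hX : mfderiv 𝓘(ℝ, E × slice N) 𝓘(ℝ, E) (TrivBundle.base (𝒜 := 𝒜)) p X = 0) :
    h.cov σ p X = mvfderiv 𝓘(ℝ, E × slice N) (fun q => ratio (σ q) (r q)) p X • r p :=
  h.cov_eq_frameDeriv hσ (hr.mdifferentiableAt hp) (hr.eventually_ne_zero hp) fun i hi =>
    hr.mvfderiv_ratio (hO i) hp (hρ i (subset_tsupport _ hi)) hX

lemma isConnection_cov : IsConnection L h.cov :=
  ⟨h.contMDiffCovariantDerivative, fun c σ p hσ X => h.cov_const_smul c σ p hσ X⟩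

/-- Makes `∇_X σ` a smooth section, to which the formula for vertical directions can be applied
again in the curvature. -/
lemma contMDiff_cov_apply {σ : ∀ p, L.Fiber p}
    {X : ∀ p : TrivBundle 𝒜, TangentSpace 𝓘(ℝ, E × slice N) p}
    (hσ : ContMDiff 𝓘(ℝ, E × slice N) (𝓘(ℝ, E × slice N).prod 𝓘(ℝ, ℂ)) ∞
      (fun p => (⟨p, σ p⟩ : TotalSpace ℂ L.Fiber)))
    (hX : ContMDiff 𝓘(ℝ, E × slice N) 𝓘(ℝ, E × slice N).tangent ∞
      (fun p => (⟨p, X p⟩ : TangentBundle 𝓘(ℝ, E × slice N) (TrivBundle 𝒜)))) :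
    ContMDiff 𝓘(ℝ, E × slice N) (𝓘(ℝ, E × slice N).prod 𝓘(ℝ, ℂ)) ∞
      (fun p => (⟨p, h.cov σ p (X p)⟩ : TotalSpace ℂ L.Fiber)) := by
  have h1 := h.contMDiffCovariantDerivative.contMDiff.contMDiff (σ := σ)
    (by rw [show (∞ + 1 : WithTop ℕ∞) = ∞ from by simp]; exact hσ.contMDiffOn)
  exact (contMDiffOn_univ.1 h1).clm_bundle_apply hX

/-- With an invariant frame `r` around `p` and `f = σ / r`, vertical derivatives are `∇_X σ = X(f)
r`. The bracket of vertical fields is vertical, so the curvature is `(X Y f - Y X f - [X, Y] f) r =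
0`. -/
lemma isFibreFlat_cov [FiniteDimensional ℝ E] (hO : ∀ i, L.IsFibreFrame (O i) (s i))
    (hρ : ∀ i, tsupport (ρ i) ⊆ O i) : IsFibreFlat L h.cov := by
  have : CompleteSpace E := FiniteDimensional.complete ℝ E
  intro X Y σ hX hY hσ vX vY p
  have hr := L.isFibreFrame_invariantSec p (w := (1 : ℂ)) one_ne_zero
  set r := L.invariantSec p (1 : ℂ)
  have hp := L.mem_frameDom p
  set U := L.frameDom p
  have key : ∀ {τ : ∀ p, L.Fiber p}, ContMDiff 𝓘(ℝ, E × slice N)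
      (𝓘(ℝ, E × slice N).prod 𝓘(ℝ, ℂ)) ∞ (fun p => (⟨p, τ p⟩ : TotalSpace ℂ L.Fiber)) →
      ∀ q ∈ U, ∀ v, mfderiv 𝓘(ℝ, E × slice N) 𝓘(ℝ, E) (TrivBundle.base (𝒜 := 𝒜)) q v = 0 →
      h.cov τ q v = mvfderiv 𝓘(ℝ, E × slice N) (fun q => ratio (τ q) (r q)) q v • r q :=
    fun hτ q hq v hv => cov_apply_of_vertical h hO hρ hr hq (hτ.mdifferentiableAt (by simp)) hv
  -- As `W` is vertical everywhere, the formula for `∇_W σ` holds on a neighbourhood of `p` and not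
  -- only at `p`, so it can be differentiated.
  have key2 : ∀ {W : ∀ p : TrivBundle 𝒜, TangentSpace 𝓘(ℝ, E × slice N) p},
      (∀ p, mfderiv 𝓘(ℝ, E × slice N) 𝓘(ℝ, E) (TrivBundle.base (𝒜 := 𝒜)) p (W p) = 0) →
      ∀ v, mvfderiv 𝓘(ℝ, E × slice N) (fun q => ratio (h.cov σ q (W q)) (r q)) p v =
        mvfderiv 𝓘(ℝ, E × slice N) (fun q =>
          mvfderiv 𝓘(ℝ, E × slice N) (fun q => ratio (σ q) (r q)) q (W q)) p v := by
    intro W hW v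
    have e : (fun q => ratio (h.cov σ q (W q)) (r q)) =ᶠ[𝓝 p] fun q =>
        mvfderiv 𝓘(ℝ, E × slice N) (fun q => ratio (σ q) (r q)) q (W q) := by
      filter_upwards [hr.isOpen.mem_nhds hp] with q hq
      exact ratio_eq (hr.ne_zero q hq) (key hσ q hq _ (hW q))
    exact congrArg (fun T : E × slice N →L[ℝ] ℂ => T v)
      (e.mfderiv_eq (I := 𝓘(ℝ, E × slice N)) (I' := 𝓘(ℝ, ℂ)))
  have hX' := (hX p).mdifferentiableAt (n := ∞) (by simp)
  have hY' := (hY p).mdifferentiableAt (n := ∞) (by simp)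
  rw [key (contMDiff_cov_apply h hσ hY) p hp _ (vX p), key (contMDiff_cov_apply h hσ hX) p hp _ (vY p),
    key hσ p hp _ (TrivBundle.mlieBracket_vertical hX' hY' vX vY), key2 vY, key2 vX,
    mvfderiv_mlieBracket (contMDiffAt_ratio le_rfl (hσ p) (hr.contMDiffAt p hp)
      (hr.ne_zero p hp)) hX' hY', ← sub_smul, ← sub_smul, sub_self, zero_smul]

/-- Near `t₀` one has `c(t) = (c(t) c(t₀)⁻¹) c(t₀)` with first factor close to `1`, so `c(t) · l` is
an invariant frame around `c(t₀) • p` times a constant. The frame is parallel in vertical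
directions, and the curve is vertical. -/
lemma isParallel_act (hO : ∀ i, L.IsFibreFrame (O i) (s i))
    (hρ : ∀ i, tsupport (ρ i) ⊆ O i) {c : ℝ → SU N} (hc : ContDiff ℝ ∞ fun t => (c t : Mat N))
    (p : TrivBundle 𝒜) (l : L.Fiber p) :
    IsParallel L h.cov (fun t => c t • p) (fun t => L.act (c t) p l) := by
  intro t₀
  set q := c t₀ • p with hq
  have hr := L.isFibreFrame_invariantSec q (w := (1 : ℂ)) one_ne_zero
  set r := L.invariantSec q (1 : ℂ)
  have hp := L.mem_frameDom q
  set k := ratio (L.act (c t₀) p l) (r q) with hk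
  have hkr : L.act (c t₀) p l = k • r q := (ratio_smul _ (hr.ne_zero q hp)).symm
  refine ⟨r, fun _ => k, hr.contMDiffAt q hp, differentiableAt_const _, ?_, ?_⟩
  · have h1 : Filter.Tendsto (fun t => c t * (c t₀)⁻¹) (𝓝 t₀) (𝓝 1) := by
      have h2 : Continuous c := continuous_induced_rng.2 hc.continuous
      have h3 : Continuous fun t => c t * (c t₀)⁻¹ :=
        continuous_induced_rng.2 (hc.continuous.mul continuous_const)
      have h4 := h3.tendsto t₀
      rwa [mul_inv_cancel] at h4
    filter_upwards [h1.eventually (hr.eventually_act q hp)] with t ht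
    apply TotalSpace.mk_injective (F := ℂ) (c t • p)
    have e1 : (c t * (c t₀)⁻¹) • q = c t • p := by rw [hq, smul_smul, inv_mul_cancel_right]
    -- The frame has values in fibres depending on the point, so equality of points is used in the
    -- total space.
    have e2 : ∀ q' : TrivBundle 𝒜, q' = c t • p →
        (⟨q', k • r q'⟩ : TotalSpace ℂ L.Fiber) = ⟨c t • p, k • r (c t • p)⟩ := by
      rintro _ rfl; rfl
    refine Eq.trans ?_ (e2 _ e1)
    rw [ht, ← map_smul, ← hkr]
    change L.smulTotal (c t) ⟨p, l⟩ =
      L.smulTotal (c t * (c t₀)⁻¹) (L.smulTotal (c t₀) ⟨p, l⟩)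
    rw [← smulTotal_mul, inv_mul_cancel_right]
  · rw [deriv_const, zero_smul, zero_add]
    have hv : mfderiv 𝓘(ℝ, E × slice N) 𝓘(ℝ, E) (TrivBundle.base (𝒜 := 𝒜)) q
        (mfderiv 𝓘(ℝ, ℝ) 𝓘(ℝ, E × slice N) (fun t => c t • p) t₀ (1 : ℝ)) = 0 := by
      -- If the curve were not differentiable, its `mfderiv` would be zero by definition and so
      -- vertical; hence differentiability of the orbit curve need not be shown.
      by_cases hd : MDifferentiableAt 𝓘(ℝ, ℝ) 𝓘(ℝ, E × slice N) (fun t => c t • p) t₀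
      · have e := mfderiv_comp_apply (I := 𝓘(ℝ, ℝ)) (I' := 𝓘(ℝ, E × slice N)) (I'' := 𝓘(ℝ, E))
          (g := TrivBundle.base (𝒜 := 𝒜)) t₀ (TrivBundle.contMDiff_base.mdifferentiableAt (by simp))
          hd (1 : ℝ)
        have e' : TrivBundle.base (𝒜 := 𝒜) ∘ (fun t => c t • p) = fun _ => p.base := rfl
        rw [e', mfderiv_const] at e
        exact e.symm
      · rw [mfderiv_zero_of_not_mdifferentiableAt hd]
        exact map_zero _
    have e1 : (fun q => ratio (r q) (r q)) =ᶠ[𝓝 q] fun _ => (1 : ℂ) := by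
      filter_upwards [hr.eventually_ne_zero hp] with q' hq' using ratio_self hq'
    have e2 : mvfderiv 𝓘(ℝ, E × slice N) (fun q => ratio (r q) (r q)) q = 0 := by
      have := e1.mfderiv_eq (I := 𝓘(ℝ, E × slice N)) (I' := 𝓘(ℝ, ℂ))
      rw [mfderiv_const] at this
      exact this
    have e3 := cov_apply_of_vertical h hO hρ hr hp (hr.mdifferentiableAt hp) hv
    refine (congrArg (k • ·) e3).trans ?_
    rw [e2]
    simp

end Partition

variable (L) in
/-- Every action of `SU(N)` on a line bundle over the bundle of trivializations is a fibre-holonomy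
action. -/
theorem isFibreHolonomy [FiniteDimensional ℝ E] [T2Space Z] [CompactSpace Z] :
    IsFibreHolonomy L := by
  obtain ⟨t, ρ, s, O, h, hO, hρ⟩ := L.exists_isFramePartition
  exact ⟨h.cov, isConnection_cov h, isFibreFlat_cov h hO hρ,
    fun c hc _ p l => isParallel_act h hO hρ hc p l⟩

end EquivariantBundle

end

end

end ProjectiveBundle

/-! ### The theorem -/

theorem mainTheorem8 {E : Type uE} [NormedAddCommGroup E] [NormedSpace ℝ E] [FiniteDimensional ℝ E]
    {Z : Type uZ} [TopologicalSpace Z] [T2Space Z] [CompactSpace Z] [ChartedSpace E Z]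
    [IsManifold (modelWithCornersSelf ℝ E) ((⊤ : ℕ∞) : WithTop ℕ∞) Z] {N : ℕ} [NeZero N]
    (𝒜 : ProjectiveBundle.AzumayaBundle.{uE, uZ, uA} N E Z)
    (V : ProjectiveBundle.RepresentingBundle.{uE, uZ, uA, uV} 𝒜) :
    ∃ L : ProjectiveBundle.EquivariantBundle.{uE, uZ, 0, uA, uV} ℂ 𝒜,
      ProjectiveBundle.IsFibreHolonomy L ∧
      Nonempty (V.Equivalence (ProjectiveBundle.RepresentingBundle.twist L
        (ProjectiveBundle.RepresentingBundle.standard 𝒜))) := by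
  exact ⟨V.equivariantLine, V.equivariantLine.isFibreHolonomy, ⟨V.twistEquivalence⟩⟩
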